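/- **Theorem.** There is a constant $C$ such that for every connected chordal graph $G=(V,E)$ with $V=\{0,\dots,n-1\}$, given by adjacency lists (in any order), the Clique-Picking algorithm described below stops after at most $C\cdot|\Pi(G)|^2\cdot(|V|+|E|)$ steps on a random access machine in which array accesses and arithmetic operations on integers have unit cost and creating an array of $k$ cells costs $k+1$ steps. Here $\Pi(G)$ is the set of maximal cliques of $G$, and a graph is chordal if no set of four or more vertices induces a cycle. *The algorithm.* It evaluates $\mathrm{count}(G)$, where for a connected induced subgraph $H=G[U]$ the function $\mathrm{count}(H)$ does the following. 1. If a value for $H$ is stored in the memo table, return it. (The table is a trie whose keys are the increasing lists of the elements of $U$; each new trie node gets a new array of $n$ pointers.) 2. Compute a rooted clique tree $(T,r,\iota)$ of $H$, i.e. a rooted tree $T$ with a bijection $\iota$ from its nodes to $\Pi(H)$ such that for every vertex $u$ the nodes $x$ with $u\in\iota(x)$ form a subtree. To this end the vertices are processed in the order of a lexicographic breadth-first search of $H$. Let $P$ be the set of neighbours of $v$ that precede $v$, and let $Q$ be the clique to which the last vertex of $P$ was assigned. If $P=Q$, then $v$ is added to $Q$ and assigned to it; otherwise $P\cup\{v\}$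 is a new clique, a child of $Q$, and $v$ is assigned to it (the first vertex starts the root clique). 3. Set $\mathrm{sum}=0$ and traverse $T$ from the root with a queue. For each node $v$: - compute the list $\mathcal C_H(\iota(v))$ of vertex sets by the search below, and let $\mathrm{prod}$ be the product of $\mathrm{count}(G[W])$ over all $W$ in this list; - on the path $r=x_1,\dots,x_p=v$ collect the set $\{X_1\subsetneq\dots\subsetneq X_\ell\}$ of those $\iota(x_i)\cap\iota(x_{i+1})$ that are contained in $\iota(v)$, by walking from $v$ to $r$; - compute $\varphi(\iota(v),\{X_1,\dots,X_\ell\})$, the number of permutations of $\iota(v)$ that have no $X_i$ as a prefix, by the recursion $\varphi(S,\{X_1,\dots,X_\ell\})=|S|!-\sum_{i=1}^{\ell}|S\setminus X_i|!\cdot\varphi(X_i,\{X_1,\dots,X_{i-1}\})$, evaluating each $\varphi(X_i,\{X_1,\dots,X_{i-1}\})$ once and using a table of factorials; - add $\varphi(\iota(v),\{X_1,\dots,X_\ell\})\cdot\mathrm{prod}$ to $\mathrm{sum}$. 4. Store $\mathrm{sum}$ as the value for $H$ and return it. *The search.* For a clique $K$ of $H=G[U]$, start with the sequence of sets $\mathcal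 S=(K,U\setminus K)$ and $L=\emptyset$. As long as $\mathcal S$ contains a non-empty set, let $X$ be the first such set and $v\in X$. If $v$ lies neither in $K$ nor in a set in $L$, add $X$ to $L$. Remove $v$ from $X$, and replace every set $S$ of $\mathcal S$ by the two sets $S\cap N(v),\ S\setminus N(v)$, in this order. The sets of $\mathcal S$ are kept as consecutive segments of one array of the vertices, with the position and the set of each vertex stored, so that each neighbour of $v$ is moved in constantly many steps. Finally $\mathcal C_H(K)$ consists of the vertex sets of the connected components of the graphs $G[X]$, $X\in L$, found by graph traversal. For $K=\emptyset$ the order of the visits is that of a lexicographic breadth-first search. -/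

import Mathlib

/-! ### Chordal graphs -/

namespace SimpleGraph

/-- A graph is chordal if no set of four or more vertices induces a cycle. -/
def IsChordalGraph {V : Type*} (G : SimpleGraph V) : Prop :=
  ∀ k : ℕ, 4 ≤ k → IsEmpty (cycleGraph k ↪g G)

/-- `Π(G)`, the set of all maximal cliques. -/
def maximalCliques {V : Type*} (G : SimpleGraph V) : Set (Set V) :=
  {K | Maximal G.IsClique K}

end SimpleGraph

namespace CliquePicking

/-- `adj` is an adjacency-list representation of `G`: the list `adj v` enumerates the neighbours
of `v`, each of them once, in an arbitrary order. -/
def IsAdjList {n : ℕ} (G : SimpleGraph (Fin n)) (adj : Fin n → List (Fin n)) : Prop :=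
  ∀ v, (adj v).Nodup ∧ ∀ w, w ∈ adj v ↔ G.Adj v w

/-! ### The cost model

A random access machine with unit-cost operations on cells that hold a natural number, a truth
value, a vertex or a pointer. A computation is a value together with the number of steps spent on it.
Charged with one step are: reading an array cell, writing an array cell, an arithmetic operation on
the numbers that are counted, adding an element to a linked list, every iteration of a loop and
leaving a loop. Creating an array with `k` cells costs `k + 1` steps. Between two charged
operations there is only a bounded number of comparisons, increments of counters, and accesses to
the head of a linked list, each of which takes constant time. Arrays are functions from the index set; every array is
used single-threadedly, i.e. after a write only the new version is ever accessed. -/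

/-- A value together with the number of steps that were spent to compute it. -/
structure Timed (α : Type) where
  val : α
  time : ℕ

instance : Monad Timed where
  pure a := ⟨a, 0⟩
  bind x f := ⟨(f x.val).val, x.time + (f x.val).time⟩

/-- One elementary step with result `a`. -/
def op {α : Type} (a : α) : Timed α := ⟨a, 1⟩

/-- A new array with `k` cells, all of them filled with `a`. -/
def newArr {ι α : Type} (k : ℕ) (a : α) : Timed (ι → α) := ⟨fun _ => a, k + 1⟩

/-- Read a cell of an array. -/
def rd {ι α : Type} (a : ι → α) (i : ι) : Timed α := op (a i)

/-- Write a cell of an array. -/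
def wr {ι α : Type} [DecidableEq ι] (a : ι → α) (i : ι) (x : α) : Timed (ι → α) :=
  op (Function.update a i x)

/-- `for b in l do s ← f b s`. -/
def forEach {β σ : Type} : List β → σ → (β → σ → Timed σ) → Timed σ
  | [], s, _ => op s
  | b :: l, s, f => do
    let s ← op s
    let s ← f b s
    forEach l s f

/-- `while cond s do s ← body s`, given a bound on the number of iterations. The bound serves only
to make the definition a total function; below it is always at least the number of iterations that
are needed until the condition fails. -/
def whileDo {σ : Type} : ℕ → (σ → Bool) → (σ → Timed σ) → σ → Timed σ
  | 0, _, _, s => op s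
  | k + 1, cond, body, s =>
    if cond s then do
      let s ← op s
      let s ← body s
      whileDo k cond body s
    else op s

section Program

variable {n : ℕ} [NeZero n]

/-- The characteristic array of a list of vertices. -/
def mark (U : List (Fin n)) : Timed (Fin n → Bool) := do
  let a ← newArr n false
  forEach U a fun v a => wr a v true

/-- The length of a linked list. -/
def len {α : Type} (l : List α) : Timed ℕ :=
  forEach l 0 fun _ k => op (k + 1)

/-! ### Lexicographic breadth-first search by partition refinement

All graphs that occur are induced subgraphs `G[U]` of the input graph `G`. They are given by the
list of the elements of `U` and the adjacency lists of `G`. -/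

/-- The state of the search in `G[U]`. In round `i` the positions `0, …, i - 1` of `perm` hold the
visited vertices in the order `τ` of their visits. The positions from `i` on hold the
sequence `𝒮` of sets of unvisited vertices, one set after the other: the set with number `c` occupies
the positions `start c, …, finish c - 1`. -/
structure Search (n : ℕ) where
  /-- the vertex at a position -/
  perm : ℕ → Fin n
  /-- the position of a vertex -/
  pos : Fin n → ℕ
  /-- the number of the set that contains a vertex -/
  cls : Fin n → ℕ
  start : ℕ → ℕ
  finish : ℕ → ℕ
  /-- `i + 1` if the set has been split in round `i` -/
  stamp : ℕ → ℕ
  /-- if the set `S` has been split in the current round at `v`, the number of `S ∩ N(v)`;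
  the set `S \ N(v)` keeps the number of `S` -/
  twin : ℕ → ℕ
  /-- the number of set numbers in use -/
  next : ℕ
  /-- `i + 1` for the vertices of the set that is added to `L` in round `i`, and `0` for the
  vertices that are in no set in `L` -/
  lab : Fin n → ℕ

/-- Put `v` at position `k`, into the set with number `c`. -/
def place (v : Fin n) (k c : ℕ) (s : Search n) : Timed (Search n) := do
  let perm ← wr s.perm k v
  let pos ← wr s.pos v k
  let cls ← wr s.cls v c
  pure { s with perm := perm, pos := pos, cls := cls }

/-- The initial state, with `𝒮 = (K, U \ K)`. The number `D` is the sum of the lengths of the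
adjacency lists; at most `D` set numbers are introduced later. -/
def initSearch (D : ℕ) (U K : List (Fin n)) (inK : Fin n → Bool) : Timed (Search n) := do
  let perm ← newArr n 0
  let pos ← newArr n 0
  let cls ← newArr n 0
  let start ← newArr (D + 2) 0
  let finish ← newArr (D + 2) 0
  let stamp ← newArr (D + 2) 0
  let twin ← newArr (D + 2) 0
  let lab ← newArr n 0
  let s : Search n := ⟨perm, pos, cls, start, finish, stamp, twin, 2, lab⟩
  let a ← forEach K (s, 0) fun v t => do
    let s ← place v t.2 0 t.1
    pure (s, t.2 + 1)
  let b ← forEach U a fun v t => do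
    let m ← rd inK v
    if m then pure t else do
      let s ← place v t.2 1 t.1
      pure (s, t.2 + 1)
  let finish ← wr b.1.finish 0 a.2
  let start ← wr b.1.start 1 a.2
  let finish ← wr finish 1 b.2
  pure { b.1 with start := start, finish := finish }

/-- Move the unvisited neighbour `w` of the vertex visited in round `i` from its set `S` to the
set `S ∩ N(v)`, which is placed directly before `S \ N(v)`. -/
def refine (i : ℕ) (w : Fin n) (s : Search n) : Timed (Search n) := do
  let d ← rd s.cls w
  let f ← rd s.start d
  let r ← rd s.stamp d
  let s ← (if r = i + 1 then pure s else do
    let stamp ← wr s.stamp d (i + 1)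
    let twin ← wr s.twin d s.next
    let start ← wr s.start s.next f
    let finish ← wr s.finish s.next f
    pure { s with stamp := stamp, twin := twin, start := start, finish := finish, next := s.next + 1 })
  let e ← rd s.twin d
  let x ← rd s.perm f
  let q ← rd s.pos w
  let perm ← wr s.perm q x
  let perm ← wr perm f w
  let pos ← wr s.pos x q
  let pos ← wr pos w f
  let start ← wr s.start d (f + 1)
  let finish ← wr s.finish e (f + 1)
  let cls ← wr s.cls w e
  pure { s with perm := perm, pos := pos, start := start, finish := finish, cls := cls }

/-- Round `i`: the vertex `v` at position `i` is a vertex of the first non-empty set `X` of `𝒮`. If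
`v` is neither in `K` nor in a set in `L`, then `X` is added to `L`. Then `v` is removed from
`X` and every set `S` of `𝒮` is replaced by `S ∩ N(v), S \ N(v)`. -/
def visit (adj : Fin n → List (Fin n)) (inU inK : Fin n → Bool) (i : ℕ) (s : Search n) :
    Timed (Search n) := do
  let v ← rd s.perm i
  let c ← rd s.cls v
  let l ← rd s.lab v
  let k ← rd inK v
  let lab ← (if l = 0 ∧ k = false then do
      let e ← rd s.finish c
      forEach (List.range' i (e - i)) s.lab fun j lab => do
        let x ← rd s.perm j
        wr lab x (i + 1)
    else pure s.lab)
  let start ← wr s.start c (i + 1)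
  let N ← rd adj v
  forEach N { s with lab := lab, start := start } fun w s => do
    let u ← rd inU w
    let q ← rd s.pos w
    if u = true ∧ i < q then refine i w s else pure s

/-- The modified lexicographic breadth-first search of `G[U]` that starts with the clique `K`.
For `K = []` the order of the visits is the one of a usual lexicographic breadth-first search. -/
def lbfs (adj : Fin n → List (Fin n)) (D : ℕ) (U K : List (Fin n)) (inU inK : Fin n → Bool) :
    Timed (Search n) := do
  let s ← initSearch D U K inK
  let m ← len U
  forEach (List.range m) s fun i s => visit adj inU inK i s

/-- The connected components of the graphs `G[X]`, where `X` ranges over the sets in `L`, found by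
graph traversal. The vertices of each component are listed in the same order as in `U`. -/
def components (adj : Fin n → List (Fin n)) (U : List (Fin n)) (lab : Fin n → ℕ) :
    Timed (List (List (Fin n))) := do
  let comp ← newArr n 0
  let t ← forEach U (comp, 0) fun v t => do
    let l ← rd lab v
    let c ← rd t.1 v
    if l = 0 ∨ c ≠ 0 then pure t else do
      let k := t.2 + 1
      let comp ← wr t.1 v k
      let r ← whileDo n (fun r : List (Fin n) × (Fin n → ℕ) => !r.1.isEmpty)
        (fun r => match r.1 with
          | [] => pure r
          | x :: stack => do
            let N ← rd adj x
            forEach N (stack, r.2) fun w r => do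
              let l' ← rd lab w
              let c' ← rd r.2 w
              if l' = l ∧ c' = 0 then do
                let comp ← wr r.2 w k
                let stack ← op (w :: r.1)
                pure (stack, comp)
              else pure r)
        ([v], comp)
      pure (r.2, k)
  let rev ← forEach U [] fun v acc => op (v :: acc)
  let bucket ← newArr (n + 1) []
  let bucket ← forEach rev bucket fun v b => do
    let c ← rd t.1 v
    let l ← rd b c
    wr b c (v :: l)
  forEach (List.range t.2) [] fun i acc => do
    let H ← rd bucket (i + 1)
    op (H :: acc)

/-- `𝒞_G[U](K)`, computed by the modified lexicographic breadth-first search. -/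
def subproblems (adj : Fin n → List (Fin n)) (D : ℕ) (U K : List (Fin n)) (inU : Fin n → Bool) :
    Timed (List (List (Fin n))) := do
  let inK ← mark K
  let s ← lbfs adj D U K inU inK
  components adj U s.lab

/-! ### Clique trees -/

/-- A rooted clique tree, with nodes `0, …, num - 1` and root `0`. -/
structure CliqueTree (n : ℕ) where
  num : ℕ
  /-- the list of the vertices of the clique `ι(x)` -/
  iota : ℕ → List (Fin n)
  /-- the size of `ι(x)` -/
  size : ℕ → ℕ
  /-- the parent of a node, `none` for the root -/
  parent : ℕ → Option ℕ
  children : ℕ → List ℕ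

/-- A rooted clique tree of `G[U]`. The vertices are processed in the order `τ` of a lexicographic
breadth-first search. Let `P` be the set of the neighbours of `v` that precede `v`. If `P` is the
clique which contains the last vertex of `P` (the clique into which that vertex was put
when it was processed), then `v` is added to this clique. Otherwise `P ∪ {v}` becomes a
new clique, a child of that one. -/
def cliqueTree (adj : Fin n → List (Fin n)) (D : ℕ) (U : List (Fin n)) (inU : Fin n → Bool) :
    Timed (CliqueTree n) := do
  let inK ← mark []
  let s ← lbfs adj D U [] inU inK
  let iota ← newArr n []
  let size ← newArr n 0
  let parent ← newArr n none
  let children ← newArr n []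
  let home ← newArr n 0
  let m ← len U
  let r ← forEach (List.range m) ((⟨0, iota, size, parent, children⟩ : CliqueTree n), home)
    fun i t => do
      let v ← rd s.perm i
      let N ← rd adj v
      -- the set of preceding neighbours, its size, and the position of its last vertex
      let p ← forEach N (([] : List (Fin n)), 0, 0) fun w p => do
        let u ← rd inU w
        let q ← rd s.pos w
        if u = true ∧ q < i then do
          let l ← op (w :: p.1)
          pure (l, p.2.1 + 1, max p.2.2 q)
        else pure p
      let T := t.1
      let new ← op (v :: p.1)
      if p.2.1 = 0 then do
        let iota ← wr T.iota T.num new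
        let size ← wr T.size T.num 1
        let home ← wr t.2 v T.num
        pure (⟨T.num + 1, iota, size, T.parent, T.children⟩, home)
      else do
        let x ← rd s.perm p.2.2
        let c ← rd t.2 x
        let k ← rd T.size c
        if k = p.2.1 then do
          let K ← rd T.iota c
          let iota ← wr T.iota c (v :: K)
          let size ← wr T.size c (k + 1)
          let home ← wr t.2 v c
          pure ({ T with iota := iota, size := size }, home)
        else do
          let iota ← wr T.iota T.num new
          let size ← wr T.size T.num (p.2.1 + 1)
          let parent ← wr T.parent T.num (some c)
          let ch ← rd T.children c
          let children ← wr T.children c (T.num :: ch)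
          let home ← wr t.2 v T.num
          pure (⟨T.num + 1, iota, size, parent, children⟩, home)
  pure r.1

/-! ### Forbidden prefixes and the function `φ` -/

/-- The sizes `|X_1| < ⋯ < |X_ℓ|` of the sets in `FP(v, 𝒯) = {X_1 ⊊ ⋯ ⊊ X_ℓ}`: go from `v` to the
root and collect the sets `ι(x) ∩ ι(y)` for adjacent nodes `x`, `y` that are subsets of `ι(v)`.
These sets form a chain, so that two of them coincide if their sizes do. -/
def forbiddenPrefixes (T : CliqueTree n) (v : ℕ) : Timed (List ℕ) := do
  let Kv ← rd T.iota v
  let inKv ← mark Kv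
  let stamp ← newArr n 0
  let p ← rd T.parent v
  let r ← whileDo n
    (fun r : ℕ × Option ℕ × (Fin n → ℕ) × List ℕ => r.2.1.isSome)
    (fun r => match r.2.1 with
      | none => pure r
      | some y => do
        let Kx ← rd T.iota r.1
        let Ky ← rd T.iota y
        let stamp ← forEach Ky r.2.2.1 fun w st => wr st w (y + 1)
        -- the size of `ι(x) ∩ ι(y)`, and whether it is a subset of `ι(v)`
        let sep ← forEach Kx (0, true) fun w a => do
          let b ← rd stamp w
          let c ← rd inKv w
          pure (if b = y + 1 then (a.1 + 1, a.2 && c) else a)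
        let acc ← op (if sep.2 = true ∧ r.2.2.2.head? ≠ some sep.1 then sep.1 :: r.2.2.2
          else r.2.2.2)
        let p ← rd T.parent y
        pure (y, p, stamp, acc))
    (v, p, stamp, [])
  pure r.2.2.2

/-- The table of the factorials `0!, …, n!`. -/
def factorials (n : ℕ) : Timed (ℕ → ℕ) := do
  let a ← newArr (n + 1) 1
  forEach (List.range n) a fun i a => do
    let f ← rd a i
    let g ← op ((i + 1) * f)
    wr a (i + 1) g

/-- `x! - ∑ (x - y)! · f`, where the sum is over the pairs `(y, f)` in the list. -/
def phiStep (fact : ℕ → ℕ) (x : ℕ) (l : List (ℕ × ℕ)) : Timed ℕ := do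
  let a ← rd fact x
  forEach l a fun p r => do
    let g ← rd fact (x - p.1)
    let h ← op (g * p.2)
    op (r - h)

/-- `φ(S, {X_1, …, X_ℓ})` for `X_1 ⊊ ⋯ ⊊ X_ℓ ⊊ S` by the recursion
`φ(S, {X_1, …, X_ℓ}) = |S|! - ∑ i, |S \ X_i|! · φ(X_i, {X_1, …, X_{i-1}})`, where the values
`φ(X_i, {X_1, …, X_{i-1}})` are computed once, for `i = 1, …, ℓ`. Only the sizes of
the sets matter. -/
def phi (fact : ℕ → ℕ) (size : ℕ) (X : List ℕ) : Timed ℕ := do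
  let l ← forEach X [] fun x l => do
    let f ← phiStep fact x l
    op ((x, f) :: l)
  phiStep fact size l

/-! ### Memoization

The graphs `G[U]` that have been treated are stored in a trie whose keys are the lists of the
elements of `U`. -/

/-- A trie with nodes `0, …, next - 1` and root `0`. -/
structure Memo (n : ℕ) where
  next : ℕ
  /-- the child along an edge labelled by a vertex, `0` if there is none -/
  child : ℕ → Fin n → ℕ
  value : ℕ → Option ℕ

/-- The trie that consists of its root, with one row of `n` pointers. Its table of nodes (a row and a
value for each node) grows by one record whenever a node is created; records of numbers `next` and
above do not exist yet. -/
def emptyMemo : Timed (Memo n) := do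
  let row ← newArr n 0
  pure ⟨1, fun _ => row, fun _ => none⟩

/-- The value that is stored for the key, if any. -/
def lookup (m : Memo n) : ℕ → List (Fin n) → Timed (Option ℕ)
  | x, [] => rd m.value x
  | x, v :: l => do
    let row ← rd m.child x
    let y ← rd row v
    if y = 0 then pure none else lookup m y l

/-- Store a value for the key. A new node of the trie needs a new row of `n` pointers. -/
def insert (val : ℕ) : Memo n → ℕ → List (Fin n) → Timed (Memo n)
  | m, x, [] => do
    let value ← wr m.value x (some val)
    pure { m with value := value }
  | m, x, v :: l => do
    let row ← rd m.child x
    let y ← rd row v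
    if y = 0 then do
      let newRow ← newArr n 0
      let row ← wr row v m.next
      let child ← wr m.child x row
      let child ← wr child m.next newRow
      insert val { m with next := m.next + 1, child := child } m.next l
    else insert val m y l

/-! ### The Clique-Picking algorithm -/

/-- Append a list to a queue (a linked list with a pointer to its end). -/
def push {α : Type} (Q l : List α) : Timed (List α) := ⟨Q ++ l, l.length + 1⟩

/-- The function `count`, applied to the graph `G[U]`. The first argument bounds the depth of the
recursion and serves only to make the definition a total function: every recursive call is
for a graph with fewer vertices, and so the number `n` of vertices of the input graph suffices. -/
def count (adj : Fin n → List (Fin n)) (D : ℕ) (fact : ℕ → ℕ) :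
    ℕ → List (Fin n) → Memo n → Timed (ℕ × Memo n)
  | 0, _, memo => op (0, memo)
  | depth + 1, U, memo => do
    let found ← lookup memo 0 U
    match found with
    | some a => pure (a, memo)
    | none => do
      let inU ← mark U
      let T ← cliqueTree adj D U inU
      let Q ← op [0]
      let r ← whileDo n (fun r : List ℕ × ℕ × Memo n => !r.1.isEmpty)
        (fun r => match r.1 with
          | [] => pure r
          | v :: Q => do
            let ch ← rd T.children v
            let Q ← push Q ch
            let K ← rd T.iota v
            let C ← subproblems adj D U K inU
            let p ← forEach C (1, r.2.2) fun H p => do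
              let a ← count adj D fact depth H p.2
              let prod ← op (p.1 * a.1)
              pure (prod, a.2)
            let X ← forbiddenPrefixes T v
            let k ← rd T.size v
            let f ← phi fact k X
            let g ← op (f * p.1)
            let sum ← op (r.2.1 + g)
            pure (Q, sum, p.2))
        (Q, 0, memo)
      let memo ← insert r.2.1 r.2.2 0 U
      pure (r.2.1, memo)

/-- The Clique-Picking algorithm, for a graph with vertices `0, …, n - 1` that is given by
adjacency lists. -/
def cliquePicking (adj : Fin n → List (Fin n)) : Timed ℕ := do
  let D ← forEach (List.finRange n) 0 fun v k => do
    let N ← rd adj v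
    let d ← len N
    op (k + d)
  let fact ← factorials n
  let memo ← emptyMemo
  let r ← count adj D fact n (List.finRange n) memo
  pure r.1

end Program

end CliquePicking

namespace SimpleGraph

/-! ### Perfect elimination orderings of chordal graphs -/

section Graph

variable {V : Type*} {G : SimpleGraph V}

/-! The bound is a product of two estimates: only O(|Π(G)|) different graphs `G[U]` are ever
evaluated, and one evaluation takes O(|Π(G)|·(|V|+|E|)) steps if its recursive calls are charged
only for their table lookups.

Number of graphs. Every `U` other than the whole vertex set is a connected component of the common
neighbourhood of a clique `S`, and this neighbourhood has a further vertex outside `U`. The search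
yields such sets inside a subproblem (`RoundInv.exists_separator`), and uniting the separator with
the clique that belongs to the subproblem shows that they are of this form in `G`
(`IsSubproblem.of_component`). Fix a perfect elimination ordering of `G`. The search itself provides
one, since it never visits a vertex while another one has strictly more visited neighbours, and in a
chordal graph this property suffices (`IsMaxNbrOrder.isPEO`). A creator is a vertex that starts a
new maximal clique in this ordering; there are at most |Π(G)| of them (`IsPEO.ncard_creators_le`).
Let `y` be the first common neighbour of `S`, and let `v` be the first vertex of `U` if `y` is not
in `U`, and the first common neighbour outside `U` otherwise. Then the preceding neighbours of `v`
are exactly `S`, and `y` shows that `v` is a creator. So `U` is determined by a creator and one of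
two cases, and there are at most 1 + 2|Π(G)| subproblems (`IsPEO.ncard_subproblems_le`).

Cost of an evaluation. A search with partition refinement and a traversal of the components are
linear (`lbfs_spec`, `components_spec`). The clique tree of `G[U]` has at most |Π(G)| nodes, because
each is opened by a creator (`TreeInv.num_le`). At a node with clique `K` there is one search, the
walk to the root is linear, and φ takes O(|K|²) steps, which is O(|V|+|E|) because `K` is a clique.
The sets found at a node are disjoint, so their lookups are linear as well. A new key needs up to
|V| rows of |V| pointers, and |V|² ≤ |Π(G)|·(|V|+2|E|) by the Cauchy–Schwarz inequality
(`sq_card_le`).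

The recursion is analysed with a potential: each evaluation increases the number of stored
subproblems by one, and each such increase pays for a whole evaluation (`count_spec`). -/

/-- A chordal graph has no induced cycle `p 0, …, p k` with `3 ≤ k`. -/
theorem no_induced_cycle (hG : G.IsChordalGraph) (k : ℕ) (hk : 3 ≤ k) (p : ℕ → V)
    (hp : ∀ i j, i < j → j ≤ k →
      p i ≠ p j ∧ (G.Adj (p i) (p j) ↔ j = i + 1 ∨ (i = 0 ∧ j = k))) : False := by
  refine (hG (k + 1) (by omega)).false ⟨⟨fun i => p i.val, ?_⟩, ?_⟩
  · intro a b hab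
    rcases lt_trichotomy a.val b.val with h | h | h
    · exact absurd hab (hp _ _ h (by omega)).1
    · exact Fin.ext h
    · exact absurd hab.symm (hp _ _ h (by omega)).1
  · have key : ∀ a b : Fin (k + 1), a.val < b.val →
        (G.Adj (p a) (p b) ↔ (SimpleGraph.cycleGraph (k + 1)).Adj a b) := by
      intro a b h
      rw [(hp _ _ h (by omega)).2, SimpleGraph.cycleGraph_adj']
      have h1 : (b - a).val = b.val - a.val := Fin.sub_val_of_le (by exact h.le)
      have h2 : (a - b).val = k + 1 + a.val - b.val := Fin.coe_sub_iff_lt.2 h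
      rw [h1, h2]
      omega
    intro a b
    rcases lt_trichotomy a.val b.val with h | h | h
    · exact key a b h
    · obtain rfl := Fin.ext h
      simp
    · exact (G.adj_comm _ _).trans ((key b a h).trans (SimpleGraph.adj_comm _ _ _))

/-- An induced path `p 0, …, p k` in `U` whose inner vertices come after both ends. -/
structure IsBadPath (G : SimpleGraph V) (U : Set V) (pos : V → ℕ) (k : ℕ) (p : ℕ → V) :
    Prop where
  two_le : 2 ≤ k
  mem : ∀ i ≤ k, p i ∈ U
  induced : ∀ i j, i < j → j ≤ k → p i ≠ p j ∧ (G.Adj (p i) (p j) ↔ j = i + 1)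
  inner : ∀ i, 0 < i → i < k → pos (p 0) < pos (p i) ∧ pos (p k) < pos (p i)

theorem IsBadPath.reverse {U : Set V} {pos : V → ℕ} {k : ℕ} {p : ℕ → V}
    (h : IsBadPath G U pos k p) : IsBadPath G U pos k (fun i => p (k - i)) := by
  refine ⟨h.two_le, fun i _ => h.mem _ (by omega), fun i j hij hj => ?_, fun i h0 hi => ?_⟩
  · obtain ⟨h1, h2⟩ := h.induced (k - j) (k - i) (by omega) (by omega)
    refine ⟨h1.symm, ?_⟩
    rw [G.adj_comm, h2]
    omega
  · have := h.inner (k - i) (by omega) (by omega)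
    simpa using this.symm

/-- A vertex is never visited while the visited neighbourhood of another unvisited vertex is
strictly larger than its own. -/
def IsMaxNbrOrder (G : SimpleGraph V) (U : Set V) (pos : V → ℕ) : Prop :=
  ∀ a ∈ U, ∀ b ∈ U, ∀ c ∈ U, pos a < pos b → pos b < pos c → G.Adj a c → ¬ G.Adj a b →
    ∃ d ∈ U, pos d < pos b ∧ G.Adj d b ∧ ¬ G.Adj d c

/-- The preceding neighbours of every vertex form a clique. -/
def IsPEO (G : SimpleGraph V) (U : Set V) (pos : V → ℕ) : Prop :=
  ∀ v ∈ U, ∀ a ∈ U, ∀ b ∈ U, pos a < pos v → pos b < pos v → G.Adj a v → G.Adj b v → a ≠ b →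
    G.Adj a b

/-- Descent on the later end. The ordering property for `p 0`, `p k`, `p 1` gives a `d` before `p k`
that is adjacent to `p k` but not to `p 1`. Cut the path at the first `p j`, `2 ≤ j`, adjacent to
`d` and append `d`. If `d` is adjacent to `p 0`, this is an induced cycle with at least four
vertices; otherwise it is a bad path both of whose ends precede `p k`. -/
theorem IsMaxNbrOrder.not_isBadPath (hG : G.IsChordalGraph) {U : Set V} {pos : V → ℕ}
    (hinj : Set.InjOn pos U) (hm : IsMaxNbrOrder G U pos) :
    ∀ N k p, IsBadPath G U pos k p → pos (p 0) < pos (p k) → pos (p k) = N → False := by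
  intro N
  induction N using Nat.strong_induction_on with
  | _ N ih =>
  intro k p hp hlt hN
  have hk := hp.two_le
  obtain ⟨d, hdU, hdk, hadj, hnadj⟩ := hm (p 0) (hp.mem 0 (by omega)) (p k) (hp.mem k le_rfl)
    (p 1) (hp.mem 1 (by omega)) hlt (hp.inner 1 (by omega) (by omega)).2
    (((hp.induced 0 1 (by omega) (by omega)).2).2 rfl)
    (fun h => by have := ((hp.induced 0 k (by omega) le_rfl).2).1 h; omega)
  classical
  have hex : ∃ j, 2 ≤ j ∧ j ≤ k ∧ G.Adj d (p j) := ⟨k, hk, le_rfl, hadj⟩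
  obtain ⟨j, ⟨hj2, hjk, hdj⟩, hmin⟩ : ∃ j, (2 ≤ j ∧ j ≤ k ∧ G.Adj d (p j)) ∧
      ∀ i < j, ¬ (2 ≤ i ∧ i ≤ k ∧ G.Adj d (p i)) :=
    ⟨Nat.find hex, Nat.find_spec hex, fun i hi => Nat.find_min hex hi⟩
  have hd_adj : ∀ i, 0 < i → i ≤ j → (G.Adj (p i) d ↔ i = j) := by
    intro i hi hij
    constructor
    · intro h
      by_contra hne
      rcases Nat.lt_or_ge i 2 with h2 | h2
      · have : i = 1 := by omega
        subst this
        exact hnadj h.symm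
      · exact hmin i (by omega) ⟨h2, by omega, h.symm⟩
    · rintro rfl
      exact hdj.symm
  have hd_ne : ∀ i ≤ j, p i ≠ d := by
    intro i hij h
    rcases Nat.eq_zero_or_pos i with rfl | h0
    · rw [← h] at hadj
      have := ((hp.induced 0 k (by omega) le_rfl).2).1 hadj
      omega
    · rcases Nat.lt_or_ge i k with h1 | h1
      · have := (hp.inner i h0 h1).2
        rw [h] at this
        omega
      · have : i = k := by omega
        subst this
        rw [h] at hdk
        omega
  set q : ℕ → V := fun i => if i ≤ j then p i else d with hq
  have hq1 : ∀ i ≤ j, q i = p i := fun i hi => by simp [hq, hi]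
  have hq2 : q (j + 1) = d := by simp [hq]
  by_cases hd0 : G.Adj (p 0) d
  · refine no_induced_cycle hG (j + 1) (by omega) q fun a b hab hb => ?_
    rw [hq1 a (by omega)]
    rcases Nat.lt_or_ge j b with hbj | hbj
    · have : b = j + 1 := by omega
      subst this
      rw [hq2]
      refine ⟨hd_ne a (by omega), ?_⟩
      rcases Nat.eq_zero_or_pos a with rfl | h0
      · simpa using hd0
      · rw [hd_adj a h0 (by omega)]
        omega
    · rw [hq1 b hbj]
      obtain ⟨h1, h2⟩ := hp.induced a b hab (by omega)
      refine ⟨h1, ?_⟩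
      rw [h2]
      omega
  · have hbad : IsBadPath G U pos (j + 1) q := by
      refine ⟨by omega, fun i hi => ?_, fun a b hab hb => ?_, fun i h0 hi => ?_⟩
      · rcases Nat.lt_or_ge j i with h | h
        · have : i = j + 1 := by omega
          subst this
          rwa [hq2]
        · rw [hq1 i h]
          exact hp.mem i (by omega)
      · rw [hq1 a (by omega)]
        rcases Nat.lt_or_ge j b with hbj | hbj
        · have : b = j + 1 := by omega
          subst this
          rw [hq2]
          refine ⟨hd_ne a (by omega), ?_⟩
          rcases Nat.eq_zero_or_pos a with rfl | h0
          · simp only [hd0, false_iff]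
            omega
          · rw [hd_adj a h0 (by omega)]
            omega
        · rw [hq1 b hbj]
          exact hp.induced a b hab (by omega)
      · rw [hq1 i (by omega), hq1 0 (by omega), hq2]
        rcases Nat.lt_or_ge i k with h1 | h1
        · have := hp.inner i h0 h1
          omega
        · have : i = k := by omega
          subst this
          omega
    have hne : pos (q 0) ≠ pos (q (j + 1)) := by
      intro h
      have h3 := hinj (hbad.mem 0 (by omega)) (hbad.mem (j + 1) le_rfl) h
      exact (hbad.induced 0 (j + 1) (by omega) le_rfl).1 h3
    rw [hq1 0 (by omega), hq2] at hne
    -- The induction hypothesis wants the earlier end first, so the path is reversed if `d` precedes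
    -- `p 0`.
    rcases Nat.lt_or_ge (pos (p 0)) (pos d) with h | h
    · exact ih (pos d) (by omega) (j + 1) q hbad (by rwa [hq1 0 (by omega), hq2]) (by rw [hq2])
    · refine ih (pos (p 0)) (by omega) (j + 1) _ hbad.reverse ?_ ?_
      · simp only [Nat.sub_zero, Nat.sub_self]
        rw [hq1 0 (by omega), hq2]
        omega
      · simp only [Nat.sub_self]
        rw [hq1 0 (by omega)]

/-- In a chordal graph a maximal neighbourhood search yields a perfect elimination ordering. -/
theorem IsMaxNbrOrder.isPEO (hG : G.IsChordalGraph) {U : Set V} {pos : V → ℕ}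
    (hinj : Set.InjOn pos U) (hm : IsMaxNbrOrder G U pos) : IsPEO G U pos := by
  intro v hv a ha b hb hav hbv haadj hbadj hab
  by_contra hnadj
  wlog hlt : pos a < pos b generalizing a b
  · have hne : pos a ≠ pos b := fun h => hab (hinj ha hb h)
    exact this b hb a ha hbv hav hbadj haadj hab.symm (fun h => hnadj h.symm) (by omega)
  -- Two non-adjacent preceding neighbours of `v` give the bad path `a, v, b`.
  set p : ℕ → V := fun i => if i = 0 then a else if i = 1 then v else b with hp
  refine hm.not_isBadPath hG hinj (pos b) 2 p ⟨le_rfl, ?_, ?_, ?_⟩ (by simpa [hp] using hlt)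
    (by simp [hp])
  · intro i hi
    interval_cases i <;> simp [hp, ha, hb, hv]
  · intro i j hij hj
    obtain ⟨rfl, rfl⟩ | ⟨rfl, rfl⟩ | ⟨rfl, rfl⟩ :
        (i = 0 ∧ j = 1) ∨ (i = 0 ∧ j = 2) ∨ (i = 1 ∧ j = 2) := by omega
    · simpa [hp, haadj] using haadj.ne
    · simp [hp, hab, hnadj]
    · simpa [hp, hbadj.symm] using hbadj.ne'
  · intro i h0 h2
    have : i = 1 := by omega
    subst this
    simp [hp, hav, hbv]

end Graph

end SimpleGraph

namespace SimpleGraph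

section Counting

variable {V : Type*} {G : SimpleGraph V}

/-! ### Vertices that start a new maximal clique -/

/-- The vertex `v` is the first one, or some earlier non-neighbour of `v` is adjacent to all
preceding neighbours of `v`. -/
def IsCreator (G : SimpleGraph V) (U : Set V) (pos : V → ℕ) (v : V) : Prop :=
  v ∈ U ∧ ((∀ y ∈ U, pos v ≤ pos y) ∨ ∃ y ∈ U, pos y < pos v ∧ ¬ G.Adj y v ∧
    ∀ a ∈ U, pos a < pos v → G.Adj a v → G.Adj y a)

theorem exists_maximalClique_ge [Finite V] {C : Set V} (hC : G.IsClique C) :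
    ∃ M ∈ G.maximalCliques, C ⊆ M := by
  obtain ⟨M, hCM, hM⟩ := Set.Finite.exists_le_maximal (s := {K | G.IsClique K})
    (Set.toFinite _) hC
  exact ⟨M, hM, hCM⟩

/-- Every vertex lies in a maximal clique without later creators. -/
theorem IsPEO.exists_maximalClique [Finite V] {U : Set V} {pos : V → ℕ}
    (hinj : Set.InjOn pos U) (hP : IsPEO G U pos) {v : V} (hv : v ∈ U) :
    ∃ M ∈ G.maximalCliques, v ∈ M ∧
      ∀ w ∈ M, w ∈ U → pos v < pos w → ¬ IsCreator G U pos w := by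
  -- Cliques grown upwards from `v`: with each member from `v` on they contain its preceding
  -- neighbours, and no member after `v` is a creator. A maximal such `C` turns out to contain every
  -- later vertex of `U` that lies in a maximal clique extending `C`.
  let Q : Set V → Prop := fun C => C ⊆ U ∧ G.IsClique C ∧ v ∈ C ∧
    (∀ c ∈ C, pos v ≤ pos c → ∀ a ∈ U, pos a < pos c → G.Adj a c → a ∈ C) ∧
    (∀ c ∈ C, pos v < pos c → ¬ IsCreator G U pos c)
  have hQ0 : Q (insert v {a | a ∈ U ∧ pos a < pos v ∧ G.Adj a v}) := by
    refine ⟨?_, ?_, Set.mem_insert _ _, ?_, ?_⟩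
    · rintro x (rfl | hx)
      · exact hv
      · exact hx.1
    · rintro x (rfl | ⟨hx, hxv, hxa⟩) y (rfl | ⟨hy, hyv, hya⟩) hne
      · exact absurd rfl hne
      · exact hya.symm
      · exact hxa
      · exact hP v hv x hx y hy hxv hyv hxa hya hne
    · rintro c (rfl | ⟨_, hcv, _⟩) hvc a ha hac hadj
      · exact Set.mem_insert_of_mem _ ⟨ha, hac, hadj⟩
      · omega
    · rintro c (rfl | ⟨_, hcv, _⟩) hvc
      · omega
      · omega
  obtain ⟨C, -, hC⟩ := Set.Finite.exists_le_maximal (s := {C | Q C}) (Set.toFinite _) hQ0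
  obtain ⟨hCU, hCc, hvC, hCcl, hCcr⟩ := hC.prop
  obtain ⟨M, hM, hCM⟩ := exists_maximalClique_ge hCc
  refine ⟨M, hM, hCM hvC, fun w hwM hwU hvw => ?_⟩
  suffices hwC : w ∈ C from hCcr w hwC hvw
  by_contra hwC
  -- The first vertex `z` outside `C` adjacent to all of `C` could be added to `C`. Indeed a
  -- preceding neighbour of `z` outside `C`, or an earlier vertex that makes `z` a creator, would be
  -- an even earlier vertex of this kind.
  obtain ⟨z, ⟨hzU, hzC, hzadj⟩, hzmin⟩ := Set.exists_min_image
    {z | z ∈ U ∧ z ∉ C ∧ ∀ c ∈ C, G.Adj c z} pos (Set.toFinite _)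
    ⟨w, hwU, hwC, fun c hc => hM.prop (hCM hc) hwM (fun h => hwC (h ▸ hc))⟩
  have hvz : pos v < pos z := by
    by_contra h
    have hne : pos z ≠ pos v := fun h => hzC (by rw [hinj hzU hv h]; exact hvC)
    exact hzC (hCcl v hvC le_rfl z hzU (by omega) (hzadj v hvC).symm)
  have hCz : ∀ c ∈ C, pos c < pos z := by
    intro c hc
    by_contra h
    have hne : pos z ≠ pos c := fun h => hzC (by rw [hinj hzU (hCU hc) h]; exact hc)
    exact hzC (hCcl c hc (by omega) z hzU (by omega) (hzadj c hc).symm)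
  have hQ : Q (insert z C) := by
    refine ⟨Set.insert_subset hzU hCU, ?_, Set.mem_insert_of_mem _ hvC, ?_, ?_⟩
    · exact hCc.insert fun c hc _ => (hzadj c hc).symm
    · rintro c (rfl | hc) hvc a ha hac hadj
      · by_contra haC
        have haC' : a ∉ C := fun h => haC (Set.mem_insert_of_mem _ h)
        have := hzmin a ⟨ha, haC', fun c' hc' => hP c hzU c' (hCU hc') a ha (hCz c' hc') hac
          (hzadj c' hc') hadj (fun h => haC' (h ▸ hc'))⟩
        omega
      · exact Set.mem_insert_of_mem _ (hCcl c hc hvc a ha hac hadj)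
    · rintro c (rfl | hc) hvc
      · rintro ⟨-, hfirst | ⟨y, hyU, hyc, hyn, hyadj⟩⟩
        · have := hfirst v hv
          omega
        · have := hzmin y ⟨hyU, fun h => hyn (hzadj y h), fun c' hc' =>
            (hyadj c' (hCU hc') (hCz c' hc') (hzadj c' hc')).symm⟩
          omega
      · exact hCcr c hc hvc
  exact hzC (hC.le_of_ge hQ (Set.subset_insert _ _) (Set.mem_insert _ _))

/-- A creator is the last creator in the clique chosen for it, so two creators cannot share a
clique. The cliques are maximal in `G` and not merely within `U`; therefore the same bound |Π(G)|
serves every subproblem. -/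
theorem IsPEO.ncard_creators_le [Finite V] {U : Set V} {pos : V → ℕ}
    (hinj : Set.InjOn pos U) (hP : IsPEO G U pos) :
    {v | IsCreator G U pos v}.ncard ≤ G.maximalCliques.ncard := by
  have hex : ∀ v, ∃ M, v ∈ U → M ∈ G.maximalCliques ∧ v ∈ M ∧
      ∀ w ∈ M, w ∈ U → pos v < pos w → ¬ IsCreator G U pos w := by
    intro v
    by_cases hv : v ∈ U
    · obtain ⟨M, h⟩ := hP.exists_maximalClique hinj hv
      exact ⟨M, fun _ => h⟩
    · exact ⟨∅, fun h => absurd h hv⟩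
  choose f hf using hex
  refine Set.ncard_le_ncard_of_injOn f (fun v hv => (hf v hv.1).1) ?_ (Set.toFinite _)
  intro v hv w hw hvw
  have h1 := hf v hv.1
  have h2 := hf w hw.1
  rcases lt_trichotomy (pos v) (pos w) with h | h | h
  · exact absurd hw (h1.2.2 w (hvw ▸ h2.2.1) hw.1 h)
  · exact hinj hv.1 hw.1 h
  · exact absurd hv (h2.2.2 v (hvw ▸ h1.2.1) hv.1 h)

/-! ### The family of subproblems -/

/-- The common neighbours of a set of vertices. -/
def commonNbrs (G : SimpleGraph V) (S : Set V) : Set V := {x | ∀ s ∈ S, G.Adj s x}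

/-- The induced subgraph on `F` is connected: `F` has no non-trivial part without outgoing edges. -/
def CutConnected (G : SimpleGraph V) (F : Set V) : Prop :=
  ∀ T ⊆ F, T.Nonempty → (∀ u ∈ T, ∀ w ∈ F, G.Adj u w → w ∈ T) → F ⊆ T

/-- The set `F` is a connected component of the common neighbourhood of `S`. -/
structure IsNbrComponent (G : SimpleGraph V) (S F : Set V) : Prop where
  nonempty : F.Nonempty
  subset : F ⊆ commonNbrs G S
  closed : ∀ u ∈ F, ∀ w ∈ commonNbrs G S, G.Adj u w → w ∈ F
  conn : CutConnected G F

/-- The vertex sets of the graphs treated by the algorithm: the connected components of the common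
neighbourhood of a clique `S`, provided that there are at least two of them, and the whole vertex
set. -/
def IsSubproblem (G : SimpleGraph V) (F : Set V) : Prop :=
  ∃ S, G.IsClique S ∧ IsNbrComponent G S F ∧ (F = Set.univ ∨ ∃ y ∈ commonNbrs G S, y ∉ F)

/-- No edge leads from `F ∩ F'` to the rest of `F`, so connectedness of `F` applies to this
intersection. -/
theorem IsNbrComponent.subset_of_mem {S F F' : Set V} (h : IsNbrComponent G S F)
    (h' : IsNbrComponent G S F') {x : V} (hx : x ∈ F) (hx' : x ∈ F') : F ⊆ F' := by
  have := h.conn (F ∩ F') Set.inter_subset_left ⟨x, hx, hx'⟩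
    (fun u hu w hw hadj => ⟨hw, h'.closed u hu.2 w (h.subset hw) hadj⟩)
  exact fun y hy => (this hy).2

/-- The component of `x` in the common neighbourhood of `S`. -/
def nbrComponent (G : SimpleGraph V) (S : Set V) (x : V) : Set V :=
  ⋃₀ {F | IsNbrComponent G S F ∧ x ∈ F}

theorem IsNbrComponent.eq_nbrComponent {S F : Set V} (h : IsNbrComponent G S F) {x : V}
    (hx : x ∈ F) : F = nbrComponent G S x := by
  apply Set.Subset.antisymm
  · exact fun y hy => ⟨F, ⟨h, hx⟩, hy⟩
  · rintro y ⟨F', ⟨h', hx'⟩, hy⟩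
    exact h'.subset_of_mem h hx' hx hy

/-- A chordal graph has at most `1 + 2 |Π(G)|` subproblems. -/
theorem IsPEO.ncard_subproblems_le [Finite V] [Nonempty V] {pos : V → ℕ}
    (hinj : Function.Injective pos) (hP : IsPEO G Set.univ pos) :
    {F | IsSubproblem G F}.ncard ≤ 1 + 2 * G.maximalCliques.ncard := by
  have hex : ∀ S : Set V, ∃ y, (commonNbrs G S).Nonempty →
      y ∈ commonNbrs G S ∧ ∀ x ∈ commonNbrs G S, pos y ≤ pos x := by
    intro S
    by_cases h : (commonNbrs G S).Nonempty
    · obtain ⟨y, hy, hmin⟩ := Set.exists_min_image _ pos (Set.toFinite _) h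
      exact ⟨y, fun _ => ⟨hy, hmin⟩⟩
    · exact ⟨Classical.arbitrary V, fun h' => absurd h' h⟩
  choose y₀ hy₀ using hex
  let P : V → Set V := fun v => {a | pos a < pos v ∧ G.Adj a v}
  let R : Set V := {v | IsCreator G Set.univ pos v}
  have hsub : {F | IsSubproblem G F} ⊆ insert Set.univ
      (Set.image (fun v => nbrComponent G (P v) v) R ∪
        Set.image (fun v => nbrComponent G (P v) (y₀ (P v))) R) := by
    rintro F ⟨S, hS, hF, rfl | ⟨y, hy, hyF⟩⟩
    · exact Set.mem_insert _ _
    right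
    obtain ⟨hy0, hmin⟩ := hy₀ S ⟨y, hy⟩
    -- If some `s ∈ S` came after `v`, then `y₀ S` and `v` would be preceding neighbours of `s` and
    -- hence adjacent. A preceding neighbour of `v` outside `S` would be adjacent to all of `S` by
    -- the elimination property at `v`, hence a common neighbour of `S` that comes too early. Now
    -- `y₀ S` witnesses that `v` is a creator.
    have key : ∀ v ∈ commonNbrs G S, pos (y₀ S) < pos v → ¬ G.Adj (y₀ S) v →
        (∀ z ∈ commonNbrs G S, G.Adj z v → pos v < pos z) → P v = S ∧ v ∈ R := by
      intro v hv hlt hnadj hz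
      have hPS : P v = S := by
        have hSv : S ⊆ P v := by
          intro s hs
          refine ⟨?_, hv s hs⟩
          have hne : pos s ≠ pos v := fun h => (hv s hs).ne (hinj h)
          by_contra hlt'
          refine hnadj (hP s trivial (y₀ S) trivial v trivial (by omega) (by omega)
            (hy0 s hs).symm (hv s hs).symm ?_)
          rintro h
          rw [h] at hlt
          omega
        refine Set.Subset.antisymm (fun z hzP => ?_) hSv
        by_contra hzS
        have hzc : z ∈ commonNbrs G S := fun s hs =>
          hP v trivial s trivial z trivial (hSv hs).1 hzP.1 (hSv hs).2 hzP.2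
            (fun h => hzS (h ▸ hs))
        have := hz z hzc hzP.2
        have := hzP.1
        omega
      refine ⟨hPS, trivial, Or.inr ⟨y₀ S, trivial, hlt, hnadj, fun a _ hav hadj => ?_⟩⟩
      have : a ∈ S := by rw [← hPS]; exact ⟨hav, hadj⟩
      exact (hy0 a this).symm
    by_cases hy0F : y₀ S ∈ F
    -- The component that contains the first common neighbour is identified by the first common
    -- neighbour outside of it.
    · right
      obtain ⟨v, ⟨hv, hvF⟩, hvmin⟩ := Set.exists_min_image
        {v | v ∈ commonNbrs G S ∧ v ∉ F} pos (Set.toFinite _) ⟨y, hy, hyF⟩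
      obtain ⟨hPv, hvR⟩ := key v hv
        (lt_of_le_of_ne (hmin v hv) (fun h => hvF (hinj h ▸ hy0F)))
        (fun h => hvF (hF.closed _ hy0F v hv h)) (fun z hz hadj => by
          have hzF : z ∉ F := fun h => hvF (hF.closed z h v hv hadj)
          exact lt_of_le_of_ne (hvmin z ⟨hz, hzF⟩) (fun h => hadj.ne (hinj h.symm)))
      exact ⟨v, hvR, by simpa only [hPv] using (hF.eq_nbrComponent hy0F).symm⟩
    -- Any other component is identified by its own first vertex.
    · left
      obtain ⟨v, hvF, hvmin⟩ := Set.exists_min_image F pos (Set.toFinite _) hF.nonempty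
      have hv := hF.subset hvF
      obtain ⟨hPv, hvR⟩ := key v hv
        (lt_of_le_of_ne (hmin v hv) (fun h => hy0F (hinj h ▸ hvF)))
        (fun h => hy0F (hF.closed _ hvF _ hy0 h.symm)) (fun z hz hadj =>
          lt_of_le_of_ne (hvmin z (hF.closed v hvF z hz hadj.symm))
            (fun h => hadj.ne (hinj h.symm)))
      exact ⟨v, hvR, by simpa only [hPv] using (hF.eq_nbrComponent hvF).symm⟩
  have hR : R.ncard ≤ G.maximalCliques.ncard := hP.ncard_creators_le hinj.injOn
  have h1 := Set.ncard_le_ncard hsub (Set.toFinite _)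
  have h2 := Set.ncard_insert_le (Set.univ : Set V)
    (Set.image (fun v => nbrComponent G (P v) v) R ∪
        Set.image (fun v => nbrComponent G (P v) (y₀ (P v))) R)
  have h3 := Set.ncard_union_le (Set.image (fun v => nbrComponent G (P v) v) R)
    (Set.image (fun v => nbrComponent G (P v) (y₀ (P v))) R)
  have h4 := Set.ncard_image_le (f := fun v => nbrComponent G (P v) v) (Set.toFinite R)
  have h5 := Set.ncard_image_le (f := fun v => nbrComponent G (P v) (y₀ (P v))) (Set.toFinite R)
  omega

/-- Components found in a subproblem are subproblems of the whole graph. -/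
theorem IsSubproblem.of_component {U H S : Set V} (hU : IsSubproblem G U) (hS : G.IsClique S)
    (hSU : S ⊆ U) (hHU : H ⊆ U) (hne : H.Nonempty) (hconn : CutConnected G H)
    (hH : H ⊆ commonNbrs G S)
    (hclosed : ∀ u ∈ H, ∀ w ∈ U, w ∈ commonNbrs G S → G.Adj u w → w ∈ H)
    {y : V} (hyU : y ∈ U) (hy : y ∈ commonNbrs G S) (hyH : y ∉ H) : IsSubproblem G H := by
  obtain ⟨S', hS', hUc, -⟩ := hU
  -- For `S = ∅` no edge would leave `H` within the connected set `U`, and `H` would contain `y`.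
  obtain ⟨s, hs⟩ : S.Nonempty := by
    by_contra h
    rw [Set.not_nonempty_iff_eq_empty] at h
    subst h
    have := hUc.conn H hHU hne
      (fun u hu w hw hadj => hclosed u hu w hw (fun s hs => absurd hs (by simp)) hadj)
    exact hyH (this hyU)
  -- All of `U` is adjacent to `S'`, so the union is a clique. Its common neighbours lie in `U`:
  -- they are common neighbours of `S'` adjacent to `s ∈ U`, and `U` is a component.
  refine ⟨S ∪ S', ?_, ⟨hne, ?_, ?_, hconn⟩, Or.inr ⟨y, ?_, hyH⟩⟩
  · rintro a (ha | ha) b (hb | hb) hab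
    · exact hS ha hb hab
    · exact (hUc.subset (hSU ha) b hb).symm
    · exact hUc.subset (hSU hb) a ha
    · exact hS' ha hb hab
  · rintro x hx a (ha | ha)
    · exact hH hx a ha
    · exact hUc.subset (hHU hx) a ha
  · intro u hu w hw hadj
    have hwU : w ∈ U := hUc.closed s (hSU hs) w (fun a ha => hw a (Or.inr ha)) (hw s (Or.inl hs))
    exact hclosed u hu w hwU (fun a ha => hw a (Or.inl ha)) hadj
  · rintro a (ha | ha)
    · exact hy a ha
    · exact hUc.subset hyU a ha

theorem isSubproblem_univ (hG : G.Connected) : IsSubproblem G Set.univ := by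
  refine ⟨∅, by simp, ⟨?_, ?_, ?_, ?_⟩, Or.inl rfl⟩
  · exact ⟨hG.nonempty.some, trivial⟩
  · exact fun x _ s hs => absurd hs (by simp)
  · exact fun _ _ _ _ _ => trivial
  · rintro T - ⟨t, ht⟩ hcl x -
    obtain ⟨p⟩ := hG.preconnected t x
    induction p with
    | nil => exact ht
    | cons h _ ih => exact ih (hcl _ ht _ trivial h)

/-! ### Numbers of vertices and edges -/

theorem card_le_of_pairs {n : ℕ} {G : SimpleGraph (Fin n)} (s : Finset (Fin n × Fin n))
    (hs : ∀ p ∈ s, p.1 = p.2 ∨ G.Adj p.1 p.2) : s.card ≤ n + 2 * G.edgeSet.ncard := by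
  classical
  have h1 : s ⊆ Finset.univ.biUnion (fun v => (insert v (G.neighborFinset v)).map
      ⟨fun w => (v, w), fun a b h => (Prod.ext_iff.1 h).2⟩) := by
    rintro ⟨a, b⟩ hp
    have := hs _ hp
    simp only [Finset.mem_biUnion, Finset.mem_univ, true_and, Finset.mem_map, Finset.mem_insert,
      SimpleGraph.mem_neighborFinset]
    exact ⟨a, b, this.imp Eq.symm id, rfl⟩
  calc s.card ≤ _ := Finset.card_le_card h1
    _ ≤ ∑ v, _ := Finset.card_biUnion_le
    _ ≤ ∑ v, (1 + G.degree v) := by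
      refine Finset.sum_le_sum fun v _ => ?_
      rw [Finset.card_map]
      have := Finset.card_insert_le v (G.neighborFinset v)
      rw [SimpleGraph.card_neighborFinset_eq_degree] at this
      omega
    _ = n + 2 * G.edgeSet.ncard := by
      rw [Finset.sum_add_distrib, G.sum_degrees_eq_twice_card_edges]
      rw [← G.coe_edgeFinset, Set.ncard_coe_finset]
      simp

/-- This pays for the quadratic evaluation of φ on a single clique. -/
theorem clique_card_sq_le {n : ℕ} {G : SimpleGraph (Fin n)} (K : Finset (Fin n))
    (hK : G.IsClique (K : Set (Fin n))) : K.card ^ 2 ≤ n + 2 * G.edgeSet.ncard := by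
  rw [sq, ← Finset.card_product]
  refine card_le_of_pairs _ fun p hp => ?_
  rw [Finset.mem_product] at hp
  by_cases h : p.1 = p.2
  · exact Or.inl h
  · exact Or.inr (hK hp.1 hp.2 h)

/-- Assign to every vertex a maximal clique containing it. Pairs with the same clique are equal or
adjacent, which bounds the sum of the squares of the class sizes by `n + 2|E|`. The sizes add up to
`n`, and the Cauchy–Schwarz inequality over the |Π(G)| classes gives the claim. -/
theorem sq_card_le {n : ℕ} (G : SimpleGraph (Fin n)) :
    n ^ 2 ≤ G.maximalCliques.ncard * (n + 2 * G.edgeSet.ncard) := by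
  classical
  have hex : ∀ v : Fin n, ∃ M ∈ G.maximalCliques, v ∈ M := by
    intro v
    obtain ⟨M, hM, h⟩ := exists_maximalClique_ge (G := G) (C := {v}) (by simp)
    exact ⟨M, hM, h rfl⟩
  choose c hc hmem using hex
  have hfin : G.maximalCliques.Finite := Set.toFinite _
  let Q := hfin.toFinset
  have h1 : n = ∑ M ∈ Q, (Finset.univ.filter fun v => c v = M).card := by
    rw [← Finset.card_eq_sum_card_fiberwise (f := c) (by simp [Q, Set.MapsTo, hc])]
    simp
  have h2 : ∑ M ∈ Q, (Finset.univ.filter fun v => c v = M).card ^ 2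
      ≤ n + 2 * G.edgeSet.ncard := by
    have : ∑ M ∈ Q, (Finset.univ.filter fun v => c v = M).card ^ 2 =
        (Q.biUnion fun M => (Finset.univ.filter fun v => c v = M) ×ˢ
          (Finset.univ.filter fun v => c v = M)).card := by
      rw [Finset.card_biUnion]
      · exact Finset.sum_congr rfl fun M _ => by rw [sq, Finset.card_product]
      · intro M _ M' _ hne
        rw [Function.onFun, Finset.disjoint_left]
        rintro ⟨a, b⟩ h h'
        simp only [Finset.mem_product, Finset.mem_filter, Finset.mem_univ, true_and] at h h'
        exact hne (h.1.symm.trans h'.1)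
    rw [this]
    refine card_le_of_pairs _ fun p hp => ?_
    simp only [Finset.mem_biUnion, Finset.mem_product, Finset.mem_filter, Finset.mem_univ,
      true_and] at hp
    obtain ⟨M, -, h3, h4⟩ := hp
    by_cases h : p.1 = p.2
    · exact Or.inl h
    · exact Or.inr ((hc p.1).prop (hmem p.1) (by rw [h3, ← h4]; exact hmem p.2) h)
  calc n ^ 2 = (∑ M ∈ Q, (Finset.univ.filter fun v => c v = M).card) ^ 2 := by rw [← h1]
    _ ≤ Q.card * ∑ M ∈ Q, (Finset.univ.filter fun v => c v = M).card ^ 2 :=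
      sq_sum_le_card_mul_sum_sq
    _ ≤ _ := by
      rw [Set.ncard_eq_toFinset_card _ hfin]
      exact Nat.mul_le_mul_left _ h2

end Counting

end SimpleGraph

namespace CliquePicking

/-! ### Reasoning about timed programs -/

section Timed

variable {α β σ ι : Type}

theorem bind_val (x : Timed α) (f : α → Timed β) : (x >>= f).val = (f x.val).val := rfl

theorem bind_time (x : Timed α) (f : α → Timed β) :
    (x >>= f).time = x.time + (f x.val).time := rfl

@[simp] theorem pure_val (a : α) : (pure a : Timed α).val = a := rfl

@[simp] theorem pure_time (a : α) : (pure a : Timed α).time = 0 := rfl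

@[simp] theorem op_val (a : α) : (op a).val = a := rfl

@[simp] theorem op_time (a : α) : (op a).time = 1 := rfl

@[simp] theorem rd_val (a : ι → α) (i : ι) : (rd a i).val = a i := rfl

@[simp] theorem rd_time (a : ι → α) (i : ι) : (rd a i).time = 1 := rfl

@[simp] theorem wr_val [DecidableEq ι] (a : ι → α) (i : ι) (x : α) :
    (wr a i x).val = Function.update a i x := rfl

@[simp] theorem wr_time [DecidableEq ι] (a : ι → α) (i : ι) (x : α) : (wr a i x).time = 1 := rfl

@[simp] theorem op_bind_val (a : α) (f : α → Timed β) : (op a >>= f).val = (f a).val := rfl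

@[simp] theorem op_bind_time (a : α) (f : α → Timed β) :
    (op a >>= f).time = 1 + (f a).time := rfl

@[simp] theorem rd_bind_val (a : ι → α) (i : ι) (f : α → Timed β) :
    (rd a i >>= f).val = (f (a i)).val := rfl

@[simp] theorem rd_bind_time (a : ι → α) (i : ι) (f : α → Timed β) :
    (rd a i >>= f).time = 1 + (f (a i)).time := rfl

@[simp] theorem wr_bind_val [DecidableEq ι] (a : ι → α) (i : ι) (x : α)
    (f : (ι → α) → Timed β) : (wr a i x >>= f).val = (f (Function.update a i x)).val := rfl

@[simp] theorem wr_bind_time [DecidableEq ι] (a : ι → α) (i : ι) (x : α)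
    (f : (ι → α) → Timed β) :
    (wr a i x >>= f).time = 1 + (f (Function.update a i x)).time := rfl

@[simp] theorem newArr_bind_val (k : ℕ) (a : α) (f : (ι → α) → Timed β) :
    (newArr k a >>= f).val = (f fun _ => a).val := rfl

@[simp] theorem newArr_bind_time (k : ℕ) (a : α) (f : (ι → α) → Timed β) :
    (newArr k a >>= f).time = k + 1 + (f fun _ => a).time := rfl

@[simp] theorem push_val (Q l : List α) : (push Q l).val = Q ++ l := rfl

@[simp] theorem push_time (Q l : List α) : (push Q l).time = l.length + 1 := rfl

@[simp] theorem forEach_nil (s : σ) (f : β → σ → Timed σ) : forEach [] s f = op s := rfl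

@[simp] theorem forEach_cons_val (b : β) (l : List β) (s : σ) (f : β → σ → Timed σ) :
    (forEach (b :: l) s f).val = (forEach l (f b s).val f).val := rfl

@[simp] theorem forEach_cons_time (b : β) (l : List β) (s : σ) (f : β → σ → Timed σ) :
    (forEach (b :: l) s f).time = 1 + ((f b s).time + (forEach l (f b s).val f).time) := rfl

/-- Invariant `I` and potential `Φ` for a loop; both depend on the part of the list that has
been processed. -/
theorem forEach_spec {L : List β} {f : β → σ → Timed σ} (I : List β → σ → Prop)
    (Φ : List β → σ → ℕ)
    (h : ∀ done b rest s, L = done ++ b :: rest → I done s →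
      I (done ++ [b]) (f b s).val ∧
        (f b s).time + 1 + Φ (done ++ [b]) (f b s).val ≤ Φ done s)
    {s : σ} (h0 : I [] s) :
    I L (forEach L s f).val ∧ (forEach L s f).time + Φ L (forEach L s f).val ≤ Φ [] s + 1 := by
  suffices H : ∀ rest done s, L = done ++ rest → I done s →
      I L (forEach rest s f).val ∧
        (forEach rest s f).time + Φ L (forEach rest s f).val ≤ Φ done s + 1 from
    H L [] s rfl h0
  intro rest
  induction rest with
  | nil =>
    intro done s hL hI
    simp only [List.append_nil] at hL
    subst hL
    simp only [forEach_nil, op_val, op_time]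
    exact ⟨hI, by omega⟩
  | cons b rest ih =>
    intro done s hL hI
    obtain ⟨h1, h2⟩ := h done b rest s hL hI
    obtain ⟨h3, h4⟩ := ih (done ++ [b]) (f b s).val (by simp [hL]) h1
    rw [forEach_cons_val, forEach_cons_time]
    exact ⟨h3, by omega⟩

/-- Invariant of a loop. -/
theorem forEach_inv {L : List β} {f : β → σ → Timed σ} (I : List β → σ → Prop)
    (h : ∀ done b rest s, L = done ++ b :: rest → I done s → I (done ++ [b]) (f b s).val)
    {s : σ} (h0 : I [] s) : I L (forEach L s f).val := by
  suffices H : ∀ rest done s, L = done ++ rest → I done s → I L (forEach rest s f).val from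
    H L [] s rfl h0
  intro rest
  induction rest with
  | nil =>
    intro done s hL hI
    simp only [List.append_nil] at hL
    subst hL
    exact hI
  | cons b rest ih =>
    intro done s hL hI
    exact ih (done ++ [b]) (f b s).val (by simp [hL]) (h done b rest s hL hI)

/-- Invariant and potential for a loop over an interval of numbers. -/
theorem forEach_range'_spec {f : ℕ → σ → Timed σ} (I : ℕ → σ → Prop) (Φ : ℕ → σ → ℕ) (k a : ℕ)
    (h : ∀ i s, a ≤ i → i < a + k → I i s →
      I (i + 1) (f i s).val ∧ (f i s).time + 1 + Φ (i + 1) (f i s).val ≤ Φ i s)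
    {s : σ} (h0 : I a s) :
    I (a + k) (forEach (List.range' a k) s f).val ∧
      (forEach (List.range' a k) s f).time + Φ (a + k) (forEach (List.range' a k) s f).val
        ≤ Φ a s + 1 := by
  induction k generalizing a s with
  | zero => exact ⟨h0, by simp [List.range', Nat.add_comm]⟩
  | succ k ih =>
    obtain ⟨h1, h2⟩ := h a s le_rfl (by omega) h0
    obtain ⟨h3, h4⟩ := ih (a + 1) (fun i s h5 h6 => h i s (by omega) (by omega)) h1
    rw [List.range'_succ, forEach_cons_val, forEach_cons_time]
    rw [show a + (k + 1) = a + 1 + k by omega]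
    exact ⟨h3, by omega⟩

theorem forEach_range_spec {f : ℕ → σ → Timed σ} (I : ℕ → σ → Prop) (Φ : ℕ → σ → ℕ) (m : ℕ)
    (h : ∀ i s, i < m → I i s →
      I (i + 1) (f i s).val ∧ (f i s).time + 1 + Φ (i + 1) (f i s).val ≤ Φ i s)
    {s : σ} (h0 : I 0 s) :
    I m (forEach (List.range m) s f).val ∧
      (forEach (List.range m) s f).time + Φ m (forEach (List.range m) s f).val ≤ Φ 0 s + 1 := by
  rw [List.range_eq_range']
  simpa using forEach_range'_spec I Φ m 0 (fun i s _ h2 => h i s (by omega)) h0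

theorem forEach_time_le {f : β → σ → Timed σ} (g : β → ℕ) (l : List β)
    (h : ∀ b ∈ l, ∀ s, (f b s).time ≤ g b) (s : σ) :
    (forEach l s f).time ≤ (l.map fun b => g b + 1).sum + 1 := by
  induction l generalizing s with
  | nil => simp
  | cons b l ih =>
    have h1 := h b (by simp) s
    have h2 := ih (fun b hb => h b (by simp [hb])) (f b s).val
    simp only [forEach_cons_time, List.map_cons, List.sum_cons]
    omega

theorem forEach_time_le_const {f : β → σ → Timed σ} (c : ℕ) (l : List β)
    (h : ∀ b ∈ l, ∀ s, (f b s).time ≤ c) (s : σ) :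
    (forEach l s f).time ≤ (c + 1) * l.length + 1 := by
  have := forEach_time_le (fun _ => c) l h s
  rw [List.map_const', List.sum_replicate, smul_eq_mul] at this
  linarith [Nat.mul_comm (c + 1) l.length]

/-- Invariant and potential for a while loop. -/
theorem whileDo_spec {cond : σ → Bool} {body : σ → Timed σ} (I : σ → Prop) (Φ : σ → ℕ)
    (h : ∀ s, cond s = true → I s →
      I (body s).val ∧ (body s).time + 1 + Φ (body s).val ≤ Φ s) (k : ℕ) {s : σ} (h0 : I s) :
    I (whileDo k cond body s).val ∧
      (whileDo k cond body s).time + Φ (whileDo k cond body s).val ≤ Φ s + 1 := by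
  induction k generalizing s with
  | zero => exact ⟨h0, by simp only [whileDo, op_time, op_val]; omega⟩
  | succ k ih =>
    by_cases hc : cond s = true
    · obtain ⟨h1, h2⟩ := h s hc h0
      obtain ⟨h3, h4⟩ := ih h1
      simp only [whileDo, hc, if_true, bind_val, bind_time, op_val, op_time]
      exact ⟨h3, by omega⟩
    · simp only [whileDo, hc]
      exact ⟨h0, by simp [Nat.add_comm]⟩

/-- A while loop runs until its condition fails if the bound exceeds a decreasing measure. -/
theorem whileDo_cond_false {cond : σ → Bool} {body : σ → Timed σ} (I : σ → Prop) (μ : σ → ℕ)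
    (h : ∀ s, cond s = true → I s → I (body s).val ∧ μ (body s).val < μ s) (k : ℕ) {s : σ}
    (h0 : I s) (hk : μ s ≤ k) : cond (whileDo k cond body s).val = false := by
  induction k generalizing s with
  | zero =>
    simp only [whileDo, op_val]
    by_contra hc
    have := (h s (by simpa using hc) h0).2
    omega
  | succ k ih =>
    by_cases hc : cond s = true
    · obtain ⟨h1, h2⟩ := h s hc h0
      simp only [whileDo, hc, if_true, bind_val, op_val]
      exact ih h1 (by omega)
    · simp only [whileDo, hc]
      simpa using hc

theorem len_val (l : List α) : (len l).val = l.length := by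
  have := forEach_inv (L := l) (f := fun (_ : α) k => op (k + 1)) (fun done k => k = done.length)
    (fun done b rest s _ h => by simp [h]) (s := 0) rfl
  exact this

theorem len_time (l : List α) : (len l).time ≤ 2 * l.length + 1 :=
  forEach_time_le_const 1 l (fun _ _ _ => by simp) 0

end Timed

/-! ### Cost of the elementary subroutines. -/

section Simple

variable {n : ℕ}

theorem mark_val (U : List (Fin n)) (v : Fin n) : (mark U).val v = decide (v ∈ U) := by
  have := forEach_inv (L := U) (f := fun v (a : Fin n → Bool) => wr a v true)
    (fun done a => ∀ v, a v = decide (v ∈ done)) (fun done b rest s _ h v => by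
      by_cases hv : v = b
      · subst hv; simp
      · simp [h, hv]) (s := fun _ => false) (by simp)
  exact this v

theorem mark_time (U : List (Fin n)) : (mark U).time ≤ n + 2 * U.length + 2 := by
  have := forEach_time_le_const (f := fun v (a : Fin n → Bool) => wr a v true) 1 U
    (fun _ _ _ => by simp) (fun _ => false)
  simp only [mark, newArr_bind_time]
  omega

theorem factorials_time (k : ℕ) : (factorials k).time ≤ 5 * k + 3 := by
  have := forEach_time_le_const (f := fun i (a : ℕ → ℕ) => do
    let f ← rd a i
    let g ← op ((i + 1) * f)
    wr a (i + 1) g) 3 (List.range k) (fun _ _ _ => by simp) (fun _ => 1)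
  simp only [factorials, newArr_bind_time]
  simp only [List.length_range] at this
  omega

theorem phiStep_time (fact : ℕ → ℕ) (x : ℕ) (l : List (ℕ × ℕ)) :
    (phiStep fact x l).time ≤ 4 * l.length + 2 := by
  have := forEach_time_le_const (f := fun (p : ℕ × ℕ) r => do
    let g ← rd fact (x - p.1)
    let h ← op (g * p.2)
    op (r - h)) 3 l (fun _ _ _ => by simp) (fact x)
  simp only [phiStep, rd_bind_time]
  omega

/-- The sum for each prefix runs over the prefixes before it, whence the quadratic bound. -/
theorem phi_time (fact : ℕ → ℕ) (size : ℕ) (X : List ℕ) :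
    (phi fact size X).time ≤ 8 * (X.length + 1) ^ 2 := by
  have := forEach_spec (L := X) (f := fun x (l : List (ℕ × ℕ)) => do
    let f ← phiStep fact x l
    op ((x, f) :: l)) (fun done l => l.length = done.length)
    (fun done _ => (4 * X.length + 4) * (X.length - done.length))
    (fun done b rest s hL h => by
      refine ⟨by simp [bind_val, h], ?_⟩
      have h1 := phiStep_time fact b s
      have h2 : X.length = done.length + (rest.length + 1) := by simp [hL]
      have h3 : X.length - done.length = rest.length + 1 := by omega
      have h4 : X.length - (done ++ [b]).length = rest.length := by simp; omega
      simp only [bind_time, op_time, h3, h4]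
      rw [h] at h1
      nlinarith) (s := []) rfl
  obtain ⟨h1, h2⟩ := this
  have h3 := phiStep_time fact size
    (forEach X [] fun x (l : List (ℕ × ℕ)) => do
      let f ← phiStep fact x l
      op ((x, f) :: l)).val
  simp only [phi, bind_time]
  rw [h1] at h3
  simp only [List.length_nil, Nat.sub_zero, Nat.sub_self, Nat.mul_zero] at h2
  nlinarith

end Simple

end CliquePicking

namespace CliquePicking

open SimpleGraph

/-! ### Partition refinement -/

section Refine

variable {n : ℕ} {U : List (Fin n)}

/-- The positions `0, …, |U| - 1` hold the vertices in `U`, and the positions from `i` on are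
partitioned into segments that correspond to the sets. -/
structure Layout (U : List (Fin n)) (i : ℕ) (s : Search n) : Prop where
  perm_spec : ∀ j < U.length, s.perm j ∈ U ∧ s.pos (s.perm j) = j
  pos_spec : ∀ u ∈ U, s.pos u < U.length ∧ s.perm (s.pos u) = u
  cls_spec : ∀ u ∈ U, i ≤ s.pos u →
    s.cls u < s.next ∧ s.start (s.cls u) ≤ s.pos u ∧ s.pos u < s.finish (s.cls u)
  seg : ∀ c < s.next, ∀ j, s.start c ≤ j → j < s.finish c →
    i ≤ j ∧ j < U.length ∧ s.cls (s.perm j) = c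

/-- The state `s` in the middle of round `i`, which began with the state `s₀`, when the neighbours
in `M` have been moved. -/
structure MidRound (U : List (Fin n)) (i : ℕ) (s₀ : Search n) (M : List (Fin n))
    (s : Search n) : Prop extends Layout U (i + 1) s where
  perm_eq : ∀ j ≤ i, s.perm j = s₀.perm j
  next_le : s₀.next ≤ s.next
  cls_lt : ∀ u ∈ U, i < s.pos u → s₀.cls u < s₀.next
  notMem : ∀ u ∈ U, i < s.pos u → u ∉ M → s.cls u = s₀.cls u
  isMem : ∀ u ∈ U, i < s.pos u → u ∈ M →
    s.cls u = s.twin (s₀.cls u) ∧ s.stamp (s₀.cls u) = i + 1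
  twin_spec : ∀ d, s.stamp d = i + 1 → d < s₀.next ∧ s₀.next ≤ s.twin d ∧ s.twin d < s.next ∧
    s.finish (s.twin d) = s.start d ∧ s.start (s.twin d) ≤ s.start d
  twin_inj : ∀ d d', s.stamp d = i + 1 → s.stamp d' = i + 1 → s.twin d = s.twin d' → d = d'
  stamp_le : ∀ c, s.stamp c ≤ i + 1
  order : ∀ u ∈ U, ∀ u' ∈ U, i < s.pos u → s.pos u < s.pos u' →
    (s₀.cls u = s₀.cls u' ∧ (u' ∈ M → u ∈ M)) ∨
      (s₀.cls u ≠ s₀.cls u' ∧ s₀.pos u < s₀.pos u')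
  lab_eq : s.lab = s₀.lab

variable {i : ℕ} {s₀ s : Search n} {M : List (Fin n)} {w : Fin n}

/-- Introducing an empty twin of an existing set. -/
theorem MidRound.split (h : MidRound U i s₀ M s) (hw : w ∈ U) (hiw : i < s.pos w) (hwM : w ∉ M)
    (hst : s.stamp (s.cls w) ≠ i + 1) :
    MidRound U i s₀ M { s with
      stamp := Function.update s.stamp (s.cls w) (i + 1)
      twin := Function.update s.twin (s.cls w) s.next
      start := Function.update s.start s.next (s.start (s.cls w))
      finish := Function.update s.finish s.next (s.start (s.cls w))
      next := s.next + 1 } := by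
  have hd := h.cls_spec w hw hiw
  have hd0 : s.cls w = s₀.cls w := h.notMem w hw hiw hwM
  have hdn : s.cls w < s₀.next := by rw [hd0]; exact h.cls_lt w hw hiw
  have hnext := h.next_le
  refine ⟨⟨h.perm_spec, h.pos_spec, ?_, ?_⟩, h.perm_eq, ?_, h.cls_lt, h.notMem, ?_, ?_, ?_, ?_,
    h.order, h.lab_eq⟩
  · intro u hu hiu
    have := h.cls_spec u hu hiu
    dsimp only
    rw [Function.update_of_ne (by omega), Function.update_of_ne (by omega)]
    omega
  · intro c hc j h1 h2
    dsimp only at hc h1 h2 ⊢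
    by_cases hcn : c = s.next
    · subst hcn
      rw [Function.update_self] at h1 h2
      omega
    · rw [Function.update_of_ne hcn] at h1 h2
      exact h.seg c (by omega) j h1 h2
  · dsimp only
    omega
  · intro u hu hiu huM
    have := h.isMem u hu hiu huM
    have hne : s₀.cls u ≠ s.cls w := fun h' => hst (h' ▸ this.2)
    dsimp only
    rw [Function.update_of_ne hne, Function.update_of_ne hne]
    exact this
  · intro d hds
    dsimp only at hds ⊢
    by_cases hdw : d = s.cls w
    · subst hdw
      rw [Function.update_self, Function.update_self, Function.update_self,
        Function.update_of_ne (by omega)]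
      omega
    · rw [Function.update_of_ne hdw] at hds
      have := h.twin_spec d hds
      rw [Function.update_of_ne hdw, Function.update_of_ne (by omega),
        Function.update_of_ne (by omega), Function.update_of_ne (by omega)]
      omega
  · intro d d' h1 h2 h3
    dsimp only at h1 h2 h3
    by_cases hdw : d = s.cls w <;> by_cases hdw' : d' = s.cls w
    · omega
    · rw [hdw, Function.update_self, Function.update_of_ne hdw'] at h3
      rw [Function.update_of_ne hdw'] at h2
      have := h.twin_spec d' h2
      omega
    · rw [hdw', Function.update_self, Function.update_of_ne hdw] at h3
      rw [Function.update_of_ne hdw] at h1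
      have := h.twin_spec d h1
      omega
    · rw [Function.update_of_ne hdw, Function.update_of_ne hdw'] at h3
      rw [Function.update_of_ne hdw] at h1
      rw [Function.update_of_ne hdw'] at h2
      exact h.twin_inj d d' h1 h2 h3
  · intro c
    dsimp only
    by_cases hc : c = s.cls w
    · subst hc
      rw [Function.update_self]
    · rw [Function.update_of_ne hc]
      exact h.stamp_le c

/-- Moving a vertex from its set to the twin of this set. -/
theorem MidRound.move (h : MidRound U i s₀ M s) (hw : w ∈ U) (hiw : i < s.pos w) (hwM : w ∉ M)
    (hst : s.stamp (s.cls w) = i + 1) {f : ℕ} (hf : s.start (s.cls w) = f) :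
    MidRound U i s₀ (M ++ [w]) { s with
      perm := Function.update (Function.update s.perm (s.pos w) (s.perm f)) f w
      pos := Function.update (Function.update s.pos (s.perm f) (s.pos w)) w f
      start := Function.update s.start (s.cls w) (f + 1)
      finish := Function.update s.finish (s.twin (s.cls w)) (f + 1)
      cls := Function.update s.cls w (s.twin (s.cls w)) } := by
  set d := s.cls w with hd
  set e := s.twin d with he
  set x := s.perm f with hx
  set q := s.pos w with hq
  obtain ⟨hd1, hd2, hd3⟩ := h.cls_spec w hw hiw
  rw [← hd, hf] at hd2
  rw [← hd] at hd1 hd3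
  obtain ⟨hf1, hf2, hf3⟩ := h.seg d hd1 f (by omega) (by omega)
  obtain ⟨hxU, hxf⟩ := h.perm_spec f hf2
  obtain ⟨hqm, hqw⟩ := h.pos_spec w hw
  obtain ⟨ht1, ht2, ht3, ht4, ht5⟩ := h.twin_spec d hst
  rw [← he] at ht2 ht3 ht4 ht5
  rw [hf] at ht4 ht5
  rw [← hx] at hxU hxf hf3
  rw [← hq] at hqm hqw
  have hed : e ≠ d := by omega
  -- A vertex that still carries the number `d` has not been moved, since twins have numbers from
  -- `s₀.next` on.
  have hcls_d : ∀ u ∈ U, i < s.pos u → s.cls u = d → u ∉ M ∧ s₀.cls u = d := by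
    intro u hu hiu hud
    have huM : u ∉ M := by
      intro huM
      obtain ⟨h1, h2⟩ := h.isMem u hu hiu huM
      have := h.twin_spec _ h2
      omega
    exact ⟨huM, by rw [← h.notMem u hu hiu huM, hud]⟩
  have hposx : x ≠ w → f ≠ q := by
    intro hne h'
    exact hne (by rw [hx, h', hqw])
  have hpos : ∀ u, u ≠ w → u ≠ x →
      Function.update (Function.update s.pos x q) w f u = s.pos u := fun u h1 h2 => by
    rw [Function.update_of_ne h1, Function.update_of_ne h2]
  have hpos_w : Function.update (Function.update s.pos x q) w f w = f := Function.update_self ..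
  have hpos_x : x ≠ w → Function.update (Function.update s.pos x q) w f x = q := fun h1 => by
    rw [Function.update_of_ne h1, Function.update_self]
  have hperm : ∀ j, j ≠ f → j ≠ q →
      Function.update (Function.update s.perm q x) f w j = s.perm j := fun j h1 h2 => by
    rw [Function.update_of_ne h1, Function.update_of_ne h2]
  have hperm_f : Function.update (Function.update s.perm q x) f w f = w := Function.update_self ..
  have hperm_q : q ≠ f → Function.update (Function.update s.perm q x) f w q = x := fun h1 => by
    rw [Function.update_of_ne h1, Function.update_self]
  have hperm_ne : ∀ j < U.length, j ≠ q → s.perm j ≠ w := by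
    intro j hj hne h'
    have := (h.perm_spec j hj).2
    rw [h'] at this
    omega
  have hpos_ne : ∀ u ∈ U, u ≠ x → s.pos u ≠ f := by
    intro u hu hne h'
    apply hne
    rw [hx, ← h', (h.pos_spec u hu).2]
  have hpos_ne' : ∀ u ∈ U, u ≠ w → s.pos u ≠ q := by
    intro u hu hne h'
    apply hne
    rw [← hqw, ← h', (h.pos_spec u hu).2]
  have hpos_gt : ∀ u ∈ U, i < Function.update (Function.update s.pos x q) w f u → i < s.pos u := by
    intro u hu h1
    by_cases huw : u = w
    · rw [huw]; omega
    · by_cases hux : u = x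
      · rw [hux]; omega
      · rwa [hpos u huw hux] at h1
  have hcls : ∀ u, u ≠ w → Function.update s.cls w e u = s.cls u := fun u h1 =>
    Function.update_of_ne h1 ..
  refine ⟨⟨?_, ?_, ?_, ?_⟩, ?_, h.next_le, ?_, ?_, ?_, ?_, h.twin_inj, h.stamp_le, ?_, h.lab_eq⟩
  · intro j hj
    dsimp only
    by_cases hjf : j = f
    · subst hjf
      rw [hperm_f, hpos_w]
      exact ⟨hw, rfl⟩
    · by_cases hjq : j = q
      · subst hjq
        have hxw : x ≠ w := fun h' => hjf (by rw [hq, ← h', hxf])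
        rw [hperm_q hjf, hpos_x hxw]
        exact ⟨hxU, rfl⟩
      · rw [hperm j hjf hjq]
        obtain ⟨h1, h2⟩ := h.perm_spec j hj
        refine ⟨h1, ?_⟩
        rw [hpos _ (hperm_ne j hj hjq) (fun h' => hjf (by rw [← h2, h', hxf]))]
        exact h2
  · intro u hu
    dsimp only
    by_cases huw : u = w
    · subst huw
      rw [hpos_w, hperm_f]
      exact ⟨hf2, rfl⟩
    · by_cases hux : u = x
      · rw [hux] at huw ⊢
        rw [hpos_x huw, hperm_q (hposx huw).symm]
        exact ⟨hqm, rfl⟩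
      · rw [hpos u huw hux, hperm _ (hpos_ne u hu hux) (hpos_ne' u hu huw)]
        exact h.pos_spec u hu
  · intro u hu hiu
    dsimp only at hiu ⊢
    by_cases huw : u = w
    · subst huw
      rw [hpos_w, Function.update_self, Function.update_of_ne hed, Function.update_self]
      omega
    · rw [hcls u huw]
      by_cases hux : u = x
      · rw [hux] at huw ⊢
        have := hposx huw
        rw [hpos_x huw, hf3, Function.update_self, Function.update_of_ne hed.symm]
        omega
      · rw [hpos u huw hux] at hiu ⊢
        have h1 := h.cls_spec u hu hiu
        have h2 := hpos_ne u hu hux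
        by_cases h3 : s.cls u = d
        · rw [h3] at h1 ⊢
          rw [Function.update_self, Function.update_of_ne hed.symm]
          omega
        · rw [Function.update_of_ne h3]
          by_cases h4 : s.cls u = e
          · rw [h4] at h1 ⊢
            rw [Function.update_self]
            omega
          · rw [Function.update_of_ne h4]
            exact h1
  · intro c hc j h1 h2
    dsimp only at hc h1 h2 ⊢
    by_cases hcd : c = d
    · subst hcd
      rw [Function.update_self] at h1
      rw [Function.update_of_ne hed.symm] at h2
      obtain ⟨h3, h4, h5⟩ := h.seg _ hc j (by omega) h2
      refine ⟨h3, h4, ?_⟩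
      by_cases hjq : j = q
      · have hqf : q ≠ f := by omega
        have hxw : x ≠ w := fun h' => hqf (by rw [hq, ← h', hxf])
        rw [hjq, hperm_q hqf, hcls x hxw, hf3]
      · rw [hperm j (by omega) hjq, hcls _ (hperm_ne j h4 hjq), h5]
    · rw [Function.update_of_ne hcd] at h1
      by_cases hce : c = e
      · subst hce
        rw [Function.update_self] at h2
        by_cases hjf : j = f
        · subst hjf
          rw [hperm_f, Function.update_self]
          exact ⟨hf1, hf2, rfl⟩
        · obtain ⟨h3, h4, h5⟩ := h.seg _ hc j h1 (by omega)
          refine ⟨h3, h4, ?_⟩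
          rw [hperm j hjf (by omega), hcls _ (hperm_ne j h4 (by omega)), h5]
      · rw [Function.update_of_ne hce] at h2
        obtain ⟨h3, h4, h5⟩ := h.seg _ hc j h1 h2
        refine ⟨h3, h4, ?_⟩
        have hjf : j ≠ f := by
          intro h'
          apply hcd
          rw [← h5, h', ← hx, hf3]
        have hjq : j ≠ q := by
          intro h'
          apply hcd
          rw [← h5, h', hqw]
        rw [hperm j hjf hjq, hcls _ (hperm_ne j h4 hjq), h5]
  · intro j hj
    dsimp only
    rw [hperm j (by omega) (by omega)]
    exact h.perm_eq j hj
  · intro u hu hiu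
    exact h.cls_lt u hu (hpos_gt u hu hiu)
  · intro u hu hiu huM
    dsimp only at hiu ⊢
    simp only [List.mem_append, List.mem_singleton, not_or] at huM
    rw [hcls u huM.2]
    exact h.notMem u hu (hpos_gt u hu hiu) huM.1
  · intro u hu hiu huM
    dsimp only at hiu ⊢
    by_cases huw : u = w
    · subst huw
      rw [Function.update_self, (hcls_d u hu hiw rfl).2]
      exact ⟨he, hst⟩
    · simp only [List.mem_append, List.mem_singleton, huw, or_false] at huM
      rw [hcls u huw]
      exact h.isMem u hu (hpos_gt u hu hiu) huM
  · intro d' hd'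
    dsimp only at hd' ⊢
    obtain ⟨h1, h2, h3, h4, h5⟩ := h.twin_spec d' hd'
    refine ⟨h1, h2, h3, ?_⟩
    by_cases hdd : d' = d
    · subst hdd
      rw [← he, Function.update_self, Function.update_self, Function.update_of_ne hed]
      exact ⟨rfl, by omega⟩
    · have hne : s.twin d' ≠ e := fun h' => hdd (h.twin_inj d' d hd' hst h')
      rw [Function.update_of_ne hne, Function.update_of_ne hdd,
        Function.update_of_ne (by omega)]
      exact ⟨h4, h5⟩
  · intro u hu u' hu' hiu huu
    dsimp only at hiu huu ⊢
    have hiu0 := hpos_gt u hu hiu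
    simp only [List.mem_append, List.mem_singleton]
    -- The segment of `d` holds only members that have not been moved, so their relative order is
    -- irrelevant and `x` may take the place of `w`.
    have hseg : ∀ v ∈ U, f ≤ s.pos v → s.pos v < s.finish d → v ∉ M ∧ s₀.cls v = d := by
      intro v hv h1 h2
      have := h.seg d hd1 (s.pos v) (by omega) h2
      rw [(h.pos_spec v hv).2] at this
      exact hcls_d v hv (by omega) this.2.2
    by_cases huw : u = w
    · subst huw
      rw [hpos_w] at huu
      have huw' : u' ≠ u := by
        rintro rfl
        rw [hpos_w] at huu
        omega
      have hcase : s.pos u' < s.finish d ∧ f ≤ s.pos u' ∨ q < s.pos u' := by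
        by_cases hux : u' = x
        · rw [hux]; omega
        · rw [hpos u' huw' hux] at huu
          omega
      rcases hcase with hc | hc
      · left
        rw [(hseg u hw (by omega) (by omega)).2, (hseg u' hu' hc.2 hc.1).2]
        simp
      · rcases h.order u hw u' hu' hiw hc with h1 | h1
        · exact Or.inl ⟨h1.1, fun _ => Or.inr rfl⟩
        · exact Or.inr h1
    · by_cases huw' : u' = w
      · subst huw'
        rw [hpos_w] at huu
        have hux : u ≠ x := by
          intro hux
          rw [hux] at huw huu
          rw [hpos_x huw] at huu
          omega
        rw [hpos u huw hux] at huu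
        rcases h.order u hu u' hu' hiu0 (by omega) with h1 | h1
        · left
          refine ⟨h1.1, fun _ => ?_⟩
          by_contra huM
          simp only [not_or] at huM
          have h2 := h.notMem u hu hiu0 huM.1
          have h3 := (h.cls_spec u hu hiu0).2.1
          rw [h2, h1.1, (hcls_d u' hw hiw rfl).2] at h3
          omega
        · exact Or.inr h1
      · have hold : s.pos u < s.pos u' → (s₀.cls u = s₀.cls u' ∧ (u' ∈ M ∨ u' = w → u ∈ M ∨ u = w)) ∨
            (s₀.cls u ≠ s₀.cls u' ∧ s₀.pos u < s₀.pos u') := by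
          intro hlt
          rcases h.order u hu u' hu' hiu0 hlt with h1 | h1
          · exact Or.inl ⟨h1.1, fun h2 => Or.inl (h1.2 (h2.resolve_right huw'))⟩
          · exact Or.inr h1
        by_cases hux : u = x
        · have hux' : u' ≠ x := by
            rintro rfl
            rw [hux] at huu
            omega
          rw [hpos u' huw' hux'] at huu
          rw [hux] at huu huw
          rw [hpos_x huw] at huu
          apply hold
          rw [hux]
          omega
        · rw [hpos u huw hux] at huu
          by_cases hux' : u' = x
          · rw [hux'] at huu huw'
            rw [hpos_x huw'] at huu
            by_cases hfu : s.pos u < f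
            · apply hold
              rw [hux']
              omega
            · left
              have h1 := hseg u hu (by omega) (by omega)
              have h2 := hseg x hxU (by omega) (by omega)
              rw [hux', h1.2, h2.2]
              simp [h2.1, huw']
          · rw [hpos u' huw' hux'] at huu
            exact hold huu

/-- If the set is split for the first time in this round, an empty twin is created by `split`; after
that both cases are an instance of `move`. -/
theorem MidRound.refine (h : MidRound U i s₀ M s) (hw : w ∈ U) (hiw : i < s.pos w)
    (hwM : w ∉ M) : MidRound U i s₀ (M ++ [w]) (refine i w s).val := by
  by_cases hst : s.stamp (s.cls w) = i + 1
  · have := h.move hw hiw hwM hst rfl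
    simpa [CliquePicking.refine, bind_val, hst] using this
  · have h1 := h.split hw hiw hwM hst
    have hne : s.cls w ≠ s.next := (h.cls_spec w hw hiw).1.ne
    have := h1.move (w := w) (f := s.start (s.cls w)) hw hiw hwM (by simp)
      (by simp [Function.update_of_ne hne])
    simpa [CliquePicking.refine, bind_val, hst] using this

theorem refine_time (i : ℕ) (w : Fin n) (s : Search n) : (refine i w s).time ≤ 17 := by
  by_cases hst : s.stamp (s.cls w) = i + 1 <;>
    simp [CliquePicking.refine, bind_val, bind_time, hst]

end Refine

end CliquePicking

namespace CliquePicking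

open SimpleGraph

/-! ### The rounds of the search -/

section Rounds

variable {n : ℕ} {G : SimpleGraph (Fin n)} {U K : List (Fin n)}

/-- The state at the beginning of round `i` of the search in `G[U]` that starts with `K`. -/
structure RoundInv (G : SimpleGraph (Fin n)) (U K : List (Fin n)) (i : ℕ) (s : Search n) : Prop
    extends Layout U i s where
  stamp_le : ∀ c, s.stamp c ≤ i
  agree : ∀ u ∈ U, ∀ u' ∈ U, i ≤ s.pos u → i ≤ s.pos u' → s.cls u = s.cls u' →
    (∀ j < i, G.Adj (s.perm j) u ↔ G.Adj (s.perm j) u') ∧ s.lab u = s.lab u' ∧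
      (u ∈ K ↔ u' ∈ K)
  order : ∀ u ∈ U, ∀ u' ∈ U, i ≤ s.pos u → s.pos u < s.pos u' → s.cls u ≠ s.cls u' →
    (u ∈ K ∧ u' ∉ K) ∨ ∃ j < i, G.Adj (s.perm j) u ∧ ¬ G.Adj (s.perm j) u'
  first : ∀ u ∈ U, ∀ u' ∈ U, u ∉ K → u' ∈ K → s.pos u' < s.pos u
  maxNbr : ∀ b < i, ∀ u ∈ U, b < s.pos u → ∀ a < b, G.Adj (s.perm a) u →
    ¬ G.Adj (s.perm a) (s.perm b) → ∃ d < b, G.Adj (s.perm d) (s.perm b) ∧ ¬ G.Adj (s.perm d) u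
  lab_mem : ∀ u, s.lab u ≠ 0 → u ∈ U ∧ u ∉ K
  lab_visited : ∀ u ∈ U, s.pos u < i → u ∉ K → s.lab u ≠ 0
  lab_le : ∀ u j, s.lab u = j + 1 → j < i ∧ j ≤ s.pos u ∧ s.lab (s.perm j) = j + 1
  -- Containment of visited neighbourhoods suffices for membership: the set added in round `j` is
  -- the first non-empty one, and by `order` each later set outside `K` misses a visited neighbour
  -- of it.
  lab_iff : ∀ u j, s.lab u = j + 1 → ∀ w ∈ U, j ≤ s.pos w →
    ((∀ a < j, G.Adj (s.perm a) u → G.Adj (s.perm a) w) ↔ s.lab w = j + 1)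

variable {i : ℕ} {s : Search n}

/-- The vertices that are added to a set in `L` in round `i`. -/
def IsNew (U K : List (Fin n)) (i : ℕ) (s : Search n) (u : Fin n) : Prop :=
  s.lab (s.perm i) = 0 ∧ s.perm i ∉ K ∧ u ∈ U ∧ i ≤ s.pos u ∧ s.cls u = s.cls (s.perm i)

open Classical in
/-- The labels after the first part of round `i`. -/
noncomputable def newLab (U K : List (Fin n)) (i : ℕ) (s : Search n) (u : Fin n) : ℕ :=
  if IsNew U K i s u then i + 1 else s.lab u

/-- The state in round `i` before the sets are split. -/
noncomputable def roundState (U K : List (Fin n)) (i : ℕ) (s : Search n) : Search n :=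
  { s with lab := newLab U K i s, start := Function.update s.start (s.cls (s.perm i)) (i + 1) }

/-- The segments cover only positions from `i` on, so the one that contains position `i` begins
there: the vertex visited next belongs to the first non-empty set. -/
theorem RoundInv.start_eq (h : RoundInv G U K i s) (hi : i < U.length) :
    s.cls (s.perm i) < s.next ∧ s.start (s.cls (s.perm i)) = i ∧
      i < s.finish (s.cls (s.perm i)) := by
  obtain ⟨h1, h2⟩ := h.perm_spec i hi
  obtain ⟨h3, h4, h5⟩ := h.cls_spec _ h1 h2.ge
  rw [h2] at h4 h5
  have := (h.seg _ h3 _ le_rfl (by omega)).1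
  omega

theorem RoundInv.midRound_nil (h : RoundInv G U K i s) (hi : i < U.length) :
    MidRound U i (roundState U K i s) [] (roundState U K i s) := by
  have hst := h.start_eq hi
  have hstamp : ∀ d, s.stamp d ≠ i + 1 := fun d h' => by
    have := h.stamp_le d
    omega
  refine ⟨⟨h.perm_spec, h.pos_spec, ?_, ?_⟩, fun _ _ => rfl, le_rfl, ?_, fun _ _ _ _ => rfl,
    ?_, ?_, ?_, ?_, ?_, rfl⟩
  · intro u hu hiu
    dsimp only [roundState] at hiu ⊢
    have := h.cls_spec u hu (by omega)
    by_cases hc : s.cls u = s.cls (s.perm i)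
    · rw [hc] at this ⊢
      rw [Function.update_self]
      omega
    · rw [Function.update_of_ne hc]
      exact this
  · intro c hc j h1 h2
    dsimp only [roundState] at hc h1 h2 ⊢
    by_cases hcc : c = s.cls (s.perm i)
    · subst hcc
      rw [Function.update_self] at h1
      have := h.seg _ hc j (by omega) h2
      exact ⟨h1, this.2⟩
    · rw [Function.update_of_ne hcc] at h1
      obtain ⟨h3, h4⟩ := h.seg _ hc j h1 h2
      have : i ≠ j := by
        rintro rfl
        exact hcc h4.2.symm
      exact ⟨by omega, h4⟩
  · exact fun u hu hiu => (h.cls_spec u hu (le_of_lt hiu)).1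
  · intro u _ _ huM
    simp at huM
  · exact fun d hd => absurd hd (hstamp d)
  · exact fun d _ hd => absurd hd (hstamp d)
  · exact fun c => (h.stamp_le c).trans (Nat.le_succ _)
  · intro u _ u' _ _ hlt
    by_cases hc : s.cls u = s.cls u'
    · exact Or.inl ⟨hc, by simp⟩
    · exact Or.inr ⟨hc, hlt⟩

/-- The positions up to `i` do not change in round `i`. -/
theorem pos_stable {s' : Search n} (h : Layout U i s) (h' : Layout U (i + 1) s')
    (hp : ∀ j ≤ i, s'.perm j = s.perm j) {u : Fin n} (hu : u ∈ U) :
    (∀ j ≤ i, s'.pos u = j ↔ s.pos u = j) ∧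
      (∀ j ≤ i + 1, j ≤ s'.pos u ↔ j ≤ s.pos u) := by
  have key : ∀ j ≤ i, s'.pos u = j ↔ s.pos u = j := by
    intro j hj
    obtain ⟨h1, h2⟩ := h.pos_spec u hu
    obtain ⟨h3, h4⟩ := h'.pos_spec u hu
    constructor
    · rintro rfl
      rw [hp _ hj] at h4
      have := (h.perm_spec _ h3).2
      rw [h4] at this
      exact this
    · rintro rfl
      rw [← hp _ hj] at h2
      have := (h'.perm_spec _ h1).2
      rw [h2] at this
      exact this
  refine ⟨key, fun j hj => ?_⟩
  rcases Nat.lt_or_ge i (s.pos u) with h1 | h1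
  · rcases Nat.lt_or_ge i (s'.pos u) with h2 | h2
    · omega
    · have := (key _ h2).1 rfl
      omega
  · have := (key _ h1).2 rfl
    omega

/-- Labels are constant on each set of the sequence, so the vertices labelled in round `i` had label
0 and no older label is overwritten. -/
theorem newLab_of_le (h : RoundInv G U K i s) {j : ℕ} (hj : j < i) (u : Fin n) :
    newLab U K i s u = j + 1 ↔ s.lab u = j + 1 := by
  unfold newLab
  split_ifs with hN
  · obtain ⟨h1, h2, h3, h4, h5⟩ := hN
    by_cases hi : i < U.length
    · obtain ⟨h6, h7⟩ := h.perm_spec i hi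
      have := (h.agree u h3 _ h6 h4 h7.ge h5).2.1
      rw [this, h1]
      omega
    · have := (h.pos_spec u h3).1
      omega
  · rfl

theorem newLab_eq_iff (h : RoundInv G U K i s) (u : Fin n) :
    newLab U K i s u = i + 1 ↔ IsNew U K i s u := by
  unfold newLab
  split_ifs with hN
  · simp [hN]
  · simp only [hN, iff_false]
    intro h'
    have := (h.lab_le u i h').1
    omega

/-- The invariant after all neighbours of the vertex visited in round `i` have been moved. -/
theorem RoundInv.succ (h : RoundInv G U K i s) (hi : i < U.length)
    (hK : G.IsClique {v | v ∈ K}) {N : List (Fin n)} (hN : ∀ w, w ∈ N ↔ G.Adj (s.perm i) w)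
    {s' : Search n} (h' : MidRound U i (roundState U K i s) N s') :
    RoundInv G U K (i + 1) s' := by
  have hp : ∀ j ≤ i, s'.perm j = s.perm j := h'.perm_eq
  have hst : ∀ u ∈ U, _ := fun u hu => pos_stable h.toLayout h'.toLayout hp hu
  have hlab : s'.lab = newLab U K i s := h'.lab_eq
  obtain ⟨hvU, hvi⟩ := h.perm_spec i hi
  have hge : ∀ u ∈ U, i + 1 ≤ s'.pos u → i < s.pos u := fun u hu h1 =>
    ((hst u hu).2 (i + 1) le_rfl).1 h1
  -- The essence of partition refinement: unvisited vertices stay together exactly if both or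
  -- neither are neighbours of the visited vertex. Twins carry new numbers, distinct for distinct
  -- sets.
  have hclsEq : ∀ u ∈ U, ∀ u' ∈ U, i + 1 ≤ s'.pos u → i + 1 ≤ s'.pos u' →
      (s'.cls u = s'.cls u' ↔ s.cls u = s.cls u' ∧ (u ∈ N ↔ u' ∈ N)) := by
    intro u hu u' hu' hiu hiu'
    have c1 := h'.cls_lt u hu hiu
    have c2 := h'.cls_lt u' hu' hiu'
    by_cases huN : u ∈ N <;> by_cases huN' : u' ∈ N
    · obtain ⟨h1, h2⟩ := h'.isMem u hu hiu huN
      obtain ⟨h3, h4⟩ := h'.isMem u' hu' hiu' huN'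
      rw [h1, h3]
      simp only [huN, huN', and_true]
      constructor
      · exact fun h5 => h'.twin_inj _ _ h2 h4 h5
      · intro h5
        have : (roundState U K i s).cls u = (roundState U K i s).cls u' := h5
        rw [this]
    · obtain ⟨h1, h2⟩ := h'.isMem u hu hiu huN
      have h3 := h'.notMem u' hu' hiu' huN'
      have h4 := h'.twin_spec _ h2
      have hne : ¬ (u ∈ N ↔ u' ∈ N) := by simp [huN, huN']
      simp only [hne, and_false, iff_false]
      omega
    · obtain ⟨h1, h2⟩ := h'.isMem u' hu' hiu' huN'
      have h3 := h'.notMem u hu hiu huN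
      have h4 := h'.twin_spec _ h2
      have hne : ¬ (u ∈ N ↔ u' ∈ N) := by simp [huN, huN']
      simp only [hne, and_false, iff_false]
      omega
    · have h1 := h'.notMem u hu hiu huN
      have h3 := h'.notMem u' hu' hiu' huN'
      rw [h1, h3]
      simp only [huN, huN', and_true]
      rfl
  refine ⟨h'.toLayout, h'.stamp_le, ?_, ?_, ?_, ?_, ?_, ?_, ?_, ?_⟩
  · intro u hu u' hu' hiu hiu' hc
    obtain ⟨hc1, hc2⟩ := (hclsEq u hu u' hu' hiu hiu').1 hc
    have g1 := hge u hu hiu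
    have g2 := hge u' hu' hiu'
    obtain ⟨a1, a2, a3⟩ := h.agree u hu u' hu' g1.le g2.le hc1
    refine ⟨fun j hj => ?_, ?_, a3⟩
    · rw [hp j (by omega)]
      rcases Nat.lt_or_ge j i with hji | hji
      · exact a1 j hji
      · have : j = i := by omega
        subst this
        rw [← hN, ← hN]
        exact hc2
    · rw [hlab]
      have : IsNew U K i s u ↔ IsNew U K i s u' := by
        unfold IsNew
        rw [hc1]
        simp only [hu, hu', g1.le, g2.le, true_and]
      unfold newLab
      by_cases hnew : IsNew U K i s u
      · rw [if_pos hnew, if_pos (this.1 hnew)]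
      · rw [if_neg hnew, if_neg (fun h1 => hnew (this.2 h1)), a2]
  · intro u hu u' hu' hiu hlt hc
    have hiu' : i + 1 ≤ s'.pos u' := by omega
    have g1 := hge u hu hiu
    rcases h'.order u hu u' hu' hiu hlt with ⟨h1, h2⟩ | ⟨h1, h2⟩
    · right
      have : ¬ (u ∈ N ↔ u' ∈ N) := fun h3 =>
        hc ((hclsEq u hu u' hu' hiu hiu').2 ⟨h1, h3⟩)
      refine ⟨i, by omega, ?_, ?_⟩ <;> rw [hp i le_rfl, ← hN] <;> tauto
    · rcases h.order u hu u' hu' g1.le h2 h1 with h3 | ⟨j, hj, h3⟩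
      · exact Or.inl h3
      · exact Or.inr ⟨j, by omega, by rwa [hp j (by omega)]⟩
  · intro u hu u' hu' huK huK'
    have h0 := h.first u hu u' hu' huK huK'
    obtain ⟨e1, f1⟩ := hst u hu
    obtain ⟨e2, f2⟩ := hst u' hu'
    by_contra hlt
    rcases Nat.lt_or_ge i (s.pos u') with h1 | h1
    · have h3 := (f1 (i + 1) le_rfl).2 (by omega)
      have hne : s'.pos u ≠ s'.pos u' := by
        intro h4
        have := (h'.pos_spec u hu).2
        rw [h4, (h'.pos_spec u' hu').2] at this
        exact huK (this ▸ huK')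
      rcases h'.order u hu u' hu' h3 (by omega) with ⟨h4, -⟩ | ⟨-, h4⟩
      · have h5 := (h.agree u hu u' hu' (by omega) (by omega) h4).2.2
        exact huK (h5.2 huK')
      · change s.pos u < s.pos u' at h4
        omega
    · have h2 := (e2 _ h1).2 rfl
      have h3 := (f1 (s.pos u' + 1) (by omega)).2 (by omega)
      omega
  · intro b hb u hu hbu a hab hadj hnadj
    have hbu' : b < s.pos u := ((hst u hu).2 (b + 1) (by omega)).1 hbu
    rw [hp a (by omega)] at hadj hnadj
    rw [hp b (by omega)] at hnadj ⊢
    suffices ∃ d < b, G.Adj (s.perm d) (s.perm b) ∧ ¬ G.Adj (s.perm d) u by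
      obtain ⟨d, hd, h1⟩ := this
      exact ⟨d, hd, by rwa [hp d (by omega)]⟩
    rcases Nat.lt_or_ge b i with hbi | hbi
    · exact h.maxNbr b hbi u hu hbu' a hab hadj hnadj
    · have : b = i := by omega
      subst this
      by_cases hc : s.cls (s.perm b) = s.cls u
      · exact absurd (((h.agree _ hvU u hu hvi.ge hbu'.le hc).1 a hab).2 hadj) hnadj
      -- Either the visited vertex is in `K`, and then all vertices visited before it are in `K` too
      -- and adjacent to it, or `order` supplies the required `d`.
      · rcases h.order _ hvU u hu hvi.ge (by omega) hc with ⟨h1, h2⟩ | h1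
        · exfalso
          obtain ⟨h3, h4⟩ := h.perm_spec a (by omega)
          have haK : s.perm a ∈ K := by
            by_contra haK
            have := h.first _ h3 _ hvU haK h1
            omega
          refine hnadj (hK haK h1 fun h5 => ?_)
          rw [h5] at h4
          omega
        · exact h1
  · intro u hu
    rw [hlab] at hu
    unfold newLab at hu
    split_ifs at hu with h1
    · refine ⟨h1.2.2.1, ?_⟩
      have := (h.agree u h1.2.2.1 _ hvU h1.2.2.2.1 hvi.ge h1.2.2.2.2).2.2
      rw [this]
      exact h1.2.1
    · exact h.lab_mem u hu
  · intro u hu hiu huK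
    rw [hlab]
    unfold newLab
    split_ifs with h1
    · omega
    · rcases Nat.lt_or_ge (s.pos u) i with h2 | h2
      · exact h.lab_visited u hu h2 huK
      · have h3 : s'.pos u = i := by
          have := ((hst u hu).2 i (by omega)).2 h2
          omega
        have h4 := ((hst u hu).1 i le_rfl).1 h3
        have h5 : s.perm i = u := by rw [← h4, (h.pos_spec u hu).2]
        intro h6
        apply h1
        refine ⟨by rwa [h5], by rwa [h5], hu, h2, by rw [h5]⟩
  · intro u j hj
    rw [hlab] at hj ⊢
    have huU : u ∈ U := by
      unfold newLab at hj
      split_ifs at hj with h1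
      · exact h1.2.2.1
      · exact (h.lab_mem u (by omega)).1
    rcases Nat.lt_or_ge j i with hji | hji
    · rw [newLab_of_le h hji] at hj
      obtain ⟨h1, h2, h3⟩ := h.lab_le u j hj
      refine ⟨by omega, ((hst u huU).2 j (by omega)).2 h2, ?_⟩
      rw [hp j (by omega), newLab_of_le h hji]
      exact h3
    · have hji : j = i := by
        by_contra hne
        unfold newLab at hj
        split_ifs at hj
        · omega
        · have := (h.lab_le u j hj).1
          omega
      subst hji
      rw [newLab_eq_iff h] at hj
      refine ⟨by omega, ((hst u huU).2 j (by omega)).2 hj.2.2.2.1, ?_⟩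
      rw [hp j le_rfl, newLab_eq_iff h]
      exact ⟨hj.1, hj.2.1, hvU, hvi.ge, rfl⟩
  · intro u j hj w hw hjw
    rw [hlab] at hj ⊢
    rcases Nat.lt_or_ge j i with hji | hji
    · rw [newLab_of_le h hji] at hj ⊢
      rw [← h.lab_iff u j hj w hw (((hst w hw).2 j (by omega)).1 hjw)]
      constructor
      · intro h1 a ha
        have := h1 a ha
        rwa [hp a (by omega)] at this
      · intro h1 a ha
        rw [hp a (by omega)]
        exact h1 a ha
    · have hji : j = i := by
        by_contra hne
        unfold newLab at hj
        split_ifs at hj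
        · omega
        · have := (h.lab_le u j hj).1
          omega
      subst hji
      rw [newLab_eq_iff h] at hj ⊢
      have hjw' := ((hst w hw).2 j (by omega)).1 hjw
      obtain ⟨h1, h2, h3, h4, h5⟩ := hj
      constructor
      · intro h6
        refine ⟨h1, h2, hw, hjw', ?_⟩
        by_contra hc
        have hne : s.pos w ≠ j := by
          intro h7
          apply hc
          rw [← h7, (h.pos_spec w hw).2]
        -- If `w` were in a later set, some visited vertex would be adjacent to the members of the
        -- first set but not to `w`, against the containment.
        rcases h.order _ hvU w hw hvi.ge (by omega) (fun h => hc h.symm) with h7 | ⟨a, ha, h7, h8⟩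
        · exact h2 h7.1
        · have h9 := ((h.agree u h3 _ hvU h4 hvi.ge h5).1 a ha).2 h7
          have := h6 a ha (by rwa [hp a (by omega)])
          rw [hp a (by omega)] at this
          exact h8 this
      · intro h6 a ha h7
        rw [hp a (by omega)] at h7 ⊢
        obtain ⟨-, -, h8, h9, h10⟩ := h6
        exact ((h.agree u h3 w hw h4 h9 (h5.trans h10.symm)).1 a ha).1 h7

end Rounds

end CliquePicking

namespace CliquePicking

open SimpleGraph

/-! ### Cost of one round of the search. -/

section Visit

variable {n : ℕ} {G : SimpleGraph (Fin n)} {U K : List (Fin n)} {i : ℕ} {s : Search n}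

/-- The number of vertices that are in no set in `L`. -/
def unlabelled (lab : Fin n → ℕ) : ℕ := (Finset.univ.filter fun u => lab u = 0).card

theorem label_loop_val (perm : ℕ → Fin n) (lab : Fin n → ℕ) (x : ℕ) (i k : ℕ) (u : Fin n) :
    ((∃ j, i ≤ j ∧ j < i + k ∧ perm j = u) →
      (forEach (List.range' i k) lab fun j lab => do
        let y ← rd perm j
        wr lab y x).val u = x) ∧
    (¬ (∃ j, i ≤ j ∧ j < i + k ∧ perm j = u) →
      (forEach (List.range' i k) lab fun j lab => do
        let y ← rd perm j
        wr lab y x).val u = lab u) := by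
  refine (forEach_range'_spec (f := fun j (lab : Fin n → ℕ) => do
    let y ← rd perm j
    wr lab y x) (fun m lab' => ((∃ j, i ≤ j ∧ j < m ∧ perm j = u) → lab' u = x) ∧
      (¬ (∃ j, i ≤ j ∧ j < m ∧ perm j = u) → lab' u = lab u)) (fun m _ => 3 * (i + k - m)) k i
    ?_ ?_).1
  · intro m lab' him hmk ⟨h1, h2⟩
    refine ⟨⟨?_, ?_⟩, ?_⟩
    · rintro ⟨j, hij, hjm, rfl⟩
      simp only [rd_bind_val, wr_val]
      by_cases hj : perm j = perm m
      · rw [hj, Function.update_self]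
      · rw [Function.update_of_ne hj]
        have : j ≠ m := fun h => hj (h ▸ rfl)
        exact h1 ⟨j, hij, by omega, rfl⟩
    · intro h3
      simp only [rd_bind_val, wr_val]
      rw [Function.update_of_ne (fun h => h3 ⟨m, him, by omega, h.symm⟩)]
      exact h2 fun ⟨j, hij, hjm, hj⟩ => h3 ⟨j, hij, by omega, hj⟩
    · simp only [rd_bind_time, wr_time]
      omega
  · refine ⟨?_, fun _ => rfl⟩
    rintro ⟨j, h1, h2, -⟩
    omega

/-- The loop spends three steps on each vertex of the set. All of these vertices change their label
from 0 to a positive one, so the drop of `unlabelled` pays for the loop. -/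
theorem RoundInv.label_step (h : RoundInv G U K i s) (hi : i < U.length) :
    (if s.lab (s.perm i) = 0 ∧ decide (s.perm i ∈ K) = false then do
        let e ← rd s.finish (s.cls (s.perm i))
        forEach (List.range' i (e - i)) s.lab fun j lab => do
          let x ← rd s.perm j
          wr lab x (i + 1)
      else pure s.lab : Timed (Fin n → ℕ)).val = newLab U K i s ∧
    (if s.lab (s.perm i) = 0 ∧ decide (s.perm i ∈ K) = false then do
        let e ← rd s.finish (s.cls (s.perm i))
        forEach (List.range' i (e - i)) s.lab fun j lab => do
          let x ← rd s.perm j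
          wr lab x (i + 1)
      else pure s.lab : Timed (Fin n → ℕ)).time + 3 * unlabelled (newLab U K i s)
        ≤ 3 * unlabelled s.lab + 2 := by
  classical
  obtain ⟨hc1, hc2, hc3⟩ := h.start_eq hi
  obtain ⟨hvU, hvi⟩ := h.perm_spec i hi
  by_cases hcond : s.lab (s.perm i) = 0 ∧ decide (s.perm i ∈ K) = false
  · rw [if_pos hcond]
    have hvK : s.perm i ∉ K := by simpa using hcond.2
    set e := s.finish (s.cls (s.perm i)) with he
    have hseg : ∀ j, i ≤ j → j < e → j < U.length ∧ s.cls (s.perm j) = s.cls (s.perm i) :=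
      fun j h1 h2 => (h.seg _ hc1 j (by omega) h2).2
    have hnew : ∀ u, (∃ j, i ≤ j ∧ j < i + (e - i) ∧ s.perm j = u) ↔ IsNew U K i s u := by
      intro u
      constructor
      · rintro ⟨j, h1, h2, rfl⟩
        obtain ⟨h3, h4⟩ := hseg j h1 (by omega)
        obtain ⟨h5, h6⟩ := h.perm_spec j h3
        exact ⟨hcond.1, hvK, h5, by omega, h4⟩
      · rintro ⟨-, -, h3, h4, h5⟩
        have := (h.cls_spec u h3 h4).2.2
        rw [h5] at this
        exact ⟨s.pos u, h4, by omega, (h.pos_spec u h3).2⟩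
    constructor
    · funext u
      obtain ⟨h1, h2⟩ := label_loop_val s.perm s.lab (i + 1) i (e - i) u
      simp only [rd_bind_val, ← he]
      unfold newLab
      split_ifs with hN
      · exact h1 ((hnew u).2 hN)
      · exact h2 (fun h3 => hN ((hnew u).1 h3))
    · have ht := forEach_time_le_const (f := fun j (lab : Fin n → ℕ) => do
        let x ← rd s.perm j
        wr lab x (i + 1)) 2 (List.range' i (e - i)) (fun _ _ _ => by simp) s.lab
      rw [List.length_range'] at ht
      have hcard : (Finset.Ico i e).image s.perm ∪
          (Finset.univ.filter fun u => newLab U K i s u = 0) ⊆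
            Finset.univ.filter fun u => s.lab u = 0 := by
        intro u hu
        rw [Finset.mem_union, Finset.mem_image] at hu
        rw [Finset.mem_filter]
        refine ⟨Finset.mem_univ _, ?_⟩
        rcases hu with ⟨j, hj, rfl⟩ | hu
        · rw [Finset.mem_Ico] at hj
          obtain ⟨h3, h4⟩ := hseg j hj.1 hj.2
          obtain ⟨h5, h6⟩ := h.perm_spec j h3
          rw [(h.agree _ h5 _ hvU (by omega) (by omega) h4).2.1]
          exact hcond.1
        · rw [Finset.mem_filter] at hu
          have := hu.2
          unfold newLab at this
          split_ifs at this
          exact this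
      have hdisj : Disjoint ((Finset.Ico i e).image s.perm)
          (Finset.univ.filter fun u => newLab U K i s u = 0) := by
        rw [Finset.disjoint_left]
        intro u hu hu'
        rw [Finset.mem_image] at hu
        obtain ⟨j, hj, rfl⟩ := hu
        rw [Finset.mem_Ico] at hj
        have h1 := (hnew (s.perm j)).1 ⟨j, hj.1, by omega, rfl⟩
        rw [Finset.mem_filter] at hu'
        have := hu'.2
        unfold newLab at this
        rw [if_pos h1] at this
        omega
      have h1 := Finset.card_le_card hcard
      rw [Finset.card_union_of_disjoint hdisj, Finset.card_image_of_injOn, Nat.card_Ico] at h1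
      · simp only [rd_bind_time, ← he]
        unfold unlabelled
        omega
      · intro a ha b hb hab
        simp only [Finset.coe_Ico, Set.mem_Ico] at ha hb
        have h1 := (h.perm_spec a (hseg a ha.1 ha.2).1).2
        have h2 := (h.perm_spec b (hseg b hb.1 hb.2).1).2
        rw [← h1, hab, h2]
  · rw [if_neg hcond]
    have : newLab U K i s = s.lab := by
      funext u
      unfold newLab
      rw [if_neg]
      rintro ⟨h1, h2, -⟩
      exact hcond ⟨h1, by simpa using h2⟩
    rw [this]
    exact ⟨rfl, by simp⟩

/-- The potential of the state at the beginning of round `i`. -/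
def searchPotential (adj : Fin n → List (Fin n)) (U : List (Fin n)) (i : ℕ) (s : Search n) : ℕ :=
  3 * unlabelled s.lab +
    ∑ u ∈ U.toFinset.filter (fun u => i ≤ s.pos u), (20 * (adj u).length + 10)

/-- Splitting the sets is paid for by the term of the visited vertex, which leaves the sum in the
potential; labelling is paid for by `unlabelled`. -/
theorem RoundInv.visit {adj : Fin n → List (Fin n)} (hadj : IsAdjList G adj)
    (hK : G.IsClique {v | v ∈ K}) (h : RoundInv G U K i s) (hi : i < U.length) :
    RoundInv G U K (i + 1)
      (visit adj (fun v => decide (v ∈ U)) (fun v => decide (v ∈ K)) i s).val ∧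
    (visit adj (fun v => decide (v ∈ U)) (fun v => decide (v ∈ K)) i s).time + 1 +
      searchPotential adj U (i + 1)
        (visit adj (fun v => decide (v ∈ U)) (fun v => decide (v ∈ K)) i s).val
      ≤ searchPotential adj U i s := by
  obtain ⟨hl1, hl2⟩ := h.label_step hi
  obtain ⟨hvU, hvi⟩ := h.perm_spec i hi
  set v := s.perm i with hv
  have hmid : MidRound U i (roundState U K i s) (adj v)
      (forEach (adj v) (roundState U K i s) fun w s => do
        let u ← rd (fun v => decide (v ∈ U)) w
        let q ← rd s.pos w
        if u = true ∧ i < q then refine i w s else pure s).val := by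
    refine forEach_inv (fun done s' => MidRound U i (roundState U K i s) done s') ?_
      (h.midRound_nil hi)
    intro done w rest s' hL hs'
    have hwd : w ∉ done := by
      have hnd := (hadj v).1
      rw [hL, List.nodup_append] at hnd
      exact fun hw => hnd.2.2 w hw w (by simp) rfl
    simp only [rd_bind_val, decide_eq_true_eq]
    by_cases hc : w ∈ U ∧ i < s'.pos w
    · rw [if_pos hc]
      exact hs'.refine hc.1 hc.2 hwd
    · rw [if_neg hc]
      have hne : ∀ u ∈ U, i < s'.pos u → u ≠ w := fun u hu hiu h' => hc ⟨h' ▸ hu, h' ▸ hiu⟩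
      have hiff : ∀ u ∈ U, i < s'.pos u → (u ∈ done ++ [w] ↔ u ∈ done) := fun u hu hiu => by
        simp [hne u hu hiu]
      refine { hs' with
        notMem := fun u hu hiu huM => hs'.notMem u hu hiu (fun h' => huM ((hiff u hu hiu).2 h'))
        isMem := fun u hu hiu huM => hs'.isMem u hu hiu ((hiff u hu hiu).1 huM)
        order := fun u hu u' hu' hiu hlt => ?_ }
      rw [hiff u hu hiu, hiff u' hu' (lt_trans hiu hlt)]
      exact hs'.order u hu u' hu' hiu hlt
  have hval : (CliquePicking.visit adj (fun v => decide (v ∈ U)) (fun v => decide (v ∈ K)) i s).val =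
      (forEach (adj v) (roundState U K i s) fun w s => do
        let u ← rd (fun v => decide (v ∈ U)) w
        let q ← rd s.pos w
        if u = true ∧ i < q then refine i w s else pure s).val := by
    simp only [CliquePicking.visit, rd_bind_val]
    rw [← hv]
    simp only [bind_val, wr_val, rd_val, hl1]
    rfl
  have hinv := h.succ hi hK (fun w => (hadj v).2 w) hmid
  rw [hval]
  refine ⟨hinv, ?_⟩
  -- Each neighbour costs 17 steps in `refine`, two reads and one for the loop. One of the ten units
  -- per vertex remains for the enclosing loop.
  have htime : (CliquePicking.visit adj (fun v => decide (v ∈ U)) (fun v => decide (v ∈ K)) i s).time ≤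
      20 * (adj v).length + 9 + 3 * unlabelled s.lab - 3 * unlabelled (newLab U K i s) := by
    have ht := fun t : Search n => forEach_time_le_const (f := fun w (s : Search n) => do
        let u ← rd (fun v => decide (v ∈ U)) w
        let q ← rd s.pos w
        if u = true ∧ i < q then refine i w s else pure s) 19 (adj v) (fun w _ s => by
          simp only [rd_bind_time]
          split_ifs
          · have := refine_time i w s
            omega
          · simp) t
    simp only [CliquePicking.visit, rd_bind_time]
    rw [← hv]
    simp only [bind_time, wr_time, wr_val, rd_time, rd_val]
    refine le_trans (Nat.add_le_add_left (Nat.add_le_add_left (Nat.add_le_add_left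
      (Nat.add_le_add_left (Nat.add_le_add_left (Nat.add_le_add_left
        (Nat.add_le_add_left (ht _) _) _) _) _) _) _) _) ?_
    omega
  have hstab := fun u hu => pos_stable (u := u) h.toLayout hinv.toLayout hmid.perm_eq hu
  have hsum : ∑ u ∈ U.toFinset.filter (fun u => i ≤ s.pos u), (20 * (adj u).length + 10) =
      20 * (adj v).length + 10 + ∑ u ∈ U.toFinset.filter (fun u => i + 1 ≤ s.pos u),
        (20 * (adj u).length + 10) := by
    rw [← Finset.sum_erase_add _ _ (a := v) (by simp [hvU, hvi]), add_comm]
    congr 2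
    ext u
    simp only [Finset.mem_erase, Finset.mem_filter, List.mem_toFinset]
    constructor
    · rintro ⟨h1, h2, h3⟩
      refine ⟨h2, ?_⟩
      have : s.pos u ≠ i := by
        intro h4
        apply h1
        rw [hv, ← h4, (h.pos_spec u h2).2]
      omega
    · rintro ⟨h1, h2⟩
      refine ⟨?_, h1, by omega⟩
      rintro rfl
      omega
  have hsum' : ∀ t : Search n, (∀ u ∈ U, i + 1 ≤ t.pos u ↔ i + 1 ≤ s.pos u) →
      ∑ u ∈ U.toFinset.filter (fun u => i + 1 ≤ t.pos u), (20 * (adj u).length + 10) =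
      ∑ u ∈ U.toFinset.filter (fun u => i + 1 ≤ s.pos u), (20 * (adj u).length + 10) := by
    intro t ht
    congr 1
    ext u
    simp only [Finset.mem_filter, List.mem_toFinset]
    constructor
    · exact fun h1 => ⟨h1.1, (ht u h1.1).1 h1.2⟩
    · exact fun h1 => ⟨h1.1, (ht u h1.1).2 h1.2⟩
  unfold searchPotential
  rw [hsum' _ (fun u hu => (hstab u hu).2 (i + 1) le_rfl), hsum, hmid.lab_eq]
  change _ + 1 + (3 * unlabelled (newLab U K i s) + _) ≤ _
  have : 3 * unlabelled (newLab U K i s) ≤ 3 * unlabelled s.lab + 2 := by omega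
  omega

end Visit

end CliquePicking

namespace CliquePicking

open SimpleGraph

/-! ### Initial state and total cost of a search. -/

section Init

variable {n : ℕ} {G : SimpleGraph (Fin n)} {U K : List (Fin n)}

/-- The state in which the vertices in `P` have been placed. -/
structure Placed (K P : List (Fin n)) (s : Search n) : Prop where
  perm_spec : ∀ j < P.length, s.perm j ∈ P ∧ s.pos (s.perm j) = j
  pos_spec : ∀ u ∈ P, s.pos u < P.length ∧ s.perm (s.pos u) = u ∧
    s.cls u = (if u ∈ K then 0 else 1) ∧ (u ∈ K ↔ s.pos u < K.length)
  start_eq : s.start = fun _ => 0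
  stamp_eq : s.stamp = fun _ => 0
  lab_eq : s.lab = fun _ => 0
  next_eq : s.next = 2

theorem Placed.place {P : List (Fin n)} {s : Search n} (h : Placed K P s) {v : Fin n}
    (hv : v ∉ P) {c : ℕ} (hc : c = if v ∈ K then 0 else 1)
    (hvK : v ∈ K ↔ P.length < K.length) : Placed K (P ++ [v]) (place v P.length c s).val := by
  simp only [CliquePicking.place, wr_bind_val, pure_val]
  refine ⟨fun j hj => ?_, fun u hu => ?_, h.start_eq, h.stamp_eq, h.lab_eq, h.next_eq⟩
  · dsimp only
    rw [List.length_append, List.length_singleton] at hj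
    by_cases hjP : j = P.length
    · subst hjP
      simp
    · obtain ⟨h1, h2⟩ := h.perm_spec j (by omega)
      rw [Function.update_of_ne hjP, Function.update_of_ne (ne_of_mem_of_not_mem h1 hv)]
      exact ⟨by simp [h1], h2⟩
  · dsimp only
    rw [List.length_append, List.length_singleton]
    by_cases huv : u = v
    · subst huv
      simp [hc, hvK]
    · have huP : u ∈ P := by simpa [huv] using hu
      obtain ⟨h1, h2, h3⟩ := h.pos_spec u huP
      rw [Function.update_of_ne huv, Function.update_of_ne huv, Function.update_of_ne (by omega)]
      exact ⟨by omega, h2, h3⟩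

theorem place_time (v : Fin n) (k c : ℕ) (s : Search n) : (place v k c s).time = 3 := by
  simp [place]

theorem length_append_filter (hU : U.Nodup) (hK : K.Nodup) (hKU : K ⊆ U) :
    (K ++ U.filter fun u => decide (u ∉ K)).length = U.length := by
  have hnd : (K ++ U.filter fun u => decide (u ∉ K)).Nodup := by
    rw [List.nodup_append]
    refine ⟨hK, hU.filter _, ?_⟩
    rintro a ha b hb rfl
    simp only [List.mem_filter, decide_eq_true_eq] at hb
    exact hb.2 ha
  apply List.Perm.length_eq
  rw [List.perm_ext_iff_of_nodup hnd hU]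
  intro a
  simp only [List.mem_append, List.mem_filter, decide_eq_true_eq]
  constructor
  · rintro (h | h)
    · exact hKU h
    · exact h.1
  · intro h
    by_cases haK : a ∈ K
    · exact Or.inl haK
    · exact Or.inr ⟨h, haK⟩

theorem length_le_of_nodup (hU : U.Nodup) : U.length ≤ n := by
  simpa using hU.length_le_card

variable [NeZero n]

theorem roundInv_initSearch (G : SimpleGraph (Fin n)) (D : ℕ) (hU : U.Nodup) (hK : K.Nodup)
    (hKU : K ⊆ U) :
    RoundInv G U K 0 (initSearch D U K fun v => decide (v ∈ K)).val := by
  have hplace0 : ∀ s : Search n, Placed K [] s →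
      ((forEach K (s, 0) fun v t => do
        let s ← place v t.2 0 t.1
        pure (s, t.2 + 1)).val.2 = K.length ∧
      Placed K K (forEach K (s, 0) fun v t => do
        let s ← place v t.2 0 t.1
        pure (s, t.2 + 1)).val.1) := by
    intro s hs
    refine forEach_inv (f := fun v (t : Search n × ℕ) => do
        let s ← place v t.2 0 t.1
        pure (s, t.2 + 1)) (fun done t => t.2 = done.length ∧ Placed K done t.1) ?_ ⟨rfl, hs⟩
    rintro done v rest t hL ⟨h1, h2⟩
    simp only [bind_val, pure_val, h1, List.length_append, List.length_singleton, true_and]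
    have hnd := hK
    rw [hL, List.nodup_append] at hnd
    have hvK : v ∈ K := by rw [hL]; simp
    refine h2.place (fun hv => hnd.2.2 v hv v (by simp) rfl) (by simp [hvK]) ?_
    simp only [hvK, true_iff]
    rw [hL]
    simp
  have hplace1 : ∀ t : Search n × ℕ, t.2 = K.length → Placed K K t.1 →
      ((forEach U t fun v t => do
        let m ← rd (fun v => decide (v ∈ K)) v
        if m then pure t else do
          let s ← place v t.2 1 t.1
          pure (s, t.2 + 1)).val.2 = (K ++ U.filter fun u => decide (u ∉ K)).length ∧
      Placed K (K ++ U.filter fun u => decide (u ∉ K)) (forEach U t fun v t => do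
        let m ← rd (fun v => decide (v ∈ K)) v
        if m then pure t else do
          let s ← place v t.2 1 t.1
          pure (s, t.2 + 1)).val.1) := by
    intro t ht1 ht2
    refine forEach_inv (f := fun v (t : Search n × ℕ) => do
        let m ← rd (fun v => decide (v ∈ K)) v
        if m then pure t else do
          let s ← place v t.2 1 t.1
          pure (s, t.2 + 1)) (fun done t => t.2 = (K ++ done.filter fun u => decide (u ∉ K)).length ∧
            Placed K (K ++ done.filter fun u => decide (u ∉ K)) t.1) ?_ ?_
    · rintro done v rest t hL ⟨h1, h2⟩
      simp only [rd_bind_val, decide_eq_true_eq]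
      by_cases hvK : v ∈ K
      · rw [if_pos hvK]
        have hfil : (done ++ [v]).filter (fun u => decide (u ∉ K)) =
            done.filter fun u => decide (u ∉ K) := by
          simp [List.filter_append, hvK]
        rw [hfil]
        exact ⟨h1, h2⟩
      · rw [if_neg hvK]
        have hnd := hU
        rw [hL, List.nodup_append] at hnd
        have hfil : K ++ (done ++ [v]).filter (fun u => decide (u ∉ K)) =
            (K ++ done.filter fun u => decide (u ∉ K)) ++ [v] := by
          simp [List.filter_append, hvK]
        simp only [bind_val, pure_val, hfil, h1]
        refine ⟨by rw [List.length_append (bs := [v])]; rfl, h2.place ?_ (by simp [hvK]) ?_⟩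
        · simp only [List.mem_append, List.mem_filter, not_or, hvK, not_false_eq_true, true_and]
          exact fun hv => hnd.2.2 v hv.1 v (by simp) rfl
        · simp [hvK]
    · simpa using ⟨ht1, ht2⟩
  have hmem : ∀ u, u ∈ (K ++ U.filter fun u => decide (u ∉ K)) ↔ u ∈ U := by
    intro a
    simp only [List.mem_append, List.mem_filter, decide_eq_true_eq]
    constructor
    · rintro (h | h)
      · exact hKU h
      · exact h.1
    · intro h
      by_cases haK : a ∈ K
      · exact Or.inl haK
      · exact Or.inr ⟨h, haK⟩
  have hlen := length_append_filter hU hK hKU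
  set s₀ : Search n := ⟨fun _ => 0, fun _ => 0, fun _ => 0, fun _ => 0, fun _ => 0, fun _ => 0,
    fun _ => 0, 2, fun _ => 0⟩ with hs₀
  obtain ⟨ha1, ha2⟩ := hplace0 s₀ ⟨by simp, by simp, rfl, rfl, rfl, rfl⟩
  simp only [initSearch, newArr_bind_val]
  rw [← hs₀, bind_val]
  generalize hA : (forEach K (s₀, 0) fun v t => do
        let s ← place v t.2 0 t.1
        pure (s, t.2 + 1)).val = A at ha1 ha2 ⊢
  obtain ⟨hb1, hb2⟩ := hplace1 A ha1 ha2
  rw [bind_val]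
  generalize hB : (forEach U A fun v t => do
        let m ← rd (fun v => decide (v ∈ K)) v
        if m then pure t else do
          let s ← place v t.2 1 t.1
          pure (s, t.2 + 1)).val = B at hb1 hb2 ⊢
  simp only [wr_bind_val, pure_val]
  rw [hlen] at hb1
  have hperm := hb2.perm_spec
  have hpos := hb2.pos_spec
  rw [hlen] at hperm hpos
  simp only [hmem] at hperm hpos
  have hstart0 : Function.update B.1.start 1 A.2 0 = 0 := by
    rw [Function.update_of_ne (by omega), hb2.start_eq]
  have hfin0 : Function.update (Function.update B.1.finish 0 A.2) 1 B.2 0 = K.length := by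
    rw [Function.update_of_ne (by omega), Function.update_self, ha1]
  have hstart1 : Function.update B.1.start 1 A.2 1 = K.length := by
    rw [Function.update_self, ha1]
  have hfin1 : Function.update (Function.update B.1.finish 0 A.2) 1 B.2 1 = U.length := by
    rw [Function.update_self, hb1]
  have hKlen : K.length ≤ U.length := by
    rw [← hlen, List.length_append]
    omega
  have hclsK : ∀ u ∈ U, B.1.cls u = 0 ↔ u ∈ K := by
    intro u hu
    rw [(hpos u hu).2.2.1]
    split_ifs with h <;> simp [h]
  have hcls01 : ∀ u ∈ U, B.1.cls u = 0 ∨ B.1.cls u = 1 := by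
    intro u hu
    rw [(hpos u hu).2.2.1]
    split_ifs <;> simp
  refine ⟨⟨hperm, fun u hu => ⟨(hpos u hu).1, (hpos u hu).2.1⟩, ?_, ?_⟩, ?_, ?_, ?_, ?_, ?_, ?_, ?_,
    ?_, ?_⟩
  · intro u hu _
    obtain ⟨h1, -, h2, h3⟩ := hpos u hu
    dsimp only
    rw [h2, hb2.next_eq]
    split_ifs with huK
    · rw [hstart0, hfin0]
      exact ⟨by omega, by omega, h3.1 huK⟩
    · rw [hstart1, hfin1]
      rw [h3] at huK
      omega
  · intro c hc j h1 h2
    dsimp only at hc h1 h2 ⊢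
    rw [hb2.next_eq] at hc
    obtain rfl | rfl : c = 0 ∨ c = 1 := by omega
    · rw [hfin0] at h2
      obtain ⟨h3, h4⟩ := hperm j (by omega)
      refine ⟨by omega, by omega, ?_⟩
      rw [hclsK _ h3, (hpos _ h3).2.2.2, h4]
      exact h2
    · rw [hstart1] at h1
      rw [hfin1] at h2
      obtain ⟨h3, h4⟩ := hperm j h2
      refine ⟨by omega, h2, (hcls01 _ h3).resolve_left ?_⟩
      rw [hclsK _ h3, (hpos _ h3).2.2.2, h4]
      omega
  · simp [hb2.stamp_eq]
  · intro u hu u' hu' _ _ hc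
    refine ⟨fun j hj => absurd hj (by omega), by simp [hb2.lab_eq], ?_⟩
    dsimp only at hc
    rw [← hclsK u hu, ← hclsK u' hu', hc]
  · intro u hu u' hu' _ hlt hc
    dsimp only at hlt hc
    left
    have h1 := (hpos u hu).2.2.2
    have h2 := (hpos u' hu').2.2.2
    have h3 : ¬ (u ∈ K ↔ u' ∈ K) := by
      rw [← hclsK u hu, ← hclsK u' hu']
      have := hcls01 u hu
      have := hcls01 u' hu'
      omega
    rw [h1, h2] at h3 ⊢
    omega
  · intro u hu u' hu' huK huK'
    dsimp only
    rw [(hpos u hu).2.2.2] at huK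
    rw [(hpos u' hu').2.2.2] at huK'
    omega
  · intro b hb
    omega
  · intro u hu
    simp [hb2.lab_eq] at hu
  · intro u _ hu
    omega
  · intro u j hu
    simp [hb2.lab_eq] at hu
  · intro u j hu
    simp [hb2.lab_eq] at hu

theorem initSearch_time (D : ℕ) (U K : List (Fin n)) (inK : Fin n → Bool) :
    (initSearch D U K inK).time ≤ 4 * n + 4 * D + 4 * K.length + 5 * U.length + 21 := by
  have h1 := fun t => forEach_time_le_const (f := fun v (t : Search n × ℕ) => do
        let s ← place v t.2 0 t.1
        pure (s, t.2 + 1)) 3 K (fun _ _ _ => by simp [bind_time, place_time]) t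
  have h2 := fun t => forEach_time_le_const (f := fun v (t : Search n × ℕ) => do
        let m ← rd inK v
        if m then pure t else do
          let s ← place v t.2 1 t.1
          pure (s, t.2 + 1)) 4 U (fun b _ t => by
            simp only [rd_bind_time]
            split_ifs <;> simp [bind_time, place_time]) t
  simp only [initSearch, newArr_bind_time]
  rw [bind_time, bind_time]
  simp only [wr_bind_time, pure_time]
  have h3 := h1 (⟨fun _ => 0, fun _ => 0, fun _ => 0, fun _ => 0, fun _ => 0, fun _ => 0,
    fun _ => 0, 2, fun _ => 0⟩, 0)
  refine le_trans (Nat.add_le_add_left (Nat.add_le_add_left (Nat.add_le_add_left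
    (Nat.add_le_add_left (Nat.add_le_add_left (Nat.add_le_add_left (Nat.add_le_add_left
    (Nat.add_le_add_left (Nat.add_le_add h3
      (Nat.add_le_add_right (h2 _) _)) _) _) _) _) _) _) _) _) ?_
  omega

/-- The initial potential is at most `13 n + 20 D`: 3 + 10 units for each vertex and 20 for each
entry of an adjacency list. The rest is the linear cost of the initialisation. -/
theorem lbfs_spec {adj : Fin n → List (Fin n)} (hadj : IsAdjList G adj) {D : ℕ}
    (hD : D = ∑ v, (adj v).length) (hU : U.Nodup) (hKn : K.Nodup) (hKU : K ⊆ U)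
    (hK : G.IsClique {v | v ∈ K}) :
    RoundInv G U K U.length
      (lbfs adj D U K (fun v => decide (v ∈ U)) (fun v => decide (v ∈ K))).val ∧
    (lbfs adj D U K (fun v => decide (v ∈ U)) (fun v => decide (v ∈ K))).time
      ≤ 60 * (n + D) := by
  have h0 := roundInv_initSearch G D hU hKn hKU
  have h1 := initSearch_time D U K fun v => decide (v ∈ K)
  obtain ⟨h2, h3⟩ := forEach_range_spec
    (f := fun i s => visit adj (fun v => decide (v ∈ U)) (fun v => decide (v ∈ K)) i s)
    (RoundInv G U K) (searchPotential adj U) U.length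
    (fun i s hi hs => hs.visit hadj hK hi) h0
  have h4 := len_time U
  have h5 := length_le_of_nodup hU
  have h6 := length_le_of_nodup hKn
  have h7 : searchPotential adj U 0 (initSearch D U K fun v => decide (v ∈ K)).val
      ≤ 13 * n + 20 * D := by
    unfold searchPotential
    have e1 : unlabelled (initSearch D U K fun v => decide (v ∈ K)).val.lab ≤ n := by
      refine (Finset.card_filter_le _ _).trans ?_
      simp
    have e2 := Finset.sum_le_univ_sum_of_nonneg (f := fun u => 20 * (adj u).length + 10)
      (s := U.toFinset.filter fun u => 0 ≤ (initSearch D U K fun v => decide (v ∈ K)).val.pos u)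
      (fun _ => Nat.zero_le _)
    have e3 : ∑ u, (20 * (adj u).length + 10) = 20 * D + 10 * n := by
      rw [Finset.sum_add_distrib, ← Finset.mul_sum, hD]
      simp [mul_comm]
    omega
  have hn : 0 < n := NeZero.pos n
  simp only [lbfs]
  rw [bind_val, bind_time, bind_val, bind_time, len_val]
  exact ⟨h2, by omega⟩

end Init

/-! ### Elimination ordering and separators obtained from the search. -/

section Consequences

variable {n : ℕ} {G : SimpleGraph (Fin n)} {U K : List (Fin n)} {s : Search n}

theorem Layout.injOn {i : ℕ} (h : Layout U i s) : Set.InjOn s.pos {u | u ∈ U} := by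
  intro a ha b hb hab
  rw [← (h.pos_spec a ha).2, hab, (h.pos_spec b hb).2]

/-- The order of the visits is a perfect elimination ordering. -/
theorem RoundInv.isPEO (hG : G.IsChordalGraph) (h : RoundInv G U K U.length s) :
    IsPEO G {u | u ∈ U} s.pos := by
  refine IsMaxNbrOrder.isPEO hG h.injOn ?_
  intro a ha b hb c hc hab hbc hac hnab
  have ea := (h.pos_spec a ha).2
  have eb := (h.pos_spec b hb).2
  obtain ⟨d, hd, h1, h2⟩ := h.maxNbr (s.pos b) (h.pos_spec b hb).1 c hc hbc (s.pos a) hab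
    (by rwa [ea]) (by rwa [ea, eb])
  have hdl : d < U.length := hd.trans (h.pos_spec b hb).1
  rw [eb] at h1
  exact ⟨s.perm d, (h.perm_spec d hdl).1, by rw [(h.perm_spec d hdl).2]; exact hd, h1, h2⟩

/-- The sets in `L` are unions of connected components of the common neighbourhood in `U` of
a clique, and do not exhaust it. -/
theorem RoundInv.exists_separator (hG : G.IsChordalGraph) (h : RoundInv G U K U.length s)
    (hK : G.IsClique {v | v ∈ K}) (hKU : K ⊆ U)
    (hmax : ∀ v ∈ U, v ∉ K → ∃ y ∈ K, ¬ G.Adj y v) {u : Fin n} (hu : s.lab u ≠ 0) :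
    ∃ S : Set (Fin n), G.IsClique S ∧ (∀ x ∈ S, x ∈ U) ∧
      (∀ w, s.lab w = s.lab u → w ∈ commonNbrs G S) ∧
      (∀ w ∈ U, w ∈ commonNbrs G S → ∀ x, s.lab x = s.lab u → G.Adj x w → s.lab w = s.lab u) ∧
      ∃ y ∈ U, y ∈ commonNbrs G S ∧ s.lab y ≠ s.lab u := by
  have hP := h.isPEO hG
  obtain ⟨j, hj⟩ : ∃ j, s.lab u = j + 1 := ⟨s.lab u - 1, by omega⟩
  obtain ⟨hjm, -, hv⟩ := h.lab_le u j hj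
  obtain ⟨hvU, hvj⟩ := h.perm_spec j hjm
  set v := s.perm j with hvdef
  have hvK : v ∉ K := (h.lab_mem v (by omega)).2
  rw [hj]
  have hperm : ∀ a ∈ U, s.perm (s.pos a) = a := fun a ha => (h.pos_spec a ha).2
  -- The members of one set in `L` have the same neighbours among the vertices visited before the
  -- round in which the set was added.
  have hsame : ∀ w, s.lab w = j + 1 → ∀ a ∈ U, s.pos a < j → (G.Adj a w ↔ G.Adj a v) := by
    intro w hw a ha haj
    have hwU := (h.lab_mem w (by omega)).1
    have h1 := (h.lab_iff v j hv w hwU (h.lab_le w j hw).2.1).2 hw (s.pos a) haj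
    have h2 := (h.lab_iff w j hw v hvU hvj.ge).2 hv (s.pos a) haj
    rw [hperm a ha] at h1 h2
    exact ⟨h2, h1⟩
  -- The separator consists of the neighbours visited before `v`, the first visited vertex of its
  -- set.
  refine ⟨{a | a ∈ U ∧ s.pos a < j ∧ G.Adj a v}, ?_, fun x hx => hx.1, ?_, ?_, ?_⟩
  · rintro a ⟨ha, haj, hav⟩ b ⟨hb, hbj, hbv⟩ hab
    exact hP v hvU a ha b hb (by omega) (by omega) hav hbv hab
  · rintro w hw a ⟨ha, haj, hav⟩
    exact (hsame w hw a ha haj).2 hav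
  · intro w hwU hwS x hx hxw
    rcases Nat.lt_or_ge (s.pos w) j with hwj | hwj
    · exact absurd (hwS w ⟨hwU, hwj, (hsame x hx w hwU hwj).1 hxw.symm⟩) (G.loopless.irrefl w)
    · refine (h.lab_iff v j hv w hwU hwj).1 fun a haj hav => ?_
      have ham : a < U.length := by omega
      exact hwS _ ⟨(h.perm_spec a ham).1, by rw [(h.perm_spec a ham).2]; exact haj, hav⟩
  -- It remains to find a common neighbour of the separator with another label. If the separator is
  -- contained in `K`, maximality of `K` provides one in `K`.
  · by_cases hSK : ∀ a ∈ U, s.pos a < j → G.Adj a v → a ∈ K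
    · obtain ⟨y, hyK, hyv⟩ := hmax v hvU hvK
      refine ⟨y, hKU hyK, ?_, ?_⟩
      · rintro a ⟨ha, haj, hav⟩
        exact hK (hSK a ha haj hav) hyK (fun h' => hyv (h' ▸ hav))
      · intro hy
        exact (h.lab_mem y (by omega)).2 hyK
    · push Not at hSK
      obtain ⟨a₀, ha₀⟩ := hSK
      -- Otherwise the last vertex `t` of the separator is outside `K`, because `K` is visited
      -- first; so `t` lies in an earlier set in `L`.
      obtain ⟨t, ⟨htU, htj, htv⟩, htmax⟩ := Set.exists_max_image
        {a | a ∈ U ∧ s.pos a < j ∧ G.Adj a v} s.pos (Set.toFinite _) ⟨a₀, ha₀.1, ha₀.2.1, ha₀.2.2.1⟩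
      have htK : t ∉ K := by
        intro htK
        have h1 := h.first a₀ ha₀.1 t htU ha₀.2.2.2 htK
        have h2 := htmax a₀ ⟨ha₀.1, ha₀.2.1, ha₀.2.2.1⟩
        omega
      have htl := h.lab_visited t htU (h.pos_spec t htU).1 htK
      obtain ⟨k, hk⟩ : ∃ k, s.lab t = k + 1 := ⟨s.lab t - 1, by omega⟩
      obtain ⟨-, hkt, -⟩ := h.lab_le t k hk
      -- Since `v` is not in the set of `t`, some `b` visited before round `k` is adjacent to `t`
      -- but not to `v`. Both `b` and the rest of the separator consist of preceding neighbours of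
      -- `t`, so the elimination property makes `b` adjacent to all of the separator.
      have hnot := (h.lab_iff t k hk v hvU (by omega)).not.2 (by omega)
      push Not at hnot
      obtain ⟨b, hbk, hbt, hbv⟩ := hnot
      have hbm : b < U.length := by omega
      obtain ⟨hbU, hbpos⟩ := h.perm_spec b hbm
      refine ⟨s.perm b, hbU, ?_, ?_⟩
      · rintro a ⟨ha, haj, hav⟩
        by_cases hat : a = t
        · rw [hat]
          exact hbt.symm
        · have h1 := htmax a ⟨ha, haj, hav⟩
          have h2 : s.pos a ≠ s.pos t := fun h' => hat (h.injOn ha htU h')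
          have hadj := hP v hvU a ha t htU (by omega) (by omega) hav htv hat
          refine hP t htU a ha (s.perm b) hbU (by omega) (by omega) hadj hbt ?_
          rintro rfl
          exact hbv hav
      · intro hb
        have := (h.lab_le _ j hb).2.1
        omega

end Consequences

end CliquePicking

namespace CliquePicking

open SimpleGraph

/-! ### Connected components -/

section Components

variable {n : ℕ} {G : SimpleGraph (Fin n)} {lab : Fin n → ℕ}

/-- The total weight of the vertices that have not been assigned to a component. -/
def freeWeight (c : Fin n → ℕ) (comp : Fin n → ℕ) : ℕ :=
  ∑ u ∈ Finset.univ.filter (fun u => comp u = 0), c u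

theorem freeWeight_update (c : Fin n → ℕ) {comp : Fin n → ℕ} {w : Fin n} (hw : comp w = 0)
    {k : ℕ} (hk : k ≠ 0) :
    c w + freeWeight c (Function.update comp w k) = freeWeight c comp := by
  unfold freeWeight
  rw [← Finset.add_sum_erase (Finset.univ.filter fun u => comp u = 0) c (a := w) (by simp [hw])]
  congr 2
  ext u
  by_cases hu : u = w
  · subst hu
    simp [hk]
  · simp [hu]

/-- Weight of the stack and of the vertices that have not been reached. -/
def stackWeight (c : Fin n → ℕ) (r : List (Fin n) × (Fin n → ℕ)) : ℕ :=
  (r.1.map c).sum + freeWeight c r.2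

/-- The state of the traversal of the component number `k`, which contains `v`; the neighbours of the
vertices in `E` may be missing. -/
structure TraversalInv (G : SimpleGraph (Fin n)) (lab comp : Fin n → ℕ) (k : ℕ) (v : Fin n)
    (E : Set (Fin n)) (r : List (Fin n) × (Fin n → ℕ)) : Prop where
  old : ∀ u, r.2 u = comp u ∨ (comp u = 0 ∧ r.2 u = k)
  lab_eq : ∀ u, r.2 u = k → lab u = lab v
  root : r.2 v = k
  stack : ∀ u ∈ r.1, r.2 u = k
  frontier : ∀ u, r.2 u = k → u ∉ r.1 → u ∉ E → ∀ w, G.Adj u w → lab w = lab v → r.2 w = k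
  reach : ∀ T : Set (Fin n), v ∈ T → (∀ u ∈ T, ∀ w, r.2 w = k → G.Adj u w → w ∈ T) →
    ∀ u, r.2 u = k → u ∈ T

/-- Components have been assigned to some of the vertices. -/
structure CompInv (G : SimpleGraph (Fin n)) (lab comp : Fin n → ℕ) (k : ℕ) : Prop where
  le : ∀ u, comp u ≤ k
  lab_ne : ∀ u, comp u ≠ 0 → lab u ≠ 0
  lab_eq : ∀ u w, comp u ≠ 0 → comp u = comp w → lab u = lab w
  closed : ∀ u w, G.Adj u w → lab u = lab w → comp u ≠ 0 → comp w = comp u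
  nonempty : ∀ c, 1 ≤ c → c ≤ k → ∃ u, comp u = c
  conn : ∀ c, c ≠ 0 → CutConnected G {u | comp u = c}

variable {comp : Fin n → ℕ} {k : ℕ} {v : Fin n}

/-- The set `E` exempts `x` from `frontier` while its list is being scanned. A push moves the weight
of a vertex from the unreached vertices to the stack, so `stackWeight` is constant for every choice
of weights. -/
theorem TraversalInv.neighbours (hk : CompInv G lab comp k) {E : Set (Fin n)} {x : Fin n}
    {stack : List (Fin n)} {comp' : Fin n → ℕ} {N : List (Fin n)}
    (h : TraversalInv G lab comp (k + 1) v E (stack, comp')) (hx : comp' x = k + 1) (hxE : x ∈ E)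
    (hN : ∀ w, w ∈ N ↔ G.Adj x w) :
    TraversalInv G lab comp (k + 1) v (E \ {x})
      (forEach N (stack, comp') fun w r => do
        let l' ← rd lab w
        let c' ← rd r.2 w
        if l' = lab v ∧ c' = 0 then do
          let comp ← wr r.2 w (k + 1)
          let stack ← op (w :: r.1)
          pure (stack, comp)
        else pure r).val ∧
    (forEach N (stack, comp') fun w r => do
        let l' ← rd lab w
        let c' ← rd r.2 w
        if l' = lab v ∧ c' = 0 then do
          let comp ← wr r.2 w (k + 1)
          let stack ← op (w :: r.1)
          pure (stack, comp)
        else pure r).time ≤ 5 * N.length + 1 ∧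
    ∀ c, stackWeight c (forEach N (stack, comp') fun w r => do
        let l' ← rd lab w
        let c' ← rd r.2 w
        if l' = lab v ∧ c' = 0 then do
          let comp ← wr r.2 w (k + 1)
          let stack ← op (w :: r.1)
          pure (stack, comp)
        else pure r).val = stackWeight c (stack, comp') := by
  have hinv := forEach_inv (L := N) (f := fun w (r : List (Fin n) × (Fin n → ℕ)) => do
        let l' ← rd lab w
        let c' ← rd r.2 w
        if l' = lab v ∧ c' = 0 then do
          let comp ← wr r.2 w (k + 1)
          let stack ← op (w :: r.1)
          pure (stack, comp)
        else pure r) (fun done r => TraversalInv G lab comp (k + 1) v E r ∧ r.2 x = k + 1 ∧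
          (∀ w ∈ done, lab w = lab v → r.2 w = k + 1) ∧
          ∀ c, stackWeight c r = stackWeight c (stack, comp')) ?_ (s := (stack, comp'))
          ⟨h, hx, by simp, fun _ => rfl⟩
  · obtain ⟨h1, h2, h3, h4⟩ := hinv
    refine ⟨{ h1 with frontier := ?_ }, ?_, h4⟩
    · intro u hu hus huE w huw hw
      by_cases hux : u = x
      · subst hux
        exact h3 w ((hN w).2 huw) hw
      · exact h1.frontier u hu hus (fun h' => huE ⟨h', hux⟩) w huw hw
    · refine forEach_time_le_const 4 N (fun w _ r => ?_) _
      simp only [rd_bind_time]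
      split_ifs <;> simp
  · rintro done w rest ⟨stk, cmp⟩ hL ⟨h1, h2, h3, h4⟩
    have hxw : G.Adj x w := (hN w).1 (by rw [hL]; simp)
    simp only [rd_bind_val]
    by_cases hc : lab w = lab v ∧ cmp w = 0
    · rw [if_pos hc]
      simp only [wr_bind_val, op_bind_val, pure_val]
      have hsub : ∀ u, cmp u = k + 1 → Function.update cmp w (k + 1) u = k + 1 := by
        intro u hu
        by_cases huw : u = w
        · rw [huw, Function.update_self]
        · rw [Function.update_of_ne huw]
          exact hu
      have hcase : ∀ u, Function.update cmp w (k + 1) u = k + 1 → u = w ∨ cmp u = k + 1 := by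
        intro u hu
        by_cases huw : u = w
        · exact Or.inl huw
        · rw [Function.update_of_ne huw] at hu
          exact Or.inr hu
      refine ⟨⟨?_, ?_, hsub _ h1.root, ?_, ?_, ?_⟩, hsub _ h2, ?_, ?_⟩
      · intro u
        by_cases huw : u = w
        · subst huw
          right
          refine ⟨?_, by simp⟩
          rcases h1.old u with h5 | h5
          · exact h5.symm.trans hc.2
          · exact h5.1
        · simpa [Function.update_of_ne huw] using h1.old u
      · intro u hu
        rcases hcase u hu with rfl | hu
        · exact hc.1
        · exact h1.lab_eq u hu
      · intro u hu
        rcases List.mem_cons.1 hu with rfl | hu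
        · simp
        · exact hsub u (h1.stack u hu)
      · intro u hu hus huE y huy hy
        rcases hcase u hu with rfl | hu
        · simp at hus
        · exact hsub y (h1.frontier u hu (fun h' => hus (by simp [h'])) huE y huy hy)
      · intro T hvT hT
        have hold := h1.reach T hvT (fun u hu y hy huy => hT u hu y (hsub y hy) huy)
        intro u hu
        rcases hcase u hu with rfl | hu
        · exact hT x (hold x h2) u hu hxw
        · exact hold u hu
      · intro y hy hyl
        simp only [List.mem_append, List.mem_singleton] at hy
        rcases hy with hy | rfl
        · exact hsub y (h3 y hy hyl)
        · simp
      · intro c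
        rw [← h4 c]
        unfold stackWeight
        have := freeWeight_update c hc.2 (k := k + 1) (by omega)
        simp only [List.map_cons, List.sum_cons]
        omega
    · rw [if_neg hc]
      simp only [pure_val]
      refine ⟨h1, h2, ?_, h4⟩
      intro y hy hyl
      simp only [List.mem_append, List.mem_singleton] at hy
      rcases hy with hy | rfl
      · exact h3 y hy hyl
      -- A neighbour with the right label that is already assigned belongs to the current component:
      -- an older component is closed and would contain `x`.
      · have hne : cmp y ≠ 0 := fun h' => hc ⟨hyl, h'⟩
        rcases h1.old y with h5 | h5
        · exfalso
          simp only at h5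
          rw [h5] at hne
          have h6 := hk.closed y x hxw.symm (hyl.trans (h1.lab_eq x h2).symm) hne
          have h7 := hk.le y
          rcases h1.old x with h8 | h8
          · simp only at h8 h2
            omega
          · omega
        · exact h5.2

/-- The weights that bound the time of the traversal. -/
def traversalCost (adj : Fin n → List (Fin n)) (u : Fin n) : ℕ := 5 * (adj u).length + 3

/-- Two weights are used for `stackWeight`: `traversalCost` bounds the time, and the weight 1 proves
termination. Termination matters because `frontier` yields closedness only when the stack is empty.
-/
theorem CompInv.traverse {adj : Fin n → List (Fin n)} (hadj : IsAdjList G adj)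
    (hk : CompInv G lab comp k) (hl : lab v ≠ 0) (hv : comp v = 0) :
    let r := whileDo n (fun r : List (Fin n) × (Fin n → ℕ) => !r.1.isEmpty)
        (fun r => match r.1 with
          | [] => pure r
          | x :: stack => do
            let N ← rd adj x
            forEach N (stack, r.2) fun w r => do
              let l' ← rd lab w
              let c' ← rd r.2 w
              if l' = lab v ∧ c' = 0 then do
                let comp ← wr r.2 w (k + 1)
                let stack ← op (w :: r.1)
                pure (stack, comp)
              else pure r)
        ([v], Function.update comp v (k + 1))
    CompInv G lab r.val.2 (k + 1) ∧
      r.time + freeWeight (traversalCost adj) r.val.2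
        ≤ freeWeight (traversalCost adj) comp + 1 := by
  intro r
  have hbody : ∀ s : List (Fin n) × (Fin n → ℕ), (!s.1.isEmpty) = true →
      TraversalInv G lab comp (k + 1) v ∅ s → ∀ b : Timed (List (Fin n) × (Fin n → ℕ)),
      b = (match s.1 with
          | [] => pure s
          | x :: stack => do
            let N ← rd adj x
            forEach N (stack, s.2) fun w r => do
              let l' ← rd lab w
              let c' ← rd r.2 w
              if l' = lab v ∧ c' = 0 then do
                let comp ← wr r.2 w (k + 1)
                let stack ← op (w :: r.1)
                pure (stack, comp)
              else pure r) →
      TraversalInv G lab comp (k + 1) v ∅ b.val ∧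
        b.time + 1 + stackWeight (traversalCost adj) b.val ≤ stackWeight (traversalCost adj) s ∧
        stackWeight (fun _ => 1) b.val < stackWeight (fun _ => 1) s := by
    rintro ⟨stk, cmp⟩ hs h b rfl
    cases stk with
    | nil => simp at hs
    | cons x stack =>
      have hx : cmp x = k + 1 := h.stack x (by simp)
      have h' : TraversalInv G lab comp (k + 1) v {x} (stack, cmp) := by
        refine { h with
          stack := fun u hu => h.stack u (by simp [hu])
          frontier := fun u hu hus huE => h.frontier u hu ?_ (by simp) }
        intro h1
        rcases List.mem_cons.1 h1 with rfl | h1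
        · exact huE rfl
        · exact hus h1
      obtain ⟨h1, h2, h3⟩ := h'.neighbours hk hx rfl (fun w => (hadj x).2 w)
      simp only [rd_bind_val, rd_bind_time]
      have hE : ({x} \ {x} : Set (Fin n)) = ∅ := by simp
      rw [hE] at h1
      refine ⟨h1, ?_, ?_⟩
      · rw [h3]
        simp only [stackWeight, List.map_cons, List.sum_cons, traversalCost]
        omega
      · rw [h3]
        simp only [stackWeight, List.map_cons, List.sum_cons]
        omega
  have hinit : TraversalInv G lab comp (k + 1) v ∅ ([v], Function.update comp v (k + 1)) := by
    have hcase : ∀ u, Function.update comp v (k + 1) u = k + 1 → u = v := by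
      intro u hu
      by_contra huv
      rw [Function.update_of_ne huv] at hu
      have := hk.le u
      omega
    refine ⟨?_, ?_, by simp, by simp, ?_, ?_⟩
    · intro u
      by_cases huv : u = v
      · subst huv
        simp [hv]
      · simp [huv]
    · intro u hu
      rw [hcase u hu]
    · intro u hu hus
      exact absurd (by simp [hcase u hu]) hus
    · intro T hvT _ u hu
      rw [hcase u hu]
      exact hvT
  have hspec := whileDo_spec (TraversalInv G lab comp (k + 1) v ∅)
    (stackWeight (traversalCost adj))
    (fun s hs h => ⟨(hbody s hs h _ rfl).1, (hbody s hs h _ rfl).2.1⟩) n hinit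
  have hfw : ∀ c, stackWeight c ([v], Function.update comp v (k + 1)) = freeWeight c comp := by
    intro c
    have := freeWeight_update c hv (k := k + 1) (by omega)
    simpa [stackWeight] using this
  -- With weight 1 the measure counts the vertices on the stack or not yet reached; it is at most
  -- `n` and each round pops one.
  have hempty := whileDo_cond_false (TraversalInv G lab comp (k + 1) v ∅)
    (stackWeight fun _ => 1) (fun s hs h => ⟨(hbody s hs h _ rfl).1, (hbody s hs h _ rfl).2.2⟩) n
    hinit (by
      rw [hfw]
      unfold freeWeight
      rw [Finset.sum_const, smul_eq_mul, mul_one]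
      exact (Finset.card_filter_le _ _).trans (by simp))
  obtain ⟨h1, h2⟩ := hspec
  change TraversalInv G lab comp (k + 1) v ∅ r.val at h1
  change r.time + stackWeight (traversalCost adj) r.val ≤ _ at h2
  change (!r.val.1.isEmpty) = false at hempty
  rw [hfw] at h2
  have hnil : r.val.1 = [] := by simpa using hempty
  have hfr := h1.frontier
  rw [hnil] at hfr
  constructor
  · have hold : ∀ u, r.val.2 u ≠ k + 1 → r.val.2 u = comp u := fun u hu =>
      (h1.old u).resolve_right (fun h' => hu h'.2)
    have hnew : ∀ u, r.val.2 u = k + 1 → comp u = 0 := by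
      intro u hu
      rcases h1.old u with h5 | h5
      · have := hk.le u
        omega
      · exact h5.1
    have hconn : CutConnected G {u | r.val.2 u = k + 1} := by
      have key : ∀ T ⊆ {u | r.val.2 u = k + 1}, v ∈ T →
          (∀ u ∈ T, ∀ w ∈ {u | r.val.2 u = k + 1}, G.Adj u w → w ∈ T) →
          {u | r.val.2 u = k + 1} ⊆ T := fun T _ hvT hcl u hu => h1.reach T hvT hcl u hu
      intro T hT hne hcl
      by_cases hvT : v ∈ T
      · exact key T hT hvT hcl
      · exfalso
        obtain ⟨t, ht⟩ := hne
        -- `reach` only treats sets that contain the starting vertex; a closed part without it is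
        -- handled by passing to its complement, which is closed by symmetry of adjacency.
        have := key ({u | r.val.2 u = k + 1} \ T) Set.sdiff_subset ⟨h1.root, hvT⟩
          (fun u hu w hw huw => ⟨hw, fun hwT => hu.2 (hcl w hwT u hu.1 huw.symm)⟩) (hT ht)
        exact this.2 ht
    refine ⟨?_, ?_, ?_, ?_, ?_, ?_⟩
    · intro u
      by_cases hu : r.val.2 u = k + 1
      · omega
      · rw [hold u hu]
        exact (hk.le u).trans (by omega)
    · intro u hu0
      by_cases hu : r.val.2 u = k + 1
      · rw [h1.lab_eq u hu]
        exact hl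
      · rw [hold u hu] at hu0
        exact hk.lab_ne u hu0
    · intro u w hu0 huw
      by_cases hu : r.val.2 u = k + 1
      · rw [h1.lab_eq u hu, h1.lab_eq w (huw ▸ hu)]
      · have hw : r.val.2 w ≠ k + 1 := fun h' => hu (huw.trans h')
        rw [hold u hu] at hu0 huw
        rw [hold w hw] at huw
        exact hk.lab_eq u w hu0 huw
    · intro u w huw hlab hu0
      by_cases hu : r.val.2 u = k + 1
      · rw [hu]
        exact hfr u hu (by simp) (by simp) w huw (hlab.symm.trans (h1.lab_eq u hu))
      · rw [hold u hu] at hu0 ⊢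
        have h3 := hk.closed u w huw hlab hu0
        rw [← h3]
        apply hold
        intro h4
        have := hnew w h4
        omega
    · intro c hc1 hck
      by_cases hc : c = k + 1
      · exact ⟨v, by rw [hc]; exact h1.root⟩
      · obtain ⟨u, hu⟩ := hk.nonempty c hc1 (by omega)
        refine ⟨u, ?_⟩
        rw [hold u]
        · exact hu
        · intro h4
          have := hnew u h4
          omega
    · intro c hc0
      by_cases hc : c = k + 1
      · rw [hc]
        exact hconn
      · have : {u | r.val.2 u = c} = {u | comp u = c} := by
          ext u
          simp only [Set.mem_ofPred_eq]
          constructor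
          · intro hu
            rw [← hold u (by omega)]
            exact hu
          · intro hu
            rw [hold u]
            · exact hu
            · intro h4
              have := hnew u h4
              omega
        rw [this]
        exact hk.conn c hc0
  · unfold stackWeight at h2
    omega

/-- The buckets are disjoint; the induction removes the elements of the last one. -/
theorem sum_length_filter_le {α : Type*} (g : α → ℕ) (l : List α) (k : ℕ) :
    ((List.range k).map fun i => (l.filter fun a => g a = i + 1).length).sum ≤ l.length := by
  induction k generalizing l with
  | zero => simp
  | succ k ih =>
    have h1 : ∀ i ∈ List.range k, (l.filter fun a => g a = i + 1) =
        ((l.filter fun a => g a ≠ k + 1).filter fun a => g a = i + 1) := by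
      intro i hi
      rw [List.filter_filter]
      refine List.filter_congr fun a _ => ?_
      have := List.mem_range.1 hi
      by_cases h : g a = i + 1
      · simp [h]
        omega
      · simp [h]
    rw [List.range_succ, List.map_append, List.sum_append]
    rw [List.map_congr_left (fun i hi => congrArg List.length (h1 i hi))]
    have h2 := ih (l.filter fun a => g a ≠ k + 1)
    have h3 := l.length_eq_length_filter_add (fun a => decide (g a = k + 1))
    simp only [List.map_cons, List.map_nil, List.sum_cons, List.sum_nil, Nat.add_zero]
    have h4 : (l.filter fun a => !decide (g a = k + 1)) = l.filter fun a => decide (g a ≠ k + 1) := by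
      simp
    rw [h4] at h3
    omega

/-- Filling the buckets from the reversed list makes every component a filter of `U`. Thus vertex
sets keep their increasing order through the recursion, and the keys of the memo table are
canonical. The total length bound will pay for the lookups. -/
theorem components_spec {adj : Fin n → List (Fin n)} (hadj : IsAdjList G adj) [NeZero n] {D : ℕ}
    (hD : D = ∑ v, (adj v).length) {U : List (Fin n)} (hU : U.Nodup)
    (hlab : ∀ u, lab u ≠ 0 → u ∈ U) :
    (∀ H ∈ (components adj U lab).val, H ≠ [] ∧ (∃ p : Fin n → Bool, H = U.filter p) ∧
      CutConnected G {u | u ∈ H} ∧ ∃ l ≠ 0, (∀ u ∈ H, lab u = l) ∧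
        ∀ u ∈ H, ∀ w, lab w = l → G.Adj u w → w ∈ H) ∧
    ((components adj U lab).val.map List.length).sum ≤ n ∧
    (components adj U lab).val.length ≤ n ∧
    (components adj U lab).time ≤ 30 * (n + D) := by
  have hlen := length_le_of_nodup hU
  have hn : 0 < n := NeZero.pos n
  simp only [components, newArr_bind_val, newArr_bind_time]
  rw [bind_val, bind_time]
  obtain ⟨h1, h2⟩ := forEach_spec (L := U) (f := fun v (t : (Fin n → ℕ) × ℕ) => do
    let l ← rd lab v
    let c ← rd t.1 v
    if l = 0 ∨ c ≠ 0 then pure t else do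
      let k := t.2 + 1
      let comp ← wr t.1 v k
      let r ← whileDo n (fun r : List (Fin n) × (Fin n → ℕ) => !r.1.isEmpty)
        (fun r => match r.1 with
          | [] => pure r
          | x :: stack => do
            let N ← rd adj x
            forEach N (stack, r.2) fun w r => do
              let l' ← rd lab w
              let c' ← rd r.2 w
              if l' = l ∧ c' = 0 then do
                let comp ← wr r.2 w k
                let stack ← op (w :: r.1)
                pure (stack, comp)
              else pure r)
        ([v], comp)
      pure (r.2, k)) (fun _ t => CompInv G lab t.1 t.2)
      (fun done t => freeWeight (traversalCost adj) t.1 + 5 * (U.length - done.length))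
      (by
        rintro done v rest ⟨comp, k⟩ hL h
        change CompInv G lab comp k at h
        have hl1 : U.length = done.length + (rest.length + 1) := by simp [hL]
        have hl2 : (done ++ [v]).length = done.length + 1 := by simp
        simp only [rd_bind_val, rd_bind_time]
        by_cases hc : lab v = 0 ∨ comp v ≠ 0
        · rw [if_pos hc]
          refine ⟨h, ?_⟩
          simp only [pure_val, pure_time, hl2]
          omega
        · rw [if_neg hc]
          push Not at hc
          obtain ⟨h1, h2⟩ := h.traverse hadj hc.1 hc.2
          simp only [wr_bind_val, wr_bind_time]
          rw [bind_val, bind_time]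
          simp only [pure_val, pure_time]
          refine ⟨h1, ?_⟩
          rw [hl2]
          omega) (s := (fun _ => 0, 0)) ⟨by simp, by simp, by simp, by simp, by
            intro c h1 h2
            simp only at h2
            omega, by
            rintro c hc T hT ⟨t, ht⟩
            exact absurd (hT ht) (by simpa using hc.symm)⟩
  generalize hA : (forEach (β := Fin n) (σ := (Fin n → ℕ) × ℕ) U (fun _ => 0, 0) _).val = A at h1 h2 ⊢
  generalize hAt : (forEach (β := Fin n) (σ := (Fin n → ℕ) × ℕ) U (fun _ => 0, 0) _).time = At
    at h2 ⊢
  obtain ⟨comp, k⟩ := A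
  simp only at h1 h2 ⊢
  have hrev : (forEach U [] fun v acc => op (v :: acc)).val = U.reverse :=
    forEach_inv (f := fun v (acc : List (Fin n)) => op (v :: acc))
      (fun done acc => acc = done.reverse) (fun done b rest s _ h => by simp [h]) rfl
  have hrevt := forEach_time_le_const (f := fun v (acc : List (Fin n)) => op (v :: acc)) 1 U
    (fun _ _ _ => by simp) []
  rw [bind_val, bind_time, hrev]
  simp only [newArr_bind_val, newArr_bind_time]
  have hbuck : (forEach U.reverse (fun (_ : ℕ) => ([] : List (Fin n))) fun v b => do
      let c ← rd comp v
      let l ← rd b c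
      wr b c (v :: l)).val = fun c => U.filter fun u => comp u = c := by
    have := forEach_inv (L := U.reverse) (f := fun v (b : ℕ → List (Fin n)) => do
      let c ← rd comp v
      let l ← rd b c
      wr b c (v :: l)) (fun done b => b = fun c => done.reverse.filter fun u => comp u = c)
      (fun done v rest b _ h => by
        simp only [rd_bind_val, wr_val]
        funext c
        by_cases hc : c = comp v
        · subst hc
          simp [h]
        · rw [Function.update_of_ne hc]
          have : comp v ≠ c := fun h => hc h.symm
          simp [h, this]) (s := fun _ => []) (by simp)
    simpa using this
  have hbuckt := forEach_time_le_const (f := fun v (b : ℕ → List (Fin n)) => do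
      let c ← rd comp v
      let l ← rd b c
      wr b c (v :: l)) 3 U.reverse (fun _ _ _ => by simp) (fun _ => [])
  rw [bind_val, bind_time, hbuck]
  set B : ℕ → List (Fin n) := fun c => U.filter fun u => comp u = c with hB
  have hfin : (forEach (List.range k) [] fun i acc => do
      let H ← rd B (i + 1)
      op (H :: acc)).val = ((List.range k).map fun i => B (i + 1)).reverse := by
    have := (forEach_range_spec (f := fun i (acc : List (List (Fin n))) => do
      let H ← rd B (i + 1)
      op (H :: acc)) (fun i acc => acc = ((List.range i).map fun i => B (i + 1)).reverse)
      (fun i _ => 3 * (k - i)) k (fun i s hi h => by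
        constructor
        · simp [h, List.range_succ]
        · simp
          omega) (s := []) (by simp)).1
    exact this
  have hfint := forEach_time_le_const (f := fun i (acc : List (List (Fin n))) => do
      let H ← rd B (i + 1)
      op (H :: acc)) 2 (List.range k) (fun _ _ _ => by simp) []
  rw [hfin]
  have hsum := sum_length_filter_le comp U k
  have hmemB : ∀ c, ∀ u, c ≠ 0 → (u ∈ B c ↔ comp u = c) := by
    intro c u hc
    simp only [hB, List.mem_filter, decide_eq_true_eq, and_iff_right_iff_imp]
    intro h
    exact hlab u (h1.lab_ne u (by omega))
  have hne : ∀ i < k, B (i + 1) ≠ [] := by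
    intro i hi
    obtain ⟨u, hu⟩ := h1.nonempty (i + 1) (by omega) (by omega)
    exact List.ne_nil_of_mem ((hmemB (i + 1) u (by omega)).2 hu)
  have hkn : k ≤ n := by
    have : k ≤ ((List.range k).map fun i => (B (i + 1)).length).sum := by
      have e : ((List.range k).map fun _ => 1).sum ≤
          ((List.range k).map fun i => (B (i + 1)).length).sum := by
        refine List.sum_le_sum fun i hi => ?_
        exact List.length_pos_iff.2 (hne i (List.mem_range.1 hi))
      simpa using e
    exact this.trans (hsum.trans hlen)
  refine ⟨?_, ?_, by simpa using hkn, ?_⟩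
  · intro H hH
    simp only [List.mem_reverse, List.mem_map, List.mem_range] at hH
    obtain ⟨i, hi, rfl⟩ := hH
    refine ⟨hne i hi, ⟨_, rfl⟩, ?_, ?_⟩
    · have : {u | u ∈ B (i + 1)} = {u | comp u = i + 1} := by
        ext u
        exact hmemB (i + 1) u (by omega)
      rw [this]
      exact h1.conn _ (by omega)
    · obtain ⟨u, hu⟩ := h1.nonempty (i + 1) (by omega) (by omega)
      refine ⟨lab u, h1.lab_ne u (by omega), ?_, ?_⟩
      · intro w hw
        rw [hmemB _ _ (by omega)] at hw
        exact h1.lab_eq w u (by omega) (by omega)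
      · intro x hx w hw hxw
        rw [hmemB _ _ (by omega)] at hx ⊢
        rw [← hx]
        exact h1.closed x w hxw
          ((h1.lab_eq x u (by omega) (by omega)).trans hw.symm) (by omega)
  · rw [List.map_reverse, List.sum_reverse, List.map_map]
    exact hsum.trans hlen
  · have hfw : freeWeight (traversalCost adj) (fun _ => 0) = 5 * D + 3 * n := by
      unfold freeWeight traversalCost
      simp only [Finset.filter_true, Finset.sum_add_distrib, ← Finset.mul_sum, ← hD]
      simp [mul_comm]
    rw [hfw] at h2
    simp only [List.length_nil, List.length_reverse, List.length_range] at h2 hbuckt hfint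
    omega

end Components

end CliquePicking

namespace CliquePicking

open SimpleGraph

/-! ### The sets found at a clique are subproblems. -/

section Subproblems

variable {n : ℕ} {G : SimpleGraph (Fin n)} {U K : List (Fin n)}

theorem mark_eq (U : List (Fin n)) : (mark U).val = fun v => decide (v ∈ U) :=
  funext (mark_val U)

variable [NeZero n]

/-- The traversal finds components of the sets in `L`, and `exists_separator` turns them into
components of a common neighbourhood. The vertex `y` outside of them, which exists because `K` is
maximal in `U`, also makes each component strictly smaller than `U`. -/
theorem subproblems_spec (hG : G.IsChordalGraph) {adj : Fin n → List (Fin n)}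
    (hadj : IsAdjList G adj) {D : ℕ} (hD : D = ∑ v, (adj v).length) (hU : U.Nodup)
    (hUs : IsSubproblem G {u | u ∈ U}) (hKn : K.Nodup) (hKU : K ⊆ U)
    (hK : G.IsClique {v | v ∈ K}) (hmax : ∀ v ∈ U, v ∉ K → ∃ y ∈ K, ¬ G.Adj y v) :
    (∀ H ∈ (subproblems adj D U K fun v => decide (v ∈ U)).val,
      (∃ p : Fin n → Bool, H = U.filter p) ∧ IsSubproblem G {u | u ∈ H} ∧
        H.length < U.length) ∧
    ((subproblems adj D U K fun v => decide (v ∈ U)).val.map List.length).sum ≤ n ∧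
    (subproblems adj D U K fun v => decide (v ∈ U)).val.length ≤ n ∧
    (subproblems adj D U K fun v => decide (v ∈ U)).time ≤ 100 * (n + D) := by
  have h1 := mark_time K
  have h2 := length_le_of_nodup hKn
  have hn : 0 < n := NeZero.pos n
  simp only [subproblems]
  rw [bind_val, bind_time, mark_eq, bind_val, bind_time]
  obtain ⟨h3, h4⟩ := lbfs_spec hadj hD hU hKn hKU hK
  set s := (lbfs adj D U K (fun v => decide (v ∈ U)) (fun v => decide (v ∈ K))).val with hs
  obtain ⟨h5, h6, h7, h8⟩ := components_spec (lab := s.lab) hadj hD hU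
    (fun u hu => (h3.lab_mem u hu).1)
  refine ⟨fun H hH => ?_, h6, h7, by omega⟩
  obtain ⟨hne, ⟨p, hp⟩, hconn, l, hl, hHl, hcl⟩ := h5 H hH
  obtain ⟨u, hu⟩ := List.exists_mem_of_ne_nil H hne
  have hul := hHl u hu
  obtain ⟨S, hS, hSU, hlS, hlcl, y, hyU, hyS, hyl⟩ :=
    h3.exists_separator hG hK hKU hmax (u := u) (by omega)
  have hHU : ∀ x ∈ H, x ∈ U := fun x hx => by
    rw [hp] at hx
    exact (List.mem_filter.1 hx).1
  have hyH : y ∉ H := fun h' => hyl (by rw [hul, hHl y h'])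
  refine ⟨⟨p, hp⟩, ?_, ?_⟩
  · refine hUs.of_component (S := S) hS hSU hHU ⟨u, hu⟩ hconn ?_ ?_ hyU hyS hyH
    · exact fun x hx => hlS x (by rw [hul, hHl x hx])
    · intro x hx w hw hwS hxw
      exact hcl x hx w ((hlcl w hw hwS x (by rw [hul, hHl x hx]) hxw).trans hul) hxw
  · rw [hp]
    refine lt_of_le_of_ne (List.length_filter_le _ _) fun h' => ?_
    rw [List.length_filter_eq_length_iff] at h'
    exact hyH (by rw [hp, List.mem_filter]; exact ⟨hyU, h' y hyU⟩)

end Subproblems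

end CliquePicking

namespace CliquePicking

open SimpleGraph

/-! ### The clique tree -/

section Tree

variable {n : ℕ} {G : SimpleGraph (Fin n)} {U : List (Fin n)} {pos : Fin n → ℕ}

/-- The preceding neighbours of a vertex. -/
def precNbrs (G : SimpleGraph (Fin n)) (U : List (Fin n)) (pos : Fin n → ℕ) (v : Fin n) :
    Set (Fin n) := {a | a ∈ U ∧ pos a < pos v ∧ G.Adj a v}

/-- The clique tree after the vertices at the positions below `i` have been processed; `home u` is
the clique to which `u` was assigned. -/
structure TreeInv (G : SimpleGraph (Fin n)) (U : List (Fin n)) (pos : Fin n → ℕ) (i : ℕ)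
    (T : CliqueTree n) (home : Fin n → ℕ) : Prop where
  nodup : ∀ x < T.num, (T.iota x).Nodup
  size_eq : ∀ x < T.num, T.size x = (T.iota x).length
  last : ∀ x < T.num, ∃ t ∈ U, pos t < i ∧ home t = x ∧
    ∀ u, u ∈ T.iota x ↔ u = t ∨ u ∈ precNbrs G U pos t
  creator : ∀ x < T.num, ∃ c, pos c < i ∧ home c = x ∧ IsCreator G {u | u ∈ U} pos c
  home_spec : ∀ u ∈ U, pos u < i → home u < T.num ∧ u ∈ T.iota (home u) ∧
    ∀ a ∈ precNbrs G U pos u, a ∈ T.iota (home u)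
  home_le : ∀ x < T.num, ∀ u ∈ T.iota x, home u ≤ x
  home_parent : ∀ x < T.num, ∀ u ∈ T.iota x, home u = x ∨
    ∃ y, T.parent x = some y ∧ u ∈ T.iota y
  parent_lt : ∀ x y, T.parent x = some y → x < T.num ∧ y < x
  children : ∀ x y, y ∈ T.children x ↔ T.parent y = some x
  children_nodup : ∀ x, (T.children x).Nodup
  greedy : ∀ u ∈ U, pos u < i → ∀ x ∈ precNbrs G U pos u,
    (∀ a ∈ precNbrs G U pos u, pos a ≤ pos x) →
      home u = home x ∨ ∃ y ∈ T.iota (home x), pos y < pos u ∧ ¬ G.Adj y u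

variable {i : ℕ} {T : CliqueTree n} {home : Fin n → ℕ} {v : Fin n}

theorem TreeInv.iota_spec (h : TreeInv G U pos i T home) {x : ℕ} (hx : x < T.num) {u : Fin n}
    (hu : u ∈ T.iota x) : u ∈ U ∧ pos u < i := by
  obtain ⟨t, ht, hti, -, hmem⟩ := h.last x hx
  rcases (hmem u).1 hu with rfl | h1
  · exact ⟨ht, hti⟩
  · exact ⟨h1.1, h1.2.1.trans hti⟩

theorem TreeInv.isClique (h : TreeInv G U pos i T home) (hP : IsPEO G {u | u ∈ U} pos) {x : ℕ}
    (hx : x < T.num) : G.IsClique {u | u ∈ T.iota x} := by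
  obtain ⟨t, ht, hti, -, hmem⟩ := h.last x hx
  intro a ha b hb hab
  rcases (hmem a).1 ha with rfl | h1 <;> rcases (hmem b).1 hb with rfl | h2
  · exact absurd rfl hab
  · exact h2.2.2.symm
  · exact h1.2.2
  · exact hP t ht a h1.1 b h2.1 h1.2.1 h2.2.1 h1.2.2 h2.2.2 hab

/-- Adding a vertex to an existing clique. -/
theorem TreeInv.join (h : TreeInv G U pos i T home)
    (hinj : Set.InjOn pos {u | u ∈ U}) (hv : v ∈ U) (hvi : pos v = i) {c : ℕ}
    (hc : c < T.num) (hcP : ∀ u, u ∈ T.iota c ↔ u ∈ precNbrs G U pos v)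
    (hhome : ∀ x ∈ precNbrs G U pos v, (∀ a ∈ precNbrs G U pos v, pos a ≤ pos x) →
      home x = c) :
    TreeInv G U pos (i + 1)
      { T with
        iota := Function.update T.iota c (v :: T.iota c)
        size := Function.update T.size c (T.size c + 1) } (Function.update home v c) := by
  have hne : ∀ u, pos u < i → u ≠ v := by
    rintro u hu rfl
    omega
  have hlt : ∀ u ∈ U, pos u < i + 1 → u ≠ v → pos u < i := by
    intro u hu h1 h2
    have : pos u ≠ pos v := fun h' => h2 (hinj hu hv h')
    omega
  have hh : ∀ u, pos u < i → Function.update home v c u = home u := fun u hu =>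
    Function.update_of_ne (hne u hu) ..
  have hsub : ∀ x u, u ∈ T.iota x → u ∈ Function.update T.iota c (v :: T.iota c) x := by
    intro x u hu
    by_cases hx : x = c
    · subst hx
      simp [hu]
    · rwa [Function.update_of_ne hx]
  have hcase : ∀ x, ∀ u ∈ Function.update T.iota c (v :: T.iota c) x,
      u ∈ T.iota x ∨ (u = v ∧ x = c) := by
    intro x u hu
    by_cases hx : x = c
    · subst hx
      rw [Function.update_self, List.mem_cons] at hu
      tauto
    · rw [Function.update_of_ne hx] at hu
      exact Or.inl hu
  have hprec : ∀ u a, pos u ≤ i → a ∈ precNbrs G U pos u → pos a < i := fun u a hu ha =>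
    lt_of_lt_of_le ha.2.1 hu
  refine ⟨?_, ?_, ?_, ?_, ?_, ?_, ?_, h.parent_lt, h.children, h.children_nodup, ?_⟩
  · intro x hx
    dsimp only
    by_cases hxc : x = c
    · subst hxc
      rw [Function.update_self, List.nodup_cons]
      exact ⟨fun h1 => hne v (h.iota_spec hx h1).2 rfl, h.nodup x hx⟩
    · rw [Function.update_of_ne hxc]
      exact h.nodup x hx
  · intro x hx
    dsimp only
    by_cases hxc : x = c
    · subst hxc
      rw [Function.update_self, Function.update_self, List.length_cons, h.size_eq x hx]
    · rw [Function.update_of_ne hxc, Function.update_of_ne hxc]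
      exact h.size_eq x hx
  · intro x hx
    dsimp only
    by_cases hxc : x = c
    · subst hxc
      refine ⟨v, hv, by omega, by simp, fun u => ?_⟩
      rw [Function.update_self, List.mem_cons, hcP]
    · obtain ⟨t, ht, hti, hth, hmem⟩ := h.last x hx
      refine ⟨t, ht, by omega, by rw [hh t hti, hth], fun u => ?_⟩
      rw [Function.update_of_ne hxc]
      exact hmem u
  · intro x hx
    obtain ⟨d, hd, hdx, hcr⟩ := h.creator x hx
    exact ⟨d, by omega, by rw [hh d hd, hdx], hcr⟩
  · intro u hu hui
    dsimp only
    by_cases huv : u = v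
    · subst huv
      rw [Function.update_self, Function.update_self]
      refine ⟨hc, by simp, fun a ha => ?_⟩
      exact List.mem_cons_of_mem _ ((hcP a).2 ha)
    · rw [Function.update_of_ne huv]
      have hui' := hlt u hu hui huv
      obtain ⟨h1, h2, h3⟩ := h.home_spec u hu hui'
      exact ⟨h1, hsub _ _ h2, fun a ha => hsub _ _ (h3 a ha)⟩
  · intro x hx u hu
    rcases hcase x u hu with h1 | ⟨rfl, rfl⟩
    · rw [hh u (h.iota_spec hx h1).2]
      exact h.home_le x hx u h1
    · rw [Function.update_self]
  · intro x hx u hu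
    rcases hcase x u hu with h1 | ⟨rfl, rfl⟩
    · rw [hh u (h.iota_spec hx h1).2]
      rcases h.home_parent x hx u h1 with h2 | ⟨y, hy, h2⟩
      · exact Or.inl h2
      · exact Or.inr ⟨y, hy, hsub y u h2⟩
    · exact Or.inl (Function.update_self ..)
  · intro u hu hui x hx hmax
    have hxi : pos x < i := hprec u x (by omega) hx
    rw [hh x hxi]
    by_cases huv : u = v
    · subst huv
      rw [Function.update_self]
      exact Or.inl (hhome x hx hmax).symm
    · have hui' := hlt u hu hui huv
      rw [hh u hui']
      rcases h.greedy u hu hui' x hx hmax with h1 | ⟨y, hy, h1⟩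
      · exact Or.inl h1
      · exact Or.inr ⟨y, hsub _ y hy, h1⟩

/-- Starting a new clique. -/
theorem TreeInv.newNode (h : TreeInv G U pos i T home)
    (hinj : Set.InjOn pos {u | u ∈ U}) (hv : v ∈ U) (hvi : pos v = i) {L : List (Fin n)}
    (hL : ∀ u, u ∈ L ↔ u ∈ precNbrs G U pos v) (hLn : L.Nodup)
    (hcr : IsCreator G {u | u ∈ U} pos v) {parent : ℕ → Option ℕ} {children : ℕ → List ℕ}
    {q : Option ℕ} (hq : ∀ y, q = some y → y < T.num)
    (hparent : parent = Function.update T.parent T.num q)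
    (hLq : ∀ u ∈ L, ∃ y, q = some y ∧ u ∈ T.iota y)
    (hch : ∀ x y, y ∈ children x ↔ y ∈ T.children x ∨ (y = T.num ∧ q = some x))
    (hchn : ∀ x, (children x).Nodup)
    (hgr : ∀ x ∈ precNbrs G U pos v, (∀ a ∈ precNbrs G U pos v, pos a ≤ pos x) →
      ∃ y ∈ T.iota (home x), pos y < pos v ∧ ¬ G.Adj y v) :
    TreeInv G U pos (i + 1)
      ⟨T.num + 1, Function.update T.iota T.num (v :: L),
        Function.update T.size T.num (L.length + 1), parent, children⟩
      (Function.update home v T.num) := by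
  have hne : ∀ u, pos u < i → u ≠ v := by
    rintro u hu rfl
    omega
  have hlt : ∀ u ∈ U, pos u < i + 1 → u ≠ v → pos u < i := by
    intro u hu h1 h2
    have : pos u ≠ pos v := fun h' => h2 (hinj hu hv h')
    omega
  have hh : ∀ u, pos u < i → Function.update home v T.num u = home u := fun u hu =>
    Function.update_of_ne (hne u hu) ..
  have hold : ∀ x < T.num, Function.update T.iota T.num (v :: L) x = T.iota x := fun x hx =>
    Function.update_of_ne hx.ne ..
  have hnum : ∀ x < T.num + 1, x = T.num ∨ x < T.num := fun x hx => by omega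
  have hLi : ∀ u ∈ L, u ∈ U ∧ pos u < i := fun u hu => by
    have := (hL u).1 hu
    exact ⟨this.1, hvi ▸ this.2.1⟩
  have hpnone : T.parent T.num = none := by
    by_contra h'
    obtain ⟨y, hy⟩ := Option.ne_none_iff_exists'.1 h'
    have := (h.parent_lt _ _ hy).1
    omega
  have hpar : ∀ x < T.num, parent x = T.parent x := fun x hx => by
    rw [hparent, Function.update_of_ne hx.ne]
  have hprec : ∀ u a, pos u ≤ i → a ∈ precNbrs G U pos u → pos a < i := fun u a hu ha =>
    lt_of_lt_of_le ha.2.1 hu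
  refine ⟨?_, ?_, ?_, ?_, ?_, ?_, ?_, ?_, ?_, hchn, ?_⟩
  · intro x hx
    dsimp only
    rcases hnum x hx with rfl | hx'
    · rw [Function.update_self, List.nodup_cons]
      exact ⟨fun h1 => hne v (hLi v h1).2 rfl, hLn⟩
    · rw [hold x hx']
      exact h.nodup x hx'
  · intro x hx
    dsimp only
    rcases hnum x hx with rfl | hx'
    · simp
    · rw [hold x hx', Function.update_of_ne hx'.ne]
      exact h.size_eq x hx'
  · intro x hx
    dsimp only
    rcases hnum x hx with rfl | hx'
    · refine ⟨v, hv, by omega, by simp, fun u => ?_⟩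
      rw [Function.update_self, List.mem_cons, hL]
    · obtain ⟨t, ht, hti, hth, hmem⟩ := h.last x hx'
      refine ⟨t, ht, by omega, by rw [hh t hti, hth], fun u => ?_⟩
      rw [hold x hx']
      exact hmem u
  · intro x hx
    rcases hnum x hx with rfl | hx'
    · exact ⟨v, by omega, by simp, hcr⟩
    · obtain ⟨d, hd, hdx, hdcr⟩ := h.creator x hx'
      exact ⟨d, by omega, by rw [hh d hd, hdx], hdcr⟩
  · intro u hu hui
    dsimp only
    by_cases huv : u = v
    · subst huv
      rw [Function.update_self, Function.update_self]
      refine ⟨by omega, by simp, fun a ha => ?_⟩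
      exact List.mem_cons_of_mem _ ((hL a).2 ha)
    · have hui' := hlt u hu hui huv
      rw [Function.update_of_ne huv]
      obtain ⟨h1, h2, h3⟩ := h.home_spec u hu hui'
      rw [hold _ h1]
      exact ⟨by omega, h2, h3⟩
  · intro x hx u hu
    dsimp only at hu
    rcases hnum x hx with rfl | hx'
    · by_cases huv : u = v
      · rw [huv, Function.update_self]
      · rw [Function.update_of_ne huv]
        rw [Function.update_self, List.mem_cons] at hu
        have := hLi u (hu.resolve_left huv)
        exact (h.home_spec u this.1 this.2).1.le
    · rw [hold x hx'] at hu
      rw [hh u (h.iota_spec hx' hu).2]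
      exact h.home_le x hx' u hu
  · intro x hx u hu
    dsimp only at hu ⊢
    rcases hnum x hx with rfl | hx'
    · rw [Function.update_self, List.mem_cons] at hu
      rcases hu with rfl | hu
      · left
        rw [Function.update_self]
      · right
        obtain ⟨y, hy, huy⟩ := hLq u hu
        refine ⟨y, by rw [hparent, Function.update_self, hy], ?_⟩
        rw [hold y (hq y hy)]
        exact huy
    · rw [hold x hx'] at hu
      rw [hh u (h.iota_spec hx' hu).2, hpar x hx']
      rcases h.home_parent x hx' u hu with h2 | ⟨y, hy, h2⟩
      · exact Or.inl h2
      · refine Or.inr ⟨y, hy, ?_⟩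
        have := (h.parent_lt x y hy).2
        rw [hold y (by omega)]
        exact h2
  · intro x y hxy
    dsimp only at hxy ⊢
    rw [hparent] at hxy
    by_cases hx : x = T.num
    · rw [hx, Function.update_self] at hxy
      have := hq y hxy
      omega
    · rw [Function.update_of_ne hx] at hxy
      have := h.parent_lt x y hxy
      omega
  · intro x y
    dsimp only
    rw [hch, h.children, hparent]
    by_cases hy : y = T.num
    · rw [hy, Function.update_self, hpnone]
      simp
    · rw [Function.update_of_ne hy]
      simp [hy]
  · intro u hu hui x hx hmax
    have hxi : pos x < i := hprec u x (by omega) hx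
    dsimp only
    rw [hh x hxi, hold _ (h.home_spec x hx.1 hxi).1]
    by_cases huv : u = v
    · subst huv
      exact Or.inr (hgr x hx hmax)
    · have hui' := hlt u hu hui huv
      rw [hh u hui']
      exact h.greedy u hu hui' x hx hmax

/-- The cliques of the tree are maximal. -/
theorem TreeInv.maximal (h : TreeInv G U pos U.length T home) (hpos : ∀ u ∈ U, pos u < U.length)
    (hP : IsPEO G {u | u ∈ U} pos) (hinj : Set.InjOn pos {u | u ∈ U}) {x : ℕ} (hx : x < T.num) :
    ∀ z ∈ U, z ∉ T.iota x → ∃ y ∈ T.iota x, ¬ G.Adj y z := by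
  by_contra hcon
  push Not at hcon
  obtain ⟨z₀, hz₀⟩ := hcon
  -- The first vertex `z` by which the clique could be extended has all its preceding neighbours in
  -- the clique, the last of them being `t`. When `z` was processed, it was therefore put into the
  -- clique of `t`, or that clique has a non-neighbour of `z`.
  obtain ⟨z, ⟨hzU, hzx, hzadj⟩, hmin⟩ := Set.exists_min_image
    {z | z ∈ U ∧ z ∉ T.iota x ∧ ∀ y ∈ T.iota x, G.Adj y z} pos (Set.toFinite _) ⟨z₀, hz₀⟩
  obtain ⟨t, htU, hti, hth, hmem⟩ := h.last x hx
  have ht : t ∈ T.iota x := (hmem t).2 (Or.inl rfl)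
  have htz : pos t < pos z := by
    by_contra hlt
    have hne : pos z ≠ pos t := fun h' => hzx (hinj hzU htU h' ▸ ht)
    exact hzx ((hmem z).2 (Or.inr ⟨hzU, by omega, (hzadj t ht).symm⟩))
  have hle : ∀ u ∈ T.iota x, u ∈ U ∧ pos u ≤ pos t := by
    intro u hu
    rcases (hmem u).1 hu with rfl | h1
    · exact ⟨htU, le_rfl⟩
    · exact ⟨h1.1, h1.2.1.le⟩
  have hprec : ∀ a ∈ precNbrs G U pos z, a ∈ T.iota x := by
    intro a ha
    by_contra hax
    have := hmin a ⟨ha.1, hax, fun y hy => hP z hzU y (hle y hy).1 a ha.1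
      (lt_of_le_of_lt (hle y hy).2 htz) ha.2.1 (hzadj y hy) ha.2.2 (fun h' => hax (h' ▸ hy))⟩
    have := ha.2.1
    omega
  rcases h.greedy z hzU (hpos z hzU) t ⟨htU, htz, hzadj t ht⟩
    (fun a ha => (hle a (hprec a ha)).2) with h1 | ⟨y, hy, -, hyz⟩
  · apply hzx
    have := (h.home_spec z hzU (hpos z hzU)).2.1
    rwa [h1, hth] at this
  · rw [hth] at hy
    exact hyz (hzadj y hy)

variable [NeZero n]

/-- Each node was opened by a creator whose `home` is this node, so distinct nodes have distinct
creators. -/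
theorem TreeInv.num_le (h : TreeInv G U pos i T home) (hP : IsPEO G {u | u ∈ U} pos)
    (hinj : Set.InjOn pos {u | u ∈ U}) : T.num ≤ G.maximalCliques.ncard := by
  refine le_trans ?_ (hP.ncard_creators_le hinj)
  have hex : ∀ x < T.num, ∃ c, home c = x ∧ IsCreator G {u | u ∈ U} pos c := by
    intro x hx
    obtain ⟨c, -, h1, h2⟩ := h.creator x hx
    exact ⟨c, h1, h2⟩
  choose! c hc using hex
  have := Set.ncard_le_ncard_of_injOn (s := (Finset.range T.num : Set ℕ)) c
    (t := {v | IsCreator G {u | u ∈ U} pos v})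
    (fun x hx => (hc x (by simpa using hx)).2) (by
      intro x hx y hy hxy
      rw [← (hc x (by simpa using hx)).1, hxy, (hc y (by simpa using hy)).1]) (Set.toFinite _)
  rw [Set.ncard_coe_finset, Finset.card_range] at this
  exact this

/-- A clique consists of its last vertex and some neighbours of it; last vertices of different
cliques have different homes. -/
theorem TreeInv.sum_length_le (h : TreeInv G U pos i T home) {adj : Fin n → List (Fin n)}
    (hadj : IsAdjList G adj) {D : ℕ} (hD : D = ∑ v, (adj v).length) :
    ∑ x ∈ Finset.range T.num, (T.iota x).length ≤ n + D := by
  classical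
  have hex : ∀ x ∈ Finset.range T.num, ∃ t, home t = x ∧
      (T.iota x).length ≤ 1 + (adj t).length := by
    intro x hx
    rw [Finset.mem_range] at hx
    obtain ⟨t, -, -, hth, hmem⟩ := h.last x hx
    refine ⟨t, hth, ?_⟩
    have : (T.iota x).Subperm (t :: adj t) := by
      refine List.subperm_of_subset (h.nodup x hx) fun u hu => ?_
      rcases (hmem u).1 hu with rfl | h1
      · simp
      · exact List.mem_cons_of_mem _ (((hadj t).2 u).2 h1.2.2.symm)
    have := this.length_le
    rw [List.length_cons] at this
    omega
  choose! t ht using hex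
  calc ∑ x ∈ Finset.range T.num, (T.iota x).length
      ≤ ∑ x ∈ Finset.range T.num, (1 + (adj (t x)).length) :=
        Finset.sum_le_sum fun x hx => (ht x hx).2
    _ = ∑ v ∈ (Finset.range T.num).image t, (1 + (adj v).length) := by
        rw [Finset.sum_image]
        intro x hx y hy hxy
        rw [← (ht x hx).1, hxy, (ht y hy).1]
    _ ≤ ∑ v, (1 + (adj v).length) := Finset.sum_le_univ_sum_of_nonneg fun _ => Nat.zero_le _
    _ = n + D := by rw [Finset.sum_add_distrib, ← hD]; simp

end Tree

end CliquePicking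

namespace CliquePicking

open SimpleGraph

/-! ### Correctness and cost of the clique tree construction. -/

section TreeProgram

variable {n : ℕ} {G : SimpleGraph (Fin n)} {U : List (Fin n)}

theorem prec_loop_spec (pos : Fin n → ℕ) (i : ℕ) {N : List (Fin n)} (hN : N.Nodup) :
    let p := forEach N (([] : List (Fin n)), 0, 0) fun w p => do
        let u ← rd (fun v => decide (v ∈ U)) w
        let q ← rd pos w
        if u = true ∧ q < i then do
          let l ← op (w :: p.1)
          pure (l, p.2.1 + 1, max p.2.2 q)
        else pure p
    p.val.1.Nodup ∧ (∀ u, u ∈ p.val.1 ↔ u ∈ N ∧ u ∈ U ∧ pos u < i) ∧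
      p.val.2.1 = p.val.1.length ∧ (∀ u ∈ p.val.1, pos u ≤ p.val.2.2) ∧
      (p.val.1 ≠ [] → ∃ u ∈ p.val.1, pos u = p.val.2.2) ∧ p.time ≤ 4 * N.length + 1 := by
  intro p
  have hinv := forEach_inv (L := N) (f := fun w (p : List (Fin n) × ℕ × ℕ) => do
        let u ← rd (fun v => decide (v ∈ U)) w
        let q ← rd pos w
        if u = true ∧ q < i then do
          let l ← op (w :: p.1)
          pure (l, p.2.1 + 1, max p.2.2 q)
        else pure p) (fun done p => p.1.Nodup ∧ (∀ u, u ∈ p.1 ↔ u ∈ done ∧ u ∈ U ∧ pos u < i) ∧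
          p.2.1 = p.1.length ∧ (∀ u ∈ p.1, pos u ≤ p.2.2) ∧
          (p.1 ≠ [] → ∃ u ∈ p.1, pos u = p.2.2) ∧ (p.1 = [] → p.2.2 = 0)) ?_ (s := ([], 0, 0))
          (by simp)
  · obtain ⟨h1, h2, h3, h4, h5, -⟩ := hinv
    refine ⟨h1, h2, h3, h4, h5, ?_⟩
    refine forEach_time_le_const 3 N (fun w _ r => ?_) _
    simp only [rd_bind_time]
    split_ifs <;> simp
  · rintro done w rest ⟨l, k, m⟩ hL ⟨h1, h2, h3, h4, h5, h6⟩
    simp only [rd_bind_val, decide_eq_true_eq]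
    simp only at h1 h2 h3 h4 h5 h6
    rw [hL, List.nodup_append] at hN
    have hwd : w ∉ done := fun hw => hN.2.2 w hw w (by simp) rfl
    by_cases hc : w ∈ U ∧ pos w < i
    · rw [if_pos hc]
      simp only [op_bind_val, pure_val]
      refine ⟨?_, ?_, by simp [h3], ?_, ?_, by simp⟩
      · rw [List.nodup_cons]
        exact ⟨fun h => hwd ((h2 w).1 h).1, h1⟩
      · intro u
        rw [List.mem_cons, h2, List.mem_append, List.mem_singleton]
        constructor
        · rintro (rfl | h)
          · exact ⟨Or.inr rfl, hc⟩
          · exact ⟨Or.inl h.1, h.2⟩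
        · rintro ⟨h | h, h'⟩
          · exact Or.inr ⟨h, h'⟩
          · exact Or.inl h
      · intro u hu
        rcases List.mem_cons.1 hu with rfl | hu
        · exact le_max_right _ _
        · exact (h4 u hu).trans (le_max_left _ _)
      · intro _
        rcases le_total m (pos w) with h | h
        · exact ⟨w, by simp, (max_eq_right h).symm⟩
        · by_cases hl : l = []
          · refine ⟨w, by simp, ?_⟩
            have := h6 hl
            omega
          · obtain ⟨u, hu, hum⟩ := h5 hl
            exact ⟨u, by simp [hu], by rw [max_eq_left h, hum]⟩
    · rw [if_neg hc]
      simp only [pure_val]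
      refine ⟨h1, ?_, h3, h4, h5, h6⟩
      intro u
      rw [h2, List.mem_append, List.mem_singleton]
      constructor
      · exact fun h => ⟨Or.inl h.1, h.2⟩
      · rintro ⟨h | rfl, h'⟩
        · exact ⟨h, h'⟩
        · exact absurd h' hc

theorem treeInv_nil (G : SimpleGraph (Fin n)) (U : List (Fin n)) (pos : Fin n → ℕ) :
    TreeInv G U pos 0 ⟨0, fun _ => [], fun _ => 0, fun _ => none, fun _ => []⟩ fun _ => 0 := by
  constructor <;> simp

/-- One step of the construction of the clique tree, for the vertex `v` at position `i`, its list
`l` of preceding neighbours, and the position `q` of the last one of them. -/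
def treeStep (perm : ℕ → Fin n) (v : Fin n) (l : List (Fin n)) (q : ℕ)
    (t : CliqueTree n × (Fin n → ℕ)) : Timed (CliqueTree n × (Fin n → ℕ)) := do
  let T := t.1
  let new ← op (v :: l)
  if l.length = 0 then do
    let iota ← wr T.iota T.num new
    let size ← wr T.size T.num 1
    let home ← wr t.2 v T.num
    pure (⟨T.num + 1, iota, size, T.parent, T.children⟩, home)
  else do
    let x ← rd perm q
    let c ← rd t.2 x
    let k ← rd T.size c
    if k = l.length then do
      let K ← rd T.iota c
      let iota ← wr T.iota c (v :: K)
      let size ← wr T.size c (k + 1)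
      let home ← wr t.2 v c
      pure ({ T with iota := iota, size := size }, home)
    else do
      let iota ← wr T.iota T.num new
      let size ← wr T.size T.num (l.length + 1)
      let parent ← wr T.parent T.num (some c)
      let ch ← rd T.children c
      let children ← wr T.children c (T.num :: ch)
      let home ← wr t.2 v T.num
      pure (⟨T.num + 1, iota, size, parent, children⟩, home)

theorem treeStep_time (perm : ℕ → Fin n) (v : Fin n) (l : List (Fin n)) (q : ℕ)
    (t : CliqueTree n × (Fin n → ℕ)) : (treeStep perm v l q t).time ≤ 10 := by
  simp only [treeStep, op_bind_time]
  split_ifs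
  · simp
  · simp only [rd_bind_time]
    split_ifs <;> simp

/-- By the elimination property the preceding neighbours of `v` all lie in the clique of the last
one. So a comparison of sizes decides whether they are the whole clique. If not, a remaining vertex
of the clique is a non-neighbour of `v` adjacent to all preceding neighbours, and `v` is a creator.
-/
theorem TreeInv.treeStep {s : Search n} {i : ℕ} {t : CliqueTree n × (Fin n → ℕ)}
    (h : TreeInv G U s.pos i t.1 t.2) (hs : Layout U U.length s)
    (hP : IsPEO G {u | u ∈ U} s.pos) (hi : i < U.length) {l : List (Fin n)} (hln : l.Nodup)
    (hl : ∀ u, u ∈ l ↔ u ∈ precNbrs G U s.pos (s.perm i)) {q : ℕ}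
    (hq : ∀ u ∈ l, s.pos u ≤ q) (hq' : l ≠ [] → ∃ u ∈ l, s.pos u = q) :
    TreeInv G U s.pos (i + 1) (treeStep s.perm (s.perm i) l q t).val.1
      (treeStep s.perm (s.perm i) l q t).val.2 := by
  obtain ⟨T, home⟩ := t
  obtain ⟨hv, hvi⟩ := hs.perm_spec i hi
  have hinj := hs.injOn
  set v := s.perm i with hvdef
  simp only [CliquePicking.treeStep, op_bind_val]
  have hpnone : T.parent T.num = none := by
    by_contra h'
    obtain ⟨y, hy⟩ := Option.ne_none_iff_exists'.1 h'
    have := (h.parent_lt _ _ hy).1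
    simp only at this
    omega
  by_cases hl0 : l.length = 0
  · rw [if_pos hl0]
    simp only [wr_bind_val, pure_val]
    have hnil : l = [] := List.length_eq_zero_iff.1 hl0
    subst hnil
    have hnone : ∀ a, a ∉ precNbrs G U s.pos v := fun a ha => by simpa using (hl a).2 ha
    refine h.newNode (L := []) (q := none) hinj hv hvi hl hln ?_ (by simp) ?_ (by simp) (by simp)
      h.children_nodup (fun x hx => absurd hx (hnone x))
    · refine ⟨hv, ?_⟩
      rcases Nat.eq_zero_or_pos i with h0 | h0
      · left
        intro y _
        omega
      · right
        -- Without preceding neighbours any earlier vertex makes `v` a creator.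
        obtain ⟨h1, h2⟩ := hs.perm_spec 0 (by omega)
        refine ⟨s.perm 0, h1, by omega, ?_, ?_⟩
        · exact fun hadj => hnone _ ⟨h1, by omega, hadj⟩
        · exact fun a ha hav hadj => absurd ⟨ha, hav, hadj⟩ (hnone a)
    · rw [← hpnone, Function.update_eq_self]
  · rw [if_neg hl0]
    simp only [rd_bind_val]
    obtain ⟨x, hxl, hxq⟩ := hq' (fun h' => hl0 (by simp [h']))
    have hxP := (hl x).1 hxl
    have hxi : s.pos x < i := by
      have := hxP.2.1
      omega
    have hperm : s.perm q = x := by rw [← hxq, (hs.pos_spec x hxP.1).2]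
    rw [hperm]
    obtain ⟨hc, hxc, hPc⟩ := h.home_spec x hxP.1 hxi
    simp only at hc hxc hPc
    set c := home x with hcdef
    have hlc : ∀ u ∈ l, u ∈ T.iota c := by
      intro u hu
      by_cases hux : u = x
      · rw [hux]
        exact hxc
      · have huP := (hl u).1 hu
        apply hPc
        have h1 := hq u hu
        have h2 : s.pos u ≠ s.pos x := fun h' => hux (hinj huP.1 hxP.1 h')
        exact ⟨huP.1, by omega,
          hP v hv u huP.1 x hxP.1 huP.2.1 hxP.2.1 huP.2.2 hxP.2.2 hux⟩
    have hlast : ∀ y ∈ precNbrs G U s.pos v, (∀ a ∈ precNbrs G U s.pos v, s.pos a ≤ s.pos y) →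
        y = x := by
      intro y hy hmax
      have h1 := hmax x hxP
      have h2 := hq y ((hl y).2 hy)
      exact hinj hy.1 hxP.1 (by omega)
    have hsize := h.size_eq c hc
    simp only at hsize
    by_cases hk : T.size c = l.length
    · rw [if_pos hk]
      simp only [rd_bind_val, wr_bind_val, pure_val]
      refine h.join hinj hv hvi hc (fun u => ?_) (fun y hy hmax => ?_)
      · rw [← hl]
        refine ⟨fun hu => ?_, hlc u⟩
        have hperm' : l.Perm (T.iota c) :=
          (List.subperm_of_subset hln hlc).perm_of_length_le (by omega)
        exact hperm'.mem_iff.2 hu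
      · rw [hlast y hy hmax]
    · rw [if_neg hk]
      simp only [rd_bind_val, wr_bind_val, pure_val]
      have hex : ∃ y ∈ T.iota c, y ∉ l := by
        by_contra hcon
        push Not at hcon
        have h1 := (List.subperm_of_subset (h.nodup c hc) hcon).length_le
        have h2 := (List.subperm_of_subset hln hlc).length_le
        simp only at h1 h2
        omega
      obtain ⟨y, hyc, hyl⟩ := hex
      have hyU := h.iota_spec hc hyc
      have hyv : ¬ G.Adj y v := fun hadj => hyl ((hl y).2 ⟨hyU.1, by omega, hadj⟩)
      refine h.newNode (L := l) (q := some c) hinj hv hvi hl hln ?_ ?_ rfl ?_ ?_ ?_ ?_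
      · refine ⟨hv, Or.inr ⟨y, hyU.1, by omega, hyv, fun a ha hav hadj => ?_⟩⟩
        have hal : a ∈ l := (hl a).2 ⟨ha, hav, hadj⟩
        exact h.isClique hP hc hyc (hlc a hal) (fun h' => hyl (h' ▸ hal))
      · intro z hz
        rw [← Option.some_inj.1 hz]
        exact hc
      · exact fun u hu => ⟨c, rfl, hlc u hu⟩
      · intro a b
        by_cases ha : a = c
        · subst ha
          simp only [Function.update_self, List.mem_cons]
          tauto
        · rw [Function.update_of_ne ha]
          have : ¬ (c = a) := fun h' => ha h'.symm
          simp [this]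
      · intro a
        by_cases ha : a = c
        · subst ha
          rw [Function.update_self, List.nodup_cons]
          refine ⟨fun hmem => ?_, h.children_nodup _⟩
          have := (h.children _ _).1 hmem
          simp only at this
          rw [hpnone] at this
          simp at this
        · rw [Function.update_of_ne ha]
          exact h.children_nodup a
      · intro z hz hmax
        rw [hlast z hz hmax]
        exact ⟨y, hyc, by omega, hyv⟩

theorem sum_range_perm_le {s : Search n} (hs : Layout U U.length s) (f : Fin n → ℕ) :
    ∑ i ∈ Finset.Ico 0 U.length, f (s.perm i) ≤ ∑ v, f v := by
  classical
  rw [← Finset.sum_image (g := s.perm) (f := f)]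
  · exact Finset.sum_le_univ_sum_of_nonneg fun _ => Nat.zero_le _
  · intro a ha b hb hab
    simp only [Finset.coe_Ico, Set.mem_Ico] at ha hb
    rw [← (hs.perm_spec a ha.2).2, hab, (hs.perm_spec b hb.2).2]

variable [NeZero n]

theorem cliqueTree_spec (hG : G.IsChordalGraph) {adj : Fin n → List (Fin n)}
    (hadj : IsAdjList G adj) {D : ℕ} (hD : D = ∑ v, (adj v).length) (hU : U.Nodup) :
    (∃ pos home, Set.InjOn pos {u | u ∈ U} ∧ (∀ u ∈ U, pos u < U.length) ∧
      IsPEO G {u | u ∈ U} pos ∧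
      TreeInv G U pos U.length (cliqueTree adj D U fun v => decide (v ∈ U)).val home) ∧
    (cliqueTree adj D U fun v => decide (v ∈ U)).time ≤ 100 * (n + D) := by
  have hn : 0 < n := NeZero.pos n
  have hlen := length_le_of_nodup hU
  obtain ⟨h3, h4⟩ := lbfs_spec hadj hD hU (K := []) (by simp) (by simp) (by simp)
  have h1 := mark_time (n := n) []
  simp only [cliqueTree]
  rw [bind_val, bind_time, mark_eq, bind_val, bind_time]
  set s := (lbfs adj D U [] (fun v => decide (v ∈ U)) (fun v => decide (v ∈ []))).val with hs
  have hP := h3.isPEO hG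
  simp only [newArr_bind_val, newArr_bind_time]
  rw [bind_val, bind_time, len_val, bind_val, bind_time]
  have hl := len_time U
  have hstep : ∀ (i : ℕ) (t : CliqueTree n × (Fin n → ℕ)) (p : List (Fin n) × ℕ × ℕ),
      p.2.1 = p.1.length → (do
        let T := t.1
        let new ← op (s.perm i :: p.1)
        if p.2.1 = 0 then do
          let iota ← wr T.iota T.num new
          let size ← wr T.size T.num 1
          let home ← wr t.2 (s.perm i) T.num
          pure (⟨T.num + 1, iota, size, T.parent, T.children⟩, home)
        else do
          let x ← rd s.perm p.2.2
          let c ← rd t.2 x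
          let k ← rd T.size c
          if k = p.2.1 then do
            let K ← rd T.iota c
            let iota ← wr T.iota c (s.perm i :: K)
            let size ← wr T.size c (k + 1)
            let home ← wr t.2 (s.perm i) c
            pure ({ T with iota := iota, size := size }, home)
          else do
            let iota ← wr T.iota T.num new
            let size ← wr T.size T.num (p.2.1 + 1)
            let parent ← wr T.parent T.num (some c)
            let ch ← rd T.children c
            let children ← wr T.children c (T.num :: ch)
            let home ← wr t.2 (s.perm i) T.num
            pure (⟨T.num + 1, iota, size, parent, children⟩, home) :
          Timed (CliqueTree n × (Fin n → ℕ))) = treeStep s.perm (s.perm i) p.1 p.2.2 t := by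
    intro i t p hp
    rw [hp]
    rfl
  obtain ⟨h5, h6⟩ := forEach_range_spec (f := fun i (t : CliqueTree n × (Fin n → ℕ)) => do
      let v ← rd s.perm i
      let N ← rd adj v
      let p ← forEach N (([] : List (Fin n)), 0, 0) fun w p => do
        let u ← rd (fun v => decide (v ∈ U)) w
        let q ← rd s.pos w
        if u = true ∧ q < i then do
          let l ← op (w :: p.1)
          pure (l, p.2.1 + 1, max p.2.2 q)
        else pure p
      let T := t.1
      let new ← op (v :: p.1)
      if p.2.1 = 0 then do
        let iota ← wr T.iota T.num new
        let size ← wr T.size T.num 1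
        let home ← wr t.2 v T.num
        pure (⟨T.num + 1, iota, size, T.parent, T.children⟩, home)
      else do
        let x ← rd s.perm p.2.2
        let c ← rd t.2 x
        let k ← rd T.size c
        if k = p.2.1 then do
          let K ← rd T.iota c
          let iota ← wr T.iota c (v :: K)
          let size ← wr T.size c (k + 1)
          let home ← wr t.2 v c
          pure ({ T with iota := iota, size := size }, home)
        else do
          let iota ← wr T.iota T.num new
          let size ← wr T.size T.num (p.2.1 + 1)
          let parent ← wr T.parent T.num (some c)
          let ch ← rd T.children c
          let children ← wr T.children c (T.num :: ch)
          let home ← wr t.2 v T.num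
          pure (⟨T.num + 1, iota, size, parent, children⟩, home))
    (fun i t => TreeInv G U s.pos i t.1 t.2)
    -- Four steps per neighbour, ten for `treeStep`, and four for two reads, the exit from the inner
    -- loop and the outer iteration.
    (fun i _ => ∑ j ∈ Finset.Ico i U.length, (4 * (adj (s.perm j)).length + 14)) U.length (by
      intro i t hi ht
      obtain ⟨hvU, hvi⟩ := h3.perm_spec i hi
      obtain ⟨p1, p2, p3, p4, p5, p6⟩ :=
        prec_loop_spec (U := U) s.pos i (hadj (s.perm i)).1
      simp only [rd_bind_val, rd_bind_time]
      rw [bind_val, bind_time, hstep i t _ p3]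
      constructor
      · refine ht.treeStep h3.toLayout hP hi p1 (fun u => ?_) p4 p5
        rw [p2 u, (hadj (s.perm i)).2]
        simp only [precNbrs, Set.mem_ofPred_eq, hvi]
        rw [G.adj_comm]
        tauto
      · rw [Finset.sum_eq_sum_Ico_succ_bot hi]
        have := treeStep_time s.perm (s.perm i)
          (forEach (adj (s.perm i)) (([] : List (Fin n)), 0, 0) fun w p => do
            let u ← rd (fun v => decide (v ∈ U)) w
            let q ← rd s.pos w
            if u = true ∧ q < i then do
              let l ← op (w :: p.1)
              pure (l, p.2.1 + 1, max p.2.2 q)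
            else pure p).val.1
          (forEach (adj (s.perm i)) (([] : List (Fin n)), 0, 0) fun w p => do
            let u ← rd (fun v => decide (v ∈ U)) w
            let q ← rd s.pos w
            if u = true ∧ q < i then do
              let l ← op (w :: p.1)
              pure (l, p.2.1 + 1, max p.2.2 q)
            else pure p).val.2.2 t
        omega) (s := (⟨0, fun _ => [], fun _ => 0, fun _ => none, fun _ => []⟩, fun _ => 0))
    (treeInv_nil G U s.pos)
  refine ⟨⟨s.pos, _, h3.injOn, fun u hu => (h3.pos_spec u hu).1, hP, h5⟩, ?_⟩
  have h7 := sum_range_perm_le h3.toLayout fun v => 4 * (adj v).length + 14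
  have h8 : ∑ v : Fin n, (4 * (adj v).length + 14) = 4 * D + 14 * n := by
    rw [Finset.sum_add_distrib, ← Finset.mul_sum, hD]
    simp [mul_comm]
  simp only [pure_time]
  rw [h8] at h7
  rw [List.length_nil] at h1
  dsimp only at h6
  omega

end TreeProgram

end CliquePicking

namespace CliquePicking

open SimpleGraph

/-! ### Number and cost of the forbidden prefixes. -/

section Prefixes

variable {n : ℕ} {G : SimpleGraph (Fin n)} {U : List (Fin n)} {pos : Fin n → ℕ} {i : ℕ}
  {T : CliqueTree n} {home : Fin n → ℕ}

/-- The number of vertices of `ι(v)` that were assigned to a clique with number at most `y`. -/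
def homeCount (T : CliqueTree n) (home : Fin n → ℕ) (v y : ℕ) : ℕ :=
  ((T.iota v).filter fun u => home u ≤ y).length

theorem homeCount_mono (T : CliqueTree n) (home : Fin n → ℕ) (v : ℕ) {x y : ℕ} (hxy : x ≤ y) :
    homeCount T home v x ≤ homeCount T home v y := by
  refine (List.monotone_filter_right _ fun u hu => ?_).length_le
  simp only [decide_eq_true_eq] at hu ⊢
  omega

theorem stamp_loop_val (L : List (Fin n)) (st : Fin n → ℕ) (k : ℕ) (w : Fin n) :
    (w ∈ L → (forEach L st fun w st => wr st w k).val w = k) ∧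
    (w ∉ L → (forEach L st fun w st => wr st w k).val w = st w) := by
  refine forEach_inv (f := fun w (st : Fin n → ℕ) => wr st w k)
    (fun done st' => (w ∈ done → st' w = k) ∧ (w ∉ done → st' w = st w)) ?_ (by simp)
  rintro done b rest st' - ⟨h1, h2⟩
  simp only [wr_val, List.mem_append, List.mem_singleton, not_or]
  by_cases hw : w = b
  · subst hw
    simp
  · rw [Function.update_of_ne hw]
    simp only [hw, or_false, not_false_eq_true, and_true]
    exact ⟨h1, h2⟩

theorem sep_loop_val (L : List (Fin n)) (stamp : Fin n → ℕ) (inKv : Fin n → Bool) (k : ℕ) :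
    let r := forEach L (0, true) fun w a => do
      let b ← rd stamp w
      let c ← rd inKv w
      pure (if b = k then (a.1 + 1, a.2 && c) else a)
    r.val.1 = (L.filter fun w => stamp w = k).length ∧
      (r.val.2 = true ↔ ∀ w ∈ L, stamp w = k → inKv w = true) := by
  refine forEach_inv (f := fun w (a : ℕ × Bool) => do
      let b ← rd stamp w
      let c ← rd inKv w
      pure (if b = k then (a.1 + 1, a.2 && c) else a))
    (fun done a => a.1 = (done.filter fun w => stamp w = k).length ∧
      (a.2 = true ↔ ∀ w ∈ done, stamp w = k → inKv w = true)) ?_ (by simp)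
  rintro done b rest ⟨a, t⟩ - ⟨h1, h2⟩
  simp only at h1 h2
  simp only [rd_bind_val, pure_val]
  by_cases hb : stamp b = k
  · rw [if_pos hb]
    constructor
    · simp [List.filter_append, hb, h1]
    · simp only [Bool.and_eq_true, h2, List.mem_append, List.mem_singleton]
      constructor
      · rintro ⟨h3, h4⟩ w (hw | rfl) hk
        · exact h3 w hw hk
        · exact h4
      · intro h3
        exact ⟨fun w hw hk => h3 w (Or.inl hw) hk, h3 b (Or.inr rfl) hb⟩
  · rw [if_neg hb]
    constructor
    · simp [List.filter_append, hb, h1]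
    · simp only [h2, List.mem_append, List.mem_singleton]
      constructor
      · rintro h3 w (hw | rfl) hk
        · exact h3 w hw hk
        · exact absurd hk hb
      · exact fun h3 w hw hk => h3 w (Or.inl hw) hk

/-- The state of the walk from `v` to the root. -/
structure WalkInv (T : CliqueTree n) (home : Fin n → ℕ) (v : ℕ)
    (r : ℕ × Option ℕ × (Fin n → ℕ) × List ℕ) : Prop where
  lt : r.1 < T.num
  parent : r.2.1 = T.parent r.1
  stamp : ∀ w, r.2.2.1 w = 0 ∨ r.1 < r.2.2.1 w
  climb : ∀ u ∈ T.iota v, home u ≤ r.1 → u ∈ T.iota r.1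
  sorted : r.2.2.2.Pairwise (· < ·)
  bound : ∀ a ∈ r.2.2.2, homeCount T home v r.1 ≤ a ∧ a ≤ (T.iota v).length

/-- The potential of the walk at the node `x`. -/
def walkPotential (T : CliqueTree n) (x : ℕ) : ℕ :=
  ∑ z ∈ Finset.range x, (5 * (T.iota z).length + 7) + 3 * (T.iota x).length

theorem length_le_of_sorted {l : List ℕ} (hl : l.Pairwise (· < ·)) {b : ℕ} (hb : ∀ a ∈ l, a ≤ b) :
    l.length ≤ b + 1 := by
  have hnd : l.Nodup := hl.imp fun h => h.ne
  have := (List.subperm_of_subset hnd (l₂ := List.range (b + 1)) fun a ha => by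
    have := hb a ha
    rw [List.mem_range]
    omega).length_le
  simpa using this

/-- If `ι(x) ∩ ι(y)` is contained in `ι(v)`, it consists exactly of the vertices of `ι(v)` with home
at most `y`. Numbers decrease towards the root, so the sizes found decrease weakly, and skipping
repetitions leaves at most `|ι(v)| + 1` of them. The nodes on the path are distinct, which bounds
the time by the sum of all clique sizes. -/
theorem forbiddenPrefixes_spec (h : TreeInv G U pos i T home) {v : ℕ} (hv : v < T.num) :
    (forbiddenPrefixes T v).val.length ≤ (T.iota v).length + 1 ∧
    (forbiddenPrefixes T v).time ≤
      2 * n + 7 + 12 * ∑ x ∈ Finset.range T.num, (T.iota x).length := by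
  simp only [forbiddenPrefixes, rd_bind_val, rd_bind_time]
  rw [bind_val, bind_time, mark_eq]
  simp only [newArr_bind_val, newArr_bind_time, rd_bind_val, rd_bind_time]
  rw [bind_val, bind_time]
  simp only [pure_val, pure_time]
  obtain ⟨h1, h2⟩ := whileDo_spec (cond := fun r : ℕ × Option ℕ × (Fin n → ℕ) × List ℕ =>
      r.2.1.isSome) (body := fun r => match r.2.1 with
      | none => pure r
      | some y => do
        let Kx ← rd T.iota r.1
        let Ky ← rd T.iota y
        let stamp ← forEach Ky r.2.2.1 fun w st => wr st w (y + 1)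
        let sep ← forEach Kx (0, true) fun w a => do
          let b ← rd stamp w
          let c ← rd (fun w => decide (w ∈ T.iota v)) w
          pure (if b = y + 1 then (a.1 + 1, a.2 && c) else a)
        let acc ← op (if sep.2 = true ∧ r.2.2.2.head? ≠ some sep.1 then sep.1 :: r.2.2.2
          else r.2.2.2)
        let p ← rd T.parent y
        pure (y, p, stamp, acc)) (WalkInv T home v) (fun r => walkPotential T r.1) (by
      rintro ⟨x, p, st, acc⟩ hs hI
      cases p with
      | none => simp at hs
      | some y =>
        obtain ⟨hx, hpar, hst, hclimb, hsort, hbound⟩ := hI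
        simp only at hx hpar hst hclimb hsort hbound
        obtain ⟨-, hyx⟩ := h.parent_lt x y hpar.symm
        have hyn : y < T.num := by omega
        simp only [rd_bind_val, rd_bind_time]
        rw [bind_val, bind_time]
        have hstv := stamp_loop_val (T.iota y) st (y + 1)
        have hstt := forEach_time_le_const (f := fun w (st : Fin n → ℕ) => wr st w (y + 1)) 1
          (T.iota y) (fun _ _ _ => by simp) st
        generalize (forEach (T.iota y) st fun w st => wr st w (y + 1)).val = st' at hstv ⊢
        rw [bind_val, bind_time]
        obtain ⟨hsep1, hsep2⟩ := sep_loop_val (T.iota x) st' (fun w => decide (w ∈ T.iota v)) (y + 1)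
        have hsept := forEach_time_le_const (f := fun w (a : ℕ × Bool) => do
          let b ← rd st' w
          let c ← rd (fun w => decide (w ∈ T.iota v)) w
          pure (if b = y + 1 then (a.1 + 1, a.2 && c) else a)) 2 (T.iota x)
          (fun _ _ _ => by simp) (0, true)
        generalize (forEach (T.iota x) (0, true) fun w (a : ℕ × Bool) => do
          let b ← rd st' w
          let c ← rd (fun w => decide (w ∈ T.iota v)) w
          pure (if b = y + 1 then (a.1 + 1, a.2 && c) else a)).val = sep at hsep1 hsep2 ⊢
        simp only [op_bind_val, op_bind_time, rd_bind_val, rd_bind_time, pure_val, pure_time]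
        -- Old stamps are 0 or larger than `x`, and `y < x`, so none of them can be mistaken for `y
        -- + 1`.
        have hst' : ∀ w, st' w = y + 1 ↔ w ∈ T.iota y := by
          intro w
          by_cases hw : w ∈ T.iota y
          · simp [hw, (hstv w).1 hw]
          · rw [(hstv w).2 hw]
            have := hst w
            simp only [hw, iff_false]
            omega
        -- A vertex of `ι(x)` whose home is not `x` also lies in the clique of the parent.
        have hup : ∀ u ∈ T.iota v, home u ≤ y → u ∈ T.iota x ∧ u ∈ T.iota y := by
          intro u hu huy
          have hux := hclimb u hu (by omega)
          refine ⟨hux, ?_⟩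
          rcases h.home_parent x hx u hux with h3 | ⟨z, hz, h3⟩
          · omega
          · rw [← hpar] at hz
            rw [Option.some_inj.1 hz]
            exact h3
        have hcount : sep.2 = true → sep.1 = homeCount T home v y := by
          intro ht
          rw [hsep2] at ht
          rw [hsep1]
          unfold homeCount
          apply List.Perm.length_eq
          rw [List.perm_ext_iff_of_nodup ((h.nodup x hx).filter _) ((h.nodup v hv).filter _)]
          intro u
          simp only [List.mem_filter, decide_eq_true_eq, hst']
          constructor
          · rintro ⟨h3, h4⟩
            refine ⟨by simpa using ht u h3 ((hst' u).2 h4), h.home_le y hyn u h4⟩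
          · rintro ⟨h3, h4⟩
            exact hup u h3 h4
        have hmono : homeCount T home v y ≤ homeCount T home v x :=
          homeCount_mono T home v hyx.le
        refine ⟨⟨hyn, rfl, ?_, fun u hu huy => (hup u hu huy).2, ?_, ?_⟩, ?_⟩
        · intro w
          dsimp only
          by_cases hw : w ∈ T.iota y
          · rw [(hstv w).1 hw]
            omega
          · rw [(hstv w).2 hw]
            have := hst w
            omega
        · dsimp only
          split_ifs with hc
          · rw [List.pairwise_cons]
            refine ⟨fun a ha => ?_, hsort⟩
            have h3 := hcount hc.1
            cases acc with
            | nil => simp at ha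
            | cons b acc =>
              have hb := (hbound b (by simp)).1
              have hne : b ≠ sep.1 := by simpa using hc.2
              rcases List.mem_cons.1 ha with rfl | ha
              · omega
              · have := (List.pairwise_cons.1 hsort).1 a ha
                omega
          · exact hsort
        · intro a ha
          dsimp only at ha ⊢
          have hold : a ∈ acc → homeCount T home v y ≤ a ∧ a ≤ (T.iota v).length := fun ha => by
            have := hbound a ha
            omega
          split_ifs at ha with hc
          · rcases List.mem_cons.1 ha with rfl | ha
            · rw [hcount hc.1]
              exact ⟨le_rfl, List.length_filter_le _ _⟩
            · exact hold ha
          · exact hold ha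
        · have hsum : ∑ z ∈ Finset.range (y + 1), (5 * (T.iota z).length + 7) ≤
              ∑ z ∈ Finset.range x, (5 * (T.iota z).length + 7) :=
            Finset.sum_le_sum_of_subset (by
              rw [Finset.range_subset_range]
              omega)
          rw [Finset.sum_range_succ] at hsum
          unfold walkPotential
          omega) n (s := (v, T.parent v, fun _ => 0, []))
      ⟨hv, rfl, by simp, fun u hu _ => hu, by simp, by simp⟩
  have hlv : ∑ z ∈ Finset.range v, (5 * (T.iota z).length + 7) + (5 * (T.iota v).length + 7) ≤
      12 * ∑ x ∈ Finset.range T.num, (T.iota x).length := by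
    rw [← Finset.sum_range_succ (fun z => 5 * (T.iota z).length + 7), Finset.mul_sum]
    refine le_trans (Finset.sum_le_sum_of_subset (t := Finset.range T.num) (by
      rw [Finset.range_subset_range]
      omega)) (Finset.sum_le_sum fun x hx => ?_)
    rw [Finset.mem_range] at hx
    obtain ⟨t, -, -, -, hmem⟩ := h.last x hx
    have : 0 < (T.iota x).length := List.length_pos_of_mem ((hmem t).2 (Or.inl rfl))
    omega
  refine ⟨length_le_of_sorted h1.sorted fun a ha => (h1.bound a ha).2, ?_⟩
  have hm := mark_time (T.iota v)
  unfold walkPotential at h2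
  dsimp only at h2 ⊢
  have key := le_trans (Nat.le_add_right _ _) h2
  refine le_trans (Nat.add_le_add_left (Nat.add_le_add_left (Nat.add_le_add_left
    (Nat.add_le_add_left key _) _) _) _) ?_
  omega

end Prefixes

end CliquePicking

namespace CliquePicking

/-! ### The memo table -/

section Trie

variable {n : ℕ}

/-- The node at the end of the path from `x` whose edges are labelled by the given list. -/
def trieNode (m : Memo n) : ℕ → List (Fin n) → Option ℕ
  | x, [] => some x
  | x, v :: l => if m.child x v = 0 then none else trieNode m (m.child x v) l

/-- A value is stored for the key. -/
def Stored (m : Memo n) (k : List (Fin n)) : Prop := (lookup m 0 k).val.isSome = true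

theorem lookup_val (m : Memo n) (x : ℕ) (l : List (Fin n)) :
    (lookup m x l).val = (trieNode m x l).bind m.value := by
  induction l generalizing x with
  | nil => rfl
  | cons v l ih =>
    simp only [lookup, trieNode, rd_bind_val]
    split_ifs with h
    · rfl
    · exact ih _

theorem lookup_time (m : Memo n) (x : ℕ) (l : List (Fin n)) :
    (lookup m x l).time ≤ 2 * l.length + 1 := by
  induction l generalizing x with
  | nil => simp [lookup]
  | cons v l ih =>
    simp only [lookup, rd_bind_time, List.length_cons]
    split_ifs with h
    · simp only [pure_time]
      omega
    · have := ih (m.child x v)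
      omega

/-- A new node costs `n + 1` steps for its row and five for reads and writes. Hence a new key may
cost about `n²` steps; `sq_card_le` absorbs them. -/
theorem insert_time (val : ℕ) (m : Memo n) (x : ℕ) (l : List (Fin n)) :
    (insert val m x l).time ≤ (n + 6) * l.length + 1 := by
  induction l generalizing m x with
  | nil => simp [insert]
  | cons v l ih =>
    simp only [insert, rd_bind_time, List.length_cons, Nat.mul_succ]
    split_ifs with h
    · simp only [newArr_bind_time, wr_bind_time]
      have := ih { m with
        next := m.next + 1
        child := Function.update (Function.update m.child x
          (Function.update (m.child x) v m.next)) m.next fun _ => 0 } m.next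
      omega
    · have := ih m (m.child x v)
      omega

theorem trieNode_append (m : Memo n) {x y : ℕ} {l : List (Fin n)} (h : trieNode m x l = some y)
    (l' : List (Fin n)) : trieNode m x (l ++ l') = trieNode m y l' := by
  induction l generalizing x with
  | nil =>
    cases h
    rfl
  | cons v l ih =>
    simp only [trieNode, List.cons_append] at h ⊢
    split_ifs at h ⊢ with h0
    exact ih h

theorem trieNode_mono {m m' : Memo n} (h : ∀ x v, m.child x v ≠ 0 → m'.child x v = m.child x v)
    {x y : ℕ} {l : List (Fin n)} (hy : trieNode m x l = some y) : trieNode m' x l = some y := by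
  induction l generalizing x with
  | nil => exact hy
  | cons v l ih =>
    simp only [trieNode] at hy ⊢
    split_ifs at hy with h0
    rw [h x v h0, if_neg h0]
    exact ih hy

/-- The memo table is a trie, in which `key x` is the list of the labels on the path to `x`. -/
structure IsTrie (m : Memo n) (key : ℕ → List (Fin n)) : Prop where
  pos : 0 < m.next
  root : key 0 = []
  child : ∀ x v, m.child x v ≠ 0 → key (m.child x v) = key x ++ [v] ∧ m.child x v < m.next
  fresh_child : ∀ x v, m.next ≤ x → m.child x v = 0
  fresh_value : ∀ x, m.next ≤ x → m.value x = none
  reach : ∀ x, x < m.next → trieNode m 0 (key x) = some x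

theorem IsTrie.key_eq {m : Memo n} {key : ℕ → List (Fin n)} (h : IsTrie m key) {x y : ℕ}
    {l : List (Fin n)} (hx : x < m.next) (hy : trieNode m x l = some y) :
    key y = key x ++ l ∧ y < m.next := by
  induction l generalizing x with
  | nil =>
    cases hy
    simpa using hx
  | cons v l ih =>
    simp only [trieNode] at hy
    split_ifs at hy with h0
    obtain ⟨h1, h2⟩ := h.child x v h0
    obtain ⟨h3, h4⟩ := ih h2 hy
    exact ⟨by rw [h3, h1]; simp, h4⟩

/-- Nodes and keys determine each other, so stored keys can be read off from the values at the
nodes, without following paths. -/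
theorem IsTrie.stored_iff {m : Memo n} {key : ℕ → List (Fin n)} (h : IsTrie m key)
    (k : List (Fin n)) :
    Stored m k ↔ ∃ x, x < m.next ∧ key x = k ∧ (m.value x).isSome = true := by
  unfold Stored
  rw [lookup_val]
  constructor
  · intro hs
    cases hx : trieNode m 0 k with
    | none => simp [hx] at hs
    | some x =>
      obtain ⟨h1, h2⟩ := h.key_eq h.pos hx
      refine ⟨x, h2, by rw [h1, h.root, List.nil_append], ?_⟩
      simpa [hx] using hs
  · rintro ⟨x, hx, rfl, hs⟩
    simpa [h.reach x hx] using hs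

theorem isTrie_emptyMemo : IsTrie (emptyMemo : Timed (Memo n)).val fun _ => [] where
  pos := Nat.one_pos
  root := rfl
  child := fun x v h => absurd rfl h
  fresh_child := fun _ _ _ => rfl
  fresh_value := fun _ _ => rfl
  reach := fun x hx => by
    have : x = 0 := Nat.lt_one_iff.1 hx
    rw [this]
    rfl

/-- A new node, the child of `x` along an edge labelled `v`. -/
theorem IsTrie.addNode {m : Memo n} {key : ℕ → List (Fin n)} (h : IsTrie m key) {x : ℕ}
    {v : Fin n} (hx : x < m.next) (hv : m.child x v = 0) :
    IsTrie { m with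
      next := m.next + 1
      child := Function.update (Function.update m.child x
        (Function.update (m.child x) v m.next)) m.next fun _ => 0 }
      (Function.update key m.next (key x ++ [v])) := by
  set m' : Memo n := { m with
      next := m.next + 1
      child := Function.update (Function.update m.child x
        (Function.update (m.child x) v m.next)) m.next fun _ => 0 } with hm'
  have hch : ∀ y w, m'.child y w = if y = x ∧ w = v then m.next else m.child y w := by
    intro y w
    simp only [hm']
    by_cases hy : y = m.next
    · subst hy
      rw [Function.update_self, if_neg (by omega), h.fresh_child _ _ le_rfl]
    · rw [Function.update_of_ne hy]
      by_cases hyx : y = x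
      · subst hyx
        rw [Function.update_self]
        by_cases hw : w = v
        · subst hw
          simp
        · simp [hw]
      · rw [Function.update_of_ne hyx, if_neg (by tauto)]
  have hmono : ∀ y w, m.child y w ≠ 0 → m'.child y w = m.child y w := by
    intro y w hy
    rw [hch, if_neg]
    rintro ⟨rfl, rfl⟩
    exact hy hv
  have hkey : ∀ y, y < m.next → Function.update key m.next (key x ++ [v]) y = key y :=
    fun y hy => Function.update_of_ne (by omega) _ _
  refine ⟨Nat.succ_pos _, by rw [hkey 0 h.pos, h.root], ?_, ?_, ?_, ?_⟩
  · intro y w hy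
    rw [hch] at hy ⊢
    split_ifs at hy ⊢ with hc
    · rw [hc.1, hc.2, hkey x hx, Function.update_self]
      exact ⟨rfl, Nat.lt_succ_self _⟩
    · obtain ⟨h1, h2⟩ := h.child y w hy
      have hy' : y < m.next := by
        by_contra hlt
        exact hy (h.fresh_child y w (by omega))
      rw [hkey _ h2, hkey y hy', h1]
      exact ⟨rfl, Nat.lt_succ_of_lt h2⟩
  · intro y w hy
    have hy : m.next + 1 ≤ y := hy
    rw [hch, if_neg (by omega), h.fresh_child y w (by omega)]
  · intro y hy
    have hy : m.next + 1 ≤ y := hy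
    exact h.fresh_value y (by omega)
  · intro y hy
    rcases Nat.lt_succ_iff_lt_or_eq.1 hy with hy | rfl
    · rw [hkey y hy]
      exact trieNode_mono hmono (h.reach y hy)
    · rw [Function.update_self, trieNode_append m' (trieNode_mono hmono (h.reach x hx))]
      have h1 : m'.child x v = m.next := by rw [hch, if_pos ⟨rfl, rfl⟩]
      simp only [trieNode]
      -- The pointer 0 means that there is no child; the number of a new node is positive because
      -- the root is already present.
      rw [h1, if_neg (by have := h.pos; omega)]

/-- Nodes created on the way have no value, so the only key that can become stored is the complete
one. -/
theorem IsTrie.insert {m : Memo n} {key : ℕ → List (Fin n)} (h : IsTrie m key) (val : ℕ) {x : ℕ}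
    (hx : x < m.next) (l : List (Fin n)) :
    ∃ key', IsTrie (insert val m x l).val key' ∧
      ∀ k, Stored (CliquePicking.insert val m x l).val k ↔ k = key x ++ l ∨ Stored m k := by
  induction l generalizing m key x with
  | nil =>
    have hnode : ∀ (y : ℕ) (k : List (Fin n)),
        trieNode { m with value := Function.update m.value x (some val) } y k = trieNode m y k := by
      intro y k
      induction k generalizing y with
      | nil => rfl
      | cons v k ih =>
        simp only [trieNode]
        split_ifs
        · rfl
        · exact ih _
    have h' : IsTrie { m with value := Function.update m.value x (some val) } key := by
      refine ⟨h.pos, h.root, h.child, h.fresh_child, fun y hy => ?_, fun y hy => ?_⟩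
      · have hy : m.next ≤ y := hy
        simp only
        rw [Function.update_of_ne (by omega)]
        exact h.fresh_value y hy
      · rw [hnode]
        exact h.reach y hy
    refine ⟨key, h', fun k => ?_⟩
    change Stored { m with value := Function.update m.value x (some val) } k ↔ _
    rw [h'.stored_iff, h.stored_iff, List.append_nil]
    constructor
    · rintro ⟨y, hy, rfl, hs⟩
      by_cases hyx : y = x
      · exact Or.inl (by rw [hyx])
      · simp only [Function.update_of_ne hyx] at hs
        exact Or.inr ⟨y, hy, rfl, hs⟩
    · rintro (rfl | ⟨y, hy, rfl, hs⟩)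
      · exact ⟨x, hx, rfl, by simp⟩
      · refine ⟨y, hy, rfl, ?_⟩
        by_cases hyx : y = x
        · simp [hyx]
        · simpa only [Function.update_of_ne hyx] using hs
  | cons v l ih =>
    simp only [CliquePicking.insert, rd_bind_val]
    split_ifs with h0
    · simp only [newArr_bind_val, wr_bind_val]
      have h1 := h.addNode hx h0
      obtain ⟨key', h2, h3⟩ := ih h1 (x := m.next) (Nat.lt_succ_self _)
      refine ⟨key', h2, fun k => ?_⟩
      rw [h3 k, Function.update_self, List.append_assoc, List.singleton_append, h1.stored_iff,
        h.stored_iff]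
      refine or_congr Iff.rfl ⟨?_, ?_⟩
      · rintro ⟨y, hy, hk, hs⟩
        rcases Nat.lt_succ_iff_lt_or_eq.1 hy with hy | rfl
        · exact ⟨y, hy, by rwa [Function.update_of_ne (by omega)] at hk, hs⟩
        · simp [h.fresh_value _ le_rfl] at hs
      · rintro ⟨y, hy, hk, hs⟩
        exact ⟨y, Nat.lt_succ_of_lt hy, by rwa [Function.update_of_ne (by omega)], hs⟩
    · obtain ⟨h1, h2⟩ := h.child x v h0
      obtain ⟨key', h3, h4⟩ := ih h h2
      refine ⟨key', h3, fun k => ?_⟩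
      rw [h4 k, h1, List.append_assoc, List.singleton_append]

end Trie

end CliquePicking

namespace CliquePicking

open SimpleGraph

/-! ### The recursion -/

section Amortized

variable {β γ σ : Type}

/-- Invariant `I` for a loop in which the time for the element `b` is at most `g b`, apart from the
growth of `μ`. -/
theorem forEach_amortized {f : β → σ → Timed σ} (I : σ → Prop) (μ : σ → ℕ) (g : β → ℕ)
    (l : List β) (h : ∀ b ∈ l, ∀ s, I s →
      I (f b s).val ∧ (f b s).time + μ s ≤ μ (f b s).val + g b) {s : σ} (h0 : I s) :
    I (forEach l s f).val ∧
      (forEach l s f).time + μ s ≤ μ (forEach l s f).val + (l.map fun b => g b + 1).sum + 1 := by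
  induction l generalizing s with
  | nil => exact ⟨h0, by simp [Nat.add_comm]⟩
  | cons b l ih =>
    obtain ⟨h1, h2⟩ := h b List.mem_cons_self s h0
    obtain ⟨h3, h4⟩ := ih (fun c hc => h c (List.mem_cons_of_mem b hc)) h1
    rw [forEach_cons_val, forEach_cons_time, List.map_cons, List.sum_cons]
    exact ⟨h3, by omega⟩

/-- Invariant `I` for a while loop in which each round takes time at most `c`, apart from the growth
of `μ`, and uses up a unit of the resource `ρ`. The invariant and the resource may depend on
an auxiliary value which is not part of the state. -/
theorem whileDo_amortized {cond : σ → Bool} {body : σ → Timed σ} (I : γ → σ → Prop) (μ : σ → ℕ)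
    (ρ : γ → ℕ) (c : ℕ)
    (h : ∀ g s, cond s = true → I g s → ∃ g', I g' (body s).val ∧ ρ g' + 1 ≤ ρ g ∧
      (body s).time + μ s ≤ μ (body s).val + c) (k : ℕ) {g : γ} {s : σ} (h0 : I g s) :
    (∃ g', I g' (whileDo k cond body s).val) ∧
      (whileDo k cond body s).time + μ s ≤
        μ (whileDo k cond body s).val + (c + 1) * ρ g + 1 := by
  induction k generalizing g s with
  | zero => exact ⟨⟨g, h0⟩, by simp only [whileDo, op_time, op_val]; omega⟩
  | succ k ih =>
    by_cases hc : cond s = true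
    · obtain ⟨g', h1, h2, h3⟩ := h g s hc h0
      obtain ⟨h4, h5⟩ := ih h1
      have h6 : (c + 1) * (ρ g' + 1) ≤ (c + 1) * ρ g := Nat.mul_le_mul_left _ h2
      rw [Nat.mul_succ] at h6
      simp only [whileDo, hc, if_true, bind_val, bind_time, op_val, op_time]
      exact ⟨h4, by omega⟩
    · simp only [whileDo, hc]
      exact ⟨⟨g, h0⟩, by simp only [Bool.false_eq_true, if_false, op_time, op_val]; omega⟩

end Amortized

/-! ### Amortized cost of the memoized recursion. -/

section Count

variable {n : ℕ} {G : SimpleGraph (Fin n)} {U : List (Fin n)}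

/-- The increasing list of the elements of a set of vertices. -/
noncomputable def keyOf (F : Set (Fin n)) : List (Fin n) := by
  classical exact (List.finRange n).filter fun v => decide (v ∈ F)

theorem keyOf_filter (p : Fin n → Bool) :
    keyOf {u | u ∈ (List.finRange n).filter p} = (List.finRange n).filter p := by
  unfold keyOf
  refine List.filter_congr fun v _ => ?_
  simp

/-- The number of subproblems whose value is stored. -/
noncomputable def storedCount (G : SimpleGraph (Fin n)) (m : Memo n) : ℕ :=
  {F | IsSubproblem G F ∧ Stored m (keyOf F)}.ncard

/-- The memo table `m'` arises from `m` by storing values for keys of length less than `ℓ`. -/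
structure Grows (ℓ : ℕ) (m m' : Memo n) : Prop where
  trie : ∃ key, IsTrie m' key
  mono : ∀ k, Stored m k → Stored m' k
  new : ∀ k, Stored m' k → Stored m k ∨ k.length < ℓ

theorem Grows.refl {m : Memo n} (ℓ : ℕ) (h : ∃ key, IsTrie m key) : Grows ℓ m m :=
  ⟨h, fun _ hk => hk, fun _ hk => Or.inl hk⟩

theorem Grows.trans {ℓ ℓ' : ℕ} {m m' m'' : Memo n} (h : Grows ℓ m m') (h' : Grows ℓ' m' m'')
    (hle : ℓ' ≤ ℓ) : Grows ℓ m m'' := by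
  refine ⟨h'.trie, fun k hk => h'.mono k (h.mono k hk), fun k hk => ?_⟩
  rcases h'.new k hk with h1 | h1
  · exact h.new k h1
  · exact Or.inr (by omega)

/-- Storing a value for a new subproblem. -/
theorem grows_insert {m : Memo n} {p : Fin n → Bool} (hU : U = (List.finRange n).filter p)
    (hUs : IsSubproblem G {u | u ∈ U}) (hm : ∃ key, IsTrie m key) (hmU : ¬ Stored m U) (a : ℕ) :
    Grows (U.length + 1) m (insert a m 0 U).val ∧
      storedCount G m + 1 ≤ storedCount G (insert a m 0 U).val := by
  obtain ⟨key, hkey⟩ := hm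
  obtain ⟨key', h1, h2⟩ := hkey.insert a hkey.pos U
  rw [hkey.root, List.nil_append] at h2
  refine ⟨⟨⟨key', h1⟩, fun k hk => (h2 k).2 (Or.inr hk), fun k hk => ?_⟩, ?_⟩
  · rcases (h2 k).1 hk with rfl | h3
    · exact Or.inr (Nat.lt_succ_self _)
    · exact Or.inl h3
  · have hk : keyOf {u | u ∈ U} = U := by rw [hU, keyOf_filter]
    refine Set.ncard_lt_ncard (Set.ssubset_iff_exists.2
      ⟨fun F hF => ⟨hF.1, (h2 _).2 (Or.inr hF.2)⟩, {u | u ∈ U}, ⟨hUs, ?_⟩, fun hF => hmU ?_⟩)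
      (Set.toFinite _)
    · rw [hk]
      exact (h2 U).2 (Or.inl rfl)
    · have := hF.2
      rwa [hk] at this

/-- What is known about a recursive call for a subproblem with fewer than `ℓ` vertices. -/
def CountSpec (G : SimpleGraph (Fin n)) (A ℓ : ℕ)
    (f : List (Fin n) → Memo n → Timed (ℕ × Memo n)) : Prop :=
  ∀ H m, (∃ p : Fin n → Bool, H = (List.finRange n).filter p) → IsSubproblem G {u | u ∈ H} →
    H.length < ℓ → (∃ key, IsTrie m key) → Grows (H.length + 1) m (f H m).val.2 ∧
      (f H m).time + A * storedCount G m ≤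
        A * storedCount G (f H m).val.2 + (2 * H.length + 2)

/-- The treatment of one node of the clique tree. -/
def countNode [NeZero n] (adj : Fin n → List (Fin n)) (D : ℕ) (fact : ℕ → ℕ) (U : List (Fin n))
    (inU : Fin n → Bool) (T : CliqueTree n) (f : List (Fin n) → Memo n → Timed (ℕ × Memo n))
    (r : List ℕ × ℕ × Memo n) : Timed (List ℕ × ℕ × Memo n) :=
  match r.1 with
  | [] => pure r
  | v :: Q => do
    let ch ← rd T.children v
    let Q ← push Q ch
    let K ← rd T.iota v
    let C ← subproblems adj D U K inU
    let p ← forEach C (1, r.2.2) fun H p => do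
      let a ← f H p.2
      let prod ← op (p.1 * a.1)
      pure (prod, a.2)
    let X ← forbiddenPrefixes T v
    let k ← rd T.size v
    let f ← phi fact k X
    let g ← op (f * p.1)
    let sum ← op (r.2.1 + g)
    pure (Q, sum, p.2)

theorem count_succ [NeZero n] (adj : Fin n → List (Fin n)) (D : ℕ) (fact : ℕ → ℕ) (depth : ℕ)
    (U : List (Fin n)) (memo : Memo n) :
    count adj D fact (depth + 1) U memo = (do
      let found ← lookup memo 0 U
      match found with
      | some a => pure (a, memo)
      | none => do
        let inU ← mark U
        let T ← cliqueTree adj D U inU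
        let Q ← op [0]
        let r ← whileDo n (fun r : List ℕ × ℕ × Memo n => !r.1.isEmpty)
          (countNode adj D fact U inU T (count adj D fact depth)) (Q, 0, memo)
        let memo ← insert r.2.1 r.2.2 0 U
        pure (r.2.1, memo)) := rfl

/-- The nodes in `L` have been treated, those in `Q` are waiting. -/
structure QueueInv (T : CliqueTree n) (L Q : List ℕ) : Prop where
  nodup : (L ++ Q).Nodup
  lt : ∀ x ∈ L ++ Q, x < T.num
  parent : ∀ x ∈ L ++ Q, x = 0 ∨ ∃ y ∈ L, T.parent x = some y

/-- A child of `v` cannot be in the queue or treated already: its parent `v` would then have been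
treated earlier. It is not the root either, since parents have smaller numbers. -/
theorem QueueInv.next {T : CliqueTree n} {pos home : Fin n → ℕ} {i : ℕ}
    (hT : TreeInv G U pos i T home) {L Q : List ℕ} {v : ℕ} (h : QueueInv T L (v :: Q)) :
    QueueInv T (L ++ [v]) (Q ++ T.children v) := by
  have hassoc : L ++ [v] ++ (Q ++ T.children v) = L ++ v :: Q ++ T.children v := by simp
  refine ⟨?_, ?_, ?_⟩
  · rw [hassoc]
    refine List.nodup_append'.2 ⟨h.nodup, hT.children_nodup v, ?_⟩
    intro x hx hxv
    have hp := (hT.children v x).1 hxv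
    rcases h.parent x hx with rfl | ⟨y, hy, hyp⟩
    · have := (hT.parent_lt 0 v hp).2
      omega
    · rw [hp, Option.some.injEq] at hyp
      subst hyp
      exact (List.nodup_append'.1 h.nodup).2.2 hy List.mem_cons_self
  · rw [hassoc]
    intro x hx
    rcases List.mem_append.1 hx with hx | hx
    · exact h.lt x hx
    · exact (hT.parent_lt x v ((hT.children v x).1 hx)).1
  · rw [hassoc]
    intro x hx
    rcases List.mem_append.1 hx with hx | hx
    · rcases h.parent x hx with h0 | ⟨y, hy, hyp⟩
      · exact Or.inl h0
      · exact Or.inr ⟨y, List.mem_append_left _ hy, hyp⟩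
    · exact Or.inr ⟨v, by simp, (hT.children v x).1 hx⟩

theorem QueueInv.length_le {T : CliqueTree n} {L Q : List ℕ} (h : QueueInv T L Q) :
    (L ++ Q).length ≤ T.num := by
  have := (h.nodup.subperm (l₂ := List.range T.num)
    fun x hx => List.mem_range.2 (h.lt x hx)).length_le
  simpa using this

theorem sum_map_length_add (C : List (List (Fin n))) (c : ℕ) :
    (C.map fun H => 2 * H.length + c).sum = 2 * (C.map List.length).sum + c * C.length := by
  induction C with
  | nil => simp
  | cons H C ih =>
    simp only [List.map_cons, List.sum_cons, ih, List.length_cons]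
    ring

variable [NeZero n]

/-- Everything at a node except the evaluations inside recursive calls is linear: one search, one
walk, one evaluation of φ, and lookups for disjoint sets. The evaluations are paid for by the growth
of `storedCount`. -/
theorem countNode_spec (hG : G.IsChordalGraph) {adj : Fin n → List (Fin n)}
    (hadj : IsAdjList G adj) {D : ℕ} (hD : D = ∑ v, (adj v).length)
    (hDG : D = 2 * G.edgeSet.ncard) {p : Fin n → Bool} (hU : U = (List.finRange n).filter p)
    (hUs : IsSubproblem G {u | u ∈ U}) {pos home : Fin n → ℕ} {T : CliqueTree n}
    (hinj : Set.InjOn pos {u | u ∈ U}) (hpos : ∀ u ∈ U, pos u < U.length)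
    (hP : IsPEO G {u | u ∈ U} pos) (hT : TreeInv G U pos U.length T home) (fact : ℕ → ℕ) {A : ℕ}
    {f : List (Fin n) → Memo n → Timed (ℕ × Memo n)} (hf : CountSpec G A U.length f)
    {L Q : List ℕ} {v sum : ℕ} {m : Memo n} (hm : ∃ key, IsTrie m key)
    (hQ : QueueInv T L (v :: Q)) :
    ∃ Q' sum' m', (countNode adj D fact U (fun v => decide (v ∈ U)) T f (v :: Q, sum, m)).val =
        (Q', sum', m') ∧ QueueInv T (L ++ [v]) Q' ∧ Grows U.length m m' ∧
      (countNode adj D fact U (fun v => decide (v ∈ U)) T f (v :: Q, sum, m)).time +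
        A * storedCount G m ≤ A * storedCount G m' + 299 * (n + D) := by
  have hn : 0 < n := NeZero.pos n
  have hUn : U.Nodup := hU ▸ (List.nodup_finRange n).filter _
  have hv : v < T.num := hQ.lt v (by simp)
  have hQ' := hQ.next hT
  have hchl : (T.children v).length ≤ n := by
    have h1 := hQ'.length_le
    have h2 := hT.sum_length_le hadj hD
    have h3 : T.num ≤ n := by
      have hex : ∀ x < T.num, ∃ t, home t = x := fun x hx => by
        obtain ⟨t, -, -, ht, -⟩ := hT.last x hx
        exact ⟨t, ht⟩
      choose! t ht using hex
      have := Finset.card_le_card_of_injOn (s := Finset.range T.num) (t := Finset.univ) t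
        (fun _ _ => Finset.mem_univ _) (fun x hx y hy hxy => by
          rw [← ht x (by simpa using hx), hxy, ht y (by simpa using hy)])
      simpa using this
    simp only [List.length_append] at h1
    omega
  have hK := hT.isClique hP hv
  have hKn := hT.nodup v hv
  obtain ⟨hC1, hC2, hC3, hC4⟩ := subproblems_spec hG hadj hD hUn hUs hKn
    (fun u hu => (hT.iota_spec hv hu).1) hK (hT.maximal hpos hP hinj hv)
  obtain ⟨hX1, hX2⟩ := forbiddenPrefixes_spec hT hv
  have hS := hT.sum_length_le hadj hD
  have hKc := clique_card_sq_le (G := G) (T.iota v).toFinset (by simpa using hK)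
  rw [List.toFinset_card_of_nodup hKn] at hKc
  have hphi := phi_time fact (T.size v) (forbiddenPrefixes T v).val
  -- With `k = |ι(v)|` this is at most `8 (k + 2)² ≤ 16 k² + 64`, and `k² ≤ n + D` since `ι(v)` is a
  -- clique.
  have hphi' : 8 * ((forbiddenPrefixes T v).val.length + 1) ^ 2 ≤ 16 * (n + D) + 64 := by
    have : ((forbiddenPrefixes T v).val.length + 1) ^ 2 ≤ ((T.iota v).length + 2) ^ 2 :=
      Nat.pow_le_pow_left (by omega) 2
    nlinarith [sq_nonneg ((T.iota v).length - 2 : ℤ)]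
  obtain ⟨hl1, hl2⟩ := forEach_amortized
    (f := fun H (q : ℕ × Memo n) => do
      let a ← f H q.2
      let prod ← op (q.1 * a.1)
      pure (prod, a.2))
    -- `CountSpec` charges `2 |H| + 2` for the call; the multiplication adds one.
    (fun q => Grows U.length m q.2) (fun q => A * storedCount G q.2) (fun H => 2 * H.length + 3)
    (subproblems adj D U (T.iota v) fun v => decide (v ∈ U)).val
    (fun H hH q hq => by
      obtain ⟨⟨p', hp'⟩, hHs, hHl⟩ := hC1 H hH
      obtain ⟨h1, h2⟩ := hf H q.2 ⟨fun u => p u && p' u, by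
        rw [hp', hU, List.filter_filter]
        refine List.filter_congr fun u _ => ?_
        rw [Bool.and_comm]⟩ hHs hHl hq.trie
      refine ⟨hq.trans h1 hHl, ?_⟩
      rw [bind_val, bind_time]
      simp only [op_bind_val, op_bind_time, pure_val, pure_time]
      omega) (s := (1, m)) (Grows.refl _ hm)
  rw [sum_map_length_add _ 4] at hl2
  simp only [countNode, rd_bind_val, rd_bind_time]
  refine ⟨_, _, _, rfl, hQ', hl1, ?_⟩
  rw [bind_time]
  simp only [push_val, push_time, rd_bind_time]
  rw [bind_time, bind_time, bind_time]
  simp only [rd_bind_time]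
  rw [bind_time]
  simp only [op_bind_time, pure_time, rd_val]
  dsimp only at hl2 ⊢
  omega

/-- A call that finds its value only reads the key. Otherwise one more subproblem is stored at the
end, which releases `A`: at most |Π(G)| nodes with `300 (n + D)` steps each, `120 (n + D)` for the
tree and other linear work, and `n²` for new rows of the trie. -/
theorem count_spec (hG : G.IsChordalGraph) {adj : Fin n → List (Fin n)}
    (hadj : IsAdjList G adj) {D : ℕ} (hD : D = ∑ v, (adj v).length)
    (hDG : D = 2 * G.edgeSet.ncard) (fact : ℕ → ℕ) {A : ℕ}
    (hA : 300 * (n + D) * G.maximalCliques.ncard + 120 * (n + D) + n * n ≤ A) (depth ℓ : ℕ) :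
    CountSpec G A ℓ (count adj D fact depth) := by
  have hn : 0 < n := NeZero.pos n
  induction depth generalizing ℓ with
  | zero =>
    intro U m _ _ _ hm
    refine ⟨Grows.refl _ hm, ?_⟩
    simp only [count, op_val, op_time]
    omega
  | succ depth ih =>
    rintro U m ⟨p, hU⟩ hUs - hm
    have hUn : U.Nodup := hU ▸ (List.nodup_finRange n).filter _
    have hUl := length_le_of_nodup hUn
    have h1 := lookup_time m 0 U
    rw [count_succ, bind_val, bind_time]
    cases hfound : (lookup m 0 U).val with
    | some a =>
      dsimp only
      simp only [pure_val, pure_time]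
      exact ⟨Grows.refl _ hm, by omega⟩
    | none =>
      dsimp only
      have hmU : ¬ Stored m U := by simp [Stored, hfound]
      have h2 := mark_time U
      rw [bind_val, bind_time, mark_eq, bind_val, bind_time]
      obtain ⟨⟨pos, home, hinj, hpos, hP, hT⟩, h3⟩ := cliqueTree_spec hG hadj hD hUn
      set T := (cliqueTree adj D U fun v => decide (v ∈ U)).val
      have hnum := hT.num_le hP hinj
      have h0 : 0 < T.num := by
        obtain ⟨S, -, hSF, -⟩ := hUs
        obtain ⟨u, hu⟩ := hSF.nonempty
        have := (hT.home_spec u hu (hpos u hu)).1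
        omega
      simp only [op_bind_val, op_bind_time]
      rw [bind_val, bind_time, bind_val, bind_time]
      obtain ⟨⟨g, hg, hgm⟩, h4⟩ := whileDo_amortized
        (cond := fun r : List ℕ × ℕ × Memo n => !r.1.isEmpty)
        (body := countNode adj D fact U (fun v => decide (v ∈ U)) T (count adj D fact depth))
        -- The list of treated nodes is not part of the state; the number of untreated ones bounds
        -- the number of rounds.
        (fun L r => QueueInv T L r.1 ∧ Grows U.length m r.2.2)
        (fun r => A * storedCount G r.2.2) (fun L => T.num - L.length) (299 * (n + D))
        (by
          rintro L ⟨Q, sum, m'⟩ hc ⟨hQ, hm'⟩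
          cases Q with
          | nil => simp at hc
          | cons v Q =>
            obtain ⟨Q', sum', m'', h5, h6, h7, h8⟩ := countNode_spec (sum := sum) hG hadj
              hD hDG hU hUs hinj hpos hP hT fact (ih U.length) hm'.trie hQ
            refine ⟨L ++ [v], ?_, ?_, ?_⟩
            · rw [h5]
              exact ⟨h6, hm'.trans h7 le_rfl⟩
            · have := hQ.length_le
              simp only [List.length_append, List.length_cons, List.length_nil] at this ⊢
              omega
            · rw [h5]
              exact h8) n (g := []) (s := ([0], 0, m))
        ⟨⟨by simp, by simpa using h0, by simp⟩, Grows.refl _ hm⟩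
      set r := (whileDo n (fun r : List ℕ × ℕ × Memo n => !r.1.isEmpty)
        (countNode adj D fact U (fun v => decide (v ∈ U)) T (count adj D fact depth))
        ([0], 0, m)) with hr
      -- The recursive calls store only keys shorter than `U`, so the insertion below really adds a
      -- subproblem.
      have hrU : ¬ Stored r.val.2.2 U := fun hs => by
        rcases hgm.new U hs with h5 | h5
        · exact hmU h5
        · omega
      obtain ⟨h5, h6⟩ := grows_insert hU hUs hgm.trie hrU r.val.2.1
      have h7 := insert_time r.val.2.1 r.val.2.2 0 U
      simp only [pure_val, pure_time]
      refine ⟨⟨h5.trie, fun k hk => h5.mono k (hgm.mono k hk), fun k hk => ?_⟩, ?_⟩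
      · rcases h5.new k hk with h8 | h8
        · rcases hgm.new k h8 with h9 | h9
          · exact Or.inl h9
          · exact Or.inr (by omega)
        · exact Or.inr h8
      · have h8 := Nat.mul_le_mul_left A h6
        rw [Nat.mul_succ] at h8
        have h9 : (299 * (n + D) + 1) * T.num ≤ 300 * (n + D) * G.maximalCliques.ncard :=
          Nat.mul_le_mul (by omega) hnum
        have h10 : (n + 6) * U.length ≤ n * n + 6 * n :=
          (Nat.mul_le_mul_left _ hUl).trans (by rw [Nat.add_mul])
        simp only [List.length_nil, Nat.sub_zero] at h4
        omega

end Count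

end CliquePicking

namespace CliquePicking

open SimpleGraph

/-! ### The total running time. -/

section CliquePicking

variable {n : ℕ} {G : SimpleGraph (Fin n)}

theorem sum_length_adj {adj : Fin n → List (Fin n)} (hadj : IsAdjList G adj) :
    ∑ v, (adj v).length = 2 * G.edgeSet.ncard := by
  classical
  have h1 : ∀ v, (adj v).length = G.degree v := by
    intro v
    rw [← List.toFinset_card_of_nodup (hadj v).1, ← G.card_neighborFinset_eq_degree]
    congr 1
    ext w
    simp [(hadj v).2]
  rw [Finset.sum_congr rfl fun v _ => h1 v, G.sum_degrees_eq_twice_card_edges,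
    ← G.coe_edgeFinset, Set.ncard_coe_finset]

variable [NeZero n]

/-- The ordering of the whole graph that the count needs is the one produced by the search with `K =
∅`. -/
theorem ncard_subproblems_le (hG : G.IsChordalGraph) {adj : Fin n → List (Fin n)}
    (hadj : IsAdjList G adj) :
    {F | IsSubproblem G F}.ncard ≤ 1 + 2 * G.maximalCliques.ncard := by
  obtain ⟨h1, -⟩ := lbfs_spec hadj rfl (List.nodup_finRange n) (K := []) (by simp) (by simp)
    (by simp)
  have huniv : {u : Fin n | u ∈ List.finRange n} = Set.univ := by simp
  have hP := h1.isPEO hG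
  have hinj := h1.injOn
  rw [huniv] at hP hinj
  exact hP.ncard_subproblems_le (Set.injOn_univ.1 hinj)

/-- The potential starts at a non-negative value and ends at no more than `A` times `1 + 2|Π(G)| ≤
3|Π(G)|`. -/
theorem cliquePicking_time (hconn : G.Connected) (hG : G.IsChordalGraph)
    {adj : Fin n → List (Fin n)} (hadj : IsAdjList G adj) :
    (cliquePicking adj).time ≤
      3000 * (G.maximalCliques.ncard ^ 2 * (n + G.edgeSet.ncard)) := by
  have hn : 0 < n := NeZero.pos n
  have hDG := sum_length_adj hadj
  set D := ∑ v, (adj v).length with hD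
  obtain ⟨h1, h2⟩ := forEach_spec (L := List.finRange n)
    (f := fun v (k : ℕ) => do
      let N ← rd adj v
      let d ← len N
      op (k + d))
    (fun done k => k = (done.map fun v => (adj v).length).sum)
    (fun done _ => 4 * (n - done.length) + 2 * (D - (done.map fun v => (adj v).length).sum))
    (by
      intro done v rest k hL hk
      have hlen := congrArg List.length hL
      have hsum := congrArg (fun l => (l.map fun v => (adj v).length).sum) hL
      have htot : ((List.finRange n).map fun v => (adj v).length).sum = D := by
        rw [hD, Fin.sum_univ_def]
      have ht := len_time (adj v)
      simp only [htot] at hsum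
      simp only [List.length_finRange, List.length_append, List.length_cons, List.map_append,
        List.map_cons, List.sum_append, List.sum_cons] at hlen hsum
      simp only [rd_bind_val, rd_bind_time]
      rw [bind_val, bind_time, len_val]
      simp only [op_val, op_time, List.length_append, List.length_cons, List.map_append,
        List.map_cons, List.sum_append, List.sum_cons, List.length_nil, List.map_nil,
        List.sum_nil]
      exact ⟨by omega, by omega⟩) (s := 0) rfl
  rw [← Fin.sum_univ_def, ← hD] at h1
  simp only [List.length_nil, List.map_nil, List.sum_nil, Nat.sub_zero] at h2
  have h3 := factorials_time n
  have hsq := sq_card_le G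
  have hfam := ncard_subproblems_le hG hadj
  set P := G.maximalCliques.ncard with hPdef
  have hP : 0 < P := by
    by_contra h0
    have : P = 0 := by omega
    rw [this] at hsq
    nlinarith
  have hcount := count_spec hG hadj hD hDG (factorials n).val 
    (A := 300 * (n + D) * P + 120 * (n + D) + n * n) le_rfl n (n + 1)
    (List.finRange n) (emptyMemo : Timed (Memo n)).val ⟨fun _ => true, by simp⟩
    (by simpa using isSubproblem_univ hconn) (by simp) ⟨_, isTrie_emptyMemo⟩
  have hle : ∀ m : Memo n, storedCount G m ≤ 3 * P := fun m =>
    (Set.ncard_le_ncard (fun F hF => hF.1) (Set.toFinite _)).trans (hfam.trans (by omega))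
  obtain ⟨-, h4⟩ := hcount
  have h5 := Nat.mul_le_mul_left (300 * (n + D) * P + 120 * (n + D) + n * n)
    (hle (count adj D (factorials n).val n (List.finRange n)
      (emptyMemo : Timed (Memo n)).val).val.2)
  rw [List.length_finRange] at h4
  have h6 : (count adj D (factorials n).val n (List.finRange n)
      (emptyMemo : Timed (Memo n)).val).time ≤ 1263 * (P ^ 2 * (n + D)) + 2 * n + 2 := by
    have h7 : (300 * (n + D) * P + 120 * (n + D) + n * n) * (3 * P) ≤
        1263 * (P ^ 2 * (n + D)) := by
      -- Here `n² ≤ P (n + D)` by `sq_card_le` and `1 ≤ P`, so the coefficients add up to 300 + 120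
      -- + 1.
      have h8 : 300 * (n + D) * P + 120 * (n + D) + n * n ≤ 421 * (P * (n + D)) := by
        rw [← hDG] at hsq
        nlinarith [Nat.mul_le_mul_right (n + D) hP]
      calc _ ≤ 421 * (P * (n + D)) * (3 * P) := Nat.mul_le_mul_right _ h8
        _ = _ := by ring
    omega
  have hPP : n + D ≤ P ^ 2 * (n + D) := Nat.le_mul_of_pos_left _ (by positivity)
  have hfin : P ^ 2 * (n + D) ≤ 2 * (P ^ 2 * (n + G.edgeSet.ncard)) := by
    rw [hDG]
    nlinarith [Nat.zero_le (P ^ 2 * n)]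
  have htime : (cliquePicking adj).time ≤
      (4 * n + 2 * D + 1) + ((5 * n + 3) + ((n + 1) + (1263 * (P ^ 2 * (n + D)) + 2 * n + 2))) := by
    simp only [cliquePicking]
    rw [bind_time, h1, bind_time, bind_time, bind_time]
    have he : (emptyMemo : Timed (Memo n)).time = n + 1 := rfl
    rw [he, pure_time]
    omega
  -- The linear terms are at most `19 (n + D)`, so the total is at most `1282 P² (n + D)`, and
  -- replacing `D` by twice the number of edges costs a factor of two at most.
  omega

end CliquePicking

end CliquePicking

theorem mainTheorem4 :
    ∃ C : ℕ, ∀ (n : ℕ) [NeZero n] (G : SimpleGraph (Fin n)) (adj : Fin n → List (Fin n)),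
      G.Connected → G.IsChordalGraph → CliquePicking.IsAdjList G adj →
        (CliquePicking.cliquePicking adj).time
          ≤ C * (G.maximalCliques.ncard ^ 2 * (n + G.edgeSet.ncard)) :=
  ⟨3000, fun _ _ _ _ hconn hG hadj => CliquePicking.cliquePicking_time hconn hG hadj⟩
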